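/- **Setting.** Formulas are $A::=a\mid A\to A\mid\Box A$ over a countable set of atoms; $(A_1,\dots,A_k)\to C$ abbreviates $A_1\to(\cdots\to(A_k\to C))$. Modal $\lambda$-terms are $M::=x\mid\lambda x.M\mid MN\mid M[N_1,\dots,N_k/x_1,\dots,x_k]$ ($k\ge 0$; the $x_i$ are distinct and bind in $M$), up to $\alpha$-equivalence and up to simultaneous permutation of the pairs $N_i/x_i$. They are typed in natural deduction by the usual rules of the simply typed $\lambda$-calculus and by: from $\Gamma\vdash N_i:\Box A_i$ ($1\le i\le k$) and $x_1:A_1,\dots,x_k:A_k\vdash M:C$ infer $\Gamma\vdash M[\vec N/\vec x]:\Box C$. Type assignments are also taken up to renaming of the variables of the context. $\Lambda(A_1,\dots,A_n\vdash C)$ is the set of terms $M$ such that $x_1:A_1,\dots,x_n:A_n\vdash M:C$ is derivable. **Normal terms.** $\widehat\Lambda$ is the least set of terms containing - $xN_1\cdots N_k$ ($k\ge 0$) if $N_i\in\widehat\Lambda$ and, for some $\Gamma$, $c$ and $A_i$ with $c$ an atom, $\Gamma\vdash x:(A_1,\dots,A_k)\to c$ and $\Gamma\vdash N_i:A_i$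 are derivable; - $\lambda x.M$ if $M\in\widehat\Lambda$ and $\Gamma,x:A\vdash M:C$ is derivable for some $\Gamma,A,C$; - $M[N_1,\dots,N_k/x_1,\dots,x_k]$ if $M\in\widehat\Lambda$, $FV(M)=\{x_1,\dots,x_k\}$, the $N_i$ are pairwise distinct terms of the form $y_iU_{i1}\cdots U_{ir_i}$ with all $U_{ij}\in\widehat\Lambda$, and $\vec x:\vec B\vdash M:C$ and $\Gamma\vdash N_i:\Box B_i$ are derivable for some $\Gamma,\vec B,C$. **The system $\mathsf{FCK}$** has the following rules, acting on contexts up to exchange ($c$ is an atom). - (ax) $\Gamma,x:c\vdash x:c$. - ($\to_R^*$) From $\Gamma,x_1:A_1,\dots,x_k:A_k\vdash M:C$, with $k\ge1$ and $C$ not an implication, infer $\Gamma\vdash\lambda x_1\cdots x_k.M:(A_1,\dots,A_k)\to C$. - ($\to_L^{ax}$) If $k\ge 1$ and $y:(A_1,\dots,A_k)\to c$ is in $\Gamma$: from $\Gamma\vdash N_i:A_i$ ($1\le i\le k$) infer $\Gamma\vdash yN_1\cdots N_k:c$. - ($\mathsf K^\Box$) If $y_1:\Box A_1,\dots,y_k:\Box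 A_k$ are distinct declarations of $\Gamma$ and $FV(M)=\{x_1,\dots,x_k\}$: from $x_1:A_1,\dots,x_k:A_k\vdash M:C$ infer $\Gamma\vdash M[y_1,\dots,y_k/x_1,\dots,x_k]:\Box C$. - ($\to_L^K$) If $m\ge1$, $N_i=f_iT_{i,1}\cdots T_{i,k_i}$ with $k_i\ge 1$ and $f_i:(A_{i,1},\dots,A_{i,k_i})\to\Box B_i$ in $\Gamma$ ($1\le i\le m$, the $f_i$ not necessarily distinct), and $\vec z$ is a list of variables of $\Gamma$: from all $\Gamma\vdash T_{i,j}:A_{i,j}$ and $\Gamma,x_1:\Box B_1,\dots,x_m:\Box B_m\vdash M[x_1,\dots,x_m,\vec z/y_1,\dots,y_m,\vec w]:\Box C$, with $x_1,\dots,x_m$ fresh, infer $\Gamma\vdash M[N_1,\dots,N_m,\vec z/y_1,\dots,y_m,\vec w]:\Box C$. **Arenas.** The arena of a formula has a vertex, labelled by $a$ or $\Box$, for each occurrence of an atom $a$ or of $\Box$. The arena of an atom is a single vertex; the arena of $A\to B$ is the disjoint union of those of $A$ and $B$ with an additional edge $v\to w$ for each $\to$-root $v$ of $A$ (vertex without outgoing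 edge $\to$) and each $\to$-root $w$ of $B$; the arena of $\Box A$ has one more vertex than that of $A$, labelled $\Box$, and no additional edge $\to$ (its further modal edges only record the scope of $\Box$). The arena of $A_1,\dots,A_n\vdash C$ is that of $(A_1,\dots,A_n)\to C$. All $\to$-paths from $v$ to $\to$-roots have the same length, the depth of $v$. The address $\mathrm{add}(v)$ is the list, outermost first, of the occurrences of $\Box$ that have $v$ in their scope. **Strategies.** A play is a finite sequence $s_0s_1\cdots s_\ell$ (possibly empty, $\epsilon$) of vertices not labelled $\Box$ with a pointer $f(i)<i$ for each $i\ge1$, such that $s_0$ is a $\to$-root, $s_i\to s_{f(i)}$, and the parities of the depths alternate. It is a view if $f(2k)=2k-1$ for $k\ge1$, and $s_{2k+1}$ has the same label as $s_{2k}$. A winning innocent strategy is a finite non-empty prefix-closed set $\mathcal S$ of views such that, if $p\in\mathcal S$ has even length, every view extending $p$ by one move is in $\mathcal S$, and, if $p\in\mathcal S$ has odd length, exactly one view extending $p$ by one move is in $\mathcal S$. A view $p$ is well-batched if $\mathrm{add}(s_{2k})$ and $\mathrm{add}(s_{2k+1})$ have the same length whenever both moves exist; then let $\sim_p$ be the equivalence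 relation on vertices generated by $s_{2k}\sim_p s_{2k+1}$ and, for each $h$, ($h$-th element of $\mathrm{add}(s_{2k})$) $\sim_p$ ($h$-th element of $\mathrm{add}(s_{2k+1})$). $\mathcal S$ is a $\mathsf{CK}$-winning innocent strategy if moreover all its views $p$ are well-batched and each $\sim_p$-class of vertices involved in one of these generating pairs contains exactly one vertex of even depth. It is trivial if $\mathcal S=\{\epsilon\}$. **Strategy of a derivation.** An $\mathsf{FCK}$-derivation $\mathcal D$ of $\Gamma\vdash T:C$ determines a set $[\![\mathcal D]\!]$ of pointed sequences over the arena of $\Gamma\vdash C$; vertices of the arenas of the premises are identified with the corresponding vertices of the arena of the conclusion. Here $c$ is the head of the conclusion $C$, that is, the unique $\to$-root of its arena not labelled $\Box$, and $c'$ is the head of the declaration used. - For (ax), $[\![\mathcal D]\!]=\{\epsilon,c,cc'\}$. - For ($\to_R^*$) and ($\mathsf K^\Box$), $[\![\mathcal D]\!]$ is the set of the premise. - For ($\to_L^{ax}$) with premises $\mathcal D_i$, $[\![\mathcal D]\!]=\{\epsilon,c,cc'\}\cup\{cc'p\mid\epsilon\ne p\in[\![\mathcal D_i]\!],\ 1\le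 i\le k\}$. - For ($\to_L^K$) with main premise $\mathcal D_0$ and other premises $\mathcal D_{i,j}$, $[\![\mathcal D]\!]=[\![\mathcal D_0]\!]\cup\{qp\mid q\in[\![\mathcal D_0]\!]\text{ ends with the head of the declaration }x_i:\Box B_i,\ \epsilon\ne p\in[\![\mathcal D_{i,j}]\!]\}$. In $qp$ (or $cc'p$, with $q=cc'$) the first move of $p$ points to the last move of $q$; a move of $p$ in $\Gamma$ that pointed to the first move of $p$ points to the first move of $q$; the other pointers are unchanged. **Statement.** Let $\mathcal S$ be a non-trivial $\mathsf{CK}$-winning innocent strategy over the arena of $A_1,\dots,A_n\vdash C$. Then there is a term $T_{\mathcal S}\in\widehat\Lambda\cap\Lambda(A_1,\dots,A_n\vdash C)$ such that the type assignment $x_1:A_1,\dots,x_n:A_n\vdash T_{\mathcal S}:C$ has exactly one derivation $\mathcal D_{\mathcal S}$ in $\mathsf{FCK}$ (up to exchange, and for every order in which the explicit substitutions of $T_{\mathcal S}$ are written), and $[\![\mathcal D_{\mathcal S}]\!]=\mathcal S$. The term is canonical: any $T'\in\widehat\Lambda$ having an $\mathsf{FCK}$-derivation $\mathcal D'$ of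 $x_1:A_1,\dots,x_n:A_n\vdash T':C$ with $[\![\mathcal D']\!]=\mathcal S$ equals $T_{\mathcal S}$. Moreover $\mathcal D_{\mathcal S}$ is built by induction on $(|\mathcal S|,|C|)$: for each subderivation $\mathcal D'$ of $\mathcal D_{\mathcal S}$, with conclusion $\Gamma'\vdash T':C'$, the set $[\![\mathcal D']\!]$ is a $\mathsf{CK}$-winning innocent strategy over the arena of $\Gamma'\vdash C'$, and $(|[\![\mathcal D']\!]|,|C'|)$ strictly decreases in the lexicographic order from the conclusion of each rule to each of its premises, where $|C'|$ is the number of symbols of $C'$. -/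

import Mathlib

namespace CKGame

/-! ## Formulas -/

/-- Formulas `A ::= a | A → A | □A` over countably many propositional variables. -/
inductive Formula : Type
  | atom (a : ℕ) : Formula
  | imp (A B : Formula) : Formula
  | box (A : Formula) : Formula

/-- The size `|A|` of a formula (number of symbols). -/
def Formula.size : Formula → ℕ
  | .atom _ => 1
  | .imp A B => A.size + B.size + 1
  | .box A => A.size + 1

/-- `C` is not an implication. -/
def Formula.NotImp (C : Formula) : Prop := ∀ A B : Formula, C ≠ Formula.imp A B

/-- Krivine's `(A₁, …, Aₖ) → C`. -/
def imps {k : ℕ} (A : Fin k → Formula) (C : Formula) : Formula :=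
  (List.ofFn A).foldr Formula.imp C

/-! ## Modal λ-terms

`Tm n` is the type of terms whose free variables are among `n` variables. Variables are represented
by their position (a newly bound variable is the last one), so that α-equivalent terms, and
α-equivalent type assignments, are equal. -/

/-- `var x`, `λx.M`, `M N`, and `M[N₁,…,Nₖ/x₁,…,xₖ]`, in which the `k` variables of `M` are bound. -/
inductive Tm : ℕ → Type
  | var {n : ℕ} (x : Fin n) : Tm n
  | lam {n : ℕ} (M : Tm (n + 1)) : Tm n
  | app {n : ℕ} (M N : Tm n) : Tm n
  | esub {n k : ℕ} (M : Tm k) (N : Fin k → Tm n) : Tm n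

/-- The extension of a renaming under one binder. -/
def liftRen {n m : ℕ} (ρ : Fin n → Fin m) : Fin (n + 1) → Fin (m + 1) :=
  Fin.lastCases (Fin.last m) (fun i => (ρ i).castSucc)

/-- Renaming of free variables. -/
def Tm.rename : {n m : ℕ} → (Fin n → Fin m) → Tm n → Tm m
  | _, _, ρ, .var x => .var (ρ x)
  | _, _, ρ, .lam M => .lam (M.rename (liftRen ρ))
  | _, _, ρ, .app M N => .app (M.rename ρ) (N.rename ρ)
  | _, _, ρ, .esub M N => .esub M (fun i => (N i).rename ρ)

/-- The congruence generated by the permutations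
`M[N₁,…,Nₖ/x₁,…,xₖ] = M[N_σ(1),…,N_σ(k)/x_σ(1),…,x_σ(k)]`. -/
inductive PermEq : {n : ℕ} → Tm n → Tm n → Prop
  | refl {n : ℕ} (M : Tm n) : PermEq M M
  | symm {n : ℕ} {M N : Tm n} : PermEq M N → PermEq N M
  | trans {n : ℕ} {M N P : Tm n} : PermEq M N → PermEq N P → PermEq M P
  | lam {n : ℕ} {M M' : Tm (n + 1)} : PermEq M M' → PermEq (.lam M) (.lam M')
  | app {n : ℕ} {M M' N N' : Tm n} : PermEq M M' → PermEq N N' →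
      PermEq (.app M N) (.app M' N')
  | esub {n k : ℕ} {M M' : Tm k} {N N' : Fin k → Tm n} : PermEq M M' →
      (∀ i, PermEq (N i) (N' i)) → PermEq (.esub M N) (.esub M' N')
  | perm {n k : ℕ} (M : Tm k) (N : Fin k → Tm n) (σ : Equiv.Perm (Fin k)) :
      PermEq (.esub M N) (.esub (M.rename σ.symm) (fun i => N (σ i)))

/-- The setoid of the permutation congruence. -/
instance termSetoid (n : ℕ) : Setoid (Tm n) where
  r := PermEq
  iseqv := ⟨PermEq.refl, PermEq.symm, PermEq.trans⟩

/-- Modal λ-terms: syntax up to α-equivalence and permutation of explicit substitutions. -/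
abbrev Term (n : ℕ) : Type := Quotient (termSetoid n)

/-- The variable `x` occurs free in the term. -/
def Occurs : {n : ℕ} → Tm n → Fin n → Prop
  | _, .var y, x => x = y
  | _, .lam M, x => Occurs M x.castSucc
  | _, .app M N, x => Occurs M x ∨ Occurs N x
  | _, .esub _ N, x => ∃ i, Occurs (N i) x

/-- `M N₁ ⋯ Nₖ`. -/
def apps {n k : ℕ} (M : Tm n) (N : Fin k → Tm n) : Tm n :=
  (List.ofFn N).foldl Tm.app M

/-- `λx₁ ⋯ λxₖ. M`. -/
def lams {n : ℕ} : (k : ℕ) → Tm (n + k) → Tm n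
  | 0, M => M
  | k + 1, M => lams k (Tm.lam M)

/-! ## Natural deduction and the terms in normal form -/

/-- Typability `Γ ⊢ M : C` in natural deduction for `CK`. -/
inductive ND : {n : ℕ} → (Fin n → Formula) → Tm n → Formula → Prop
  | id {n : ℕ} (Γ : Fin n → Formula) (x : Fin n) : ND Γ (.var x) (Γ x)
  | abs {n : ℕ} {Γ : Fin n → Formula} {A C : Formula} {M : Tm (n + 1)} :
      ND (Fin.snoc (α := fun _ => Formula) Γ A) M C → ND Γ (.lam M) (.imp A C)
  | app {n : ℕ} {Γ : Fin n → Formula} {A C : Formula} {M N : Tm n} :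
      ND Γ N A → ND Γ M (.imp A C) → ND Γ (.app M N) C
  | boxSubst {n k : ℕ} {Γ : Fin n → Formula} {A : Fin k → Formula} {C : Formula}
      {M : Tm k} {N : Fin k → Tm n} :
      (∀ i, ND Γ (N i) (.box (A i))) → ND A M C → ND Γ (.esub M N) (.box C)

/-- Representatives of the terms in `Λ̂`. -/
inductive IsNormal : {n : ℕ} → Tm n → Prop
  | neutral {n k : ℕ} (Γ : Fin n → Formula) (x : Fin n) (N : Fin k → Tm n)
      (A : Fin k → Formula) (c : ℕ) :
      (∀ i, IsNormal (N i)) → ND Γ (.var x) (imps A (.atom c)) → (∀ i, ND Γ (N i) (A i)) →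
      IsNormal (apps (.var x) N)
  | lam {n : ℕ} (Γ : Fin n → Formula) (A C : Formula) (M : Tm (n + 1)) :
      IsNormal M → ND (Fin.snoc (α := fun _ => Formula) Γ A) M C → IsNormal (.lam M)
  | esub {n k : ℕ} (Γ : Fin n → Formula) (B : Fin k → Formula) (C : Formula)
      (M : Tm k) (N : Fin k → Tm n) (y : Fin k → Fin n) (r : Fin k → ℕ)
      (U : ∀ i, Fin (r i) → Tm n) :
      IsNormal M → (∀ x, Occurs M x) → ND B M C →
      (∀ i j, i ≠ j → ¬ PermEq (N i) (N j)) →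
      (∀ i, N i = apps (.var (y i)) (U i)) → (∀ i j, IsNormal (U i j)) →
      (∀ i, ND Γ (N i) (.box (B i))) →
      IsNormal (.esub M N)

/-- The set `Λ̂`. -/
def normalTerms (n : ℕ) : Set (Term n) := {T | ∃ t : Tm n, ⟦t⟧ = T ∧ IsNormal t}

/-- The set `Λ(A₁,…,Aₙ ⊢ C)`. -/
def typableTerms {n : ℕ} (Γ : Fin n → Formula) (C : Formula) : Set (Term n) :=
  {T | ∃ t : Tm n, ⟦t⟧ = T ∧ ND Γ t C}

/-! ## The type system `FCK` -/

/-- `FCK Γ T C` is the type of `FCK`-derivations of `Γ ⊢ T : C`. The exchange rule is left implicit: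
rules act on declarations at arbitrary positions of the context. -/
inductive FCK : {n : ℕ} → (Fin n → Formula) → Tm n → Formula → Type
  /-- `Γ, x : c ⊢ x : c`. -/
  | ax {n : ℕ} {Γ : Fin n → Formula} {T : Tm n} {D : Formula} (x : Fin n) (c : ℕ)
      (hx : Γ x = .atom c) (hT : T = .var x) (hD : D = .atom c) : FCK Γ T D
  /-- `Γ ⊢ λx₁⋯xₖ.M : (A₁,…,Aₖ) → C` from `Γ, x₁ : A₁, …, xₖ : Aₖ ⊢ M : C`; all the premises of the
  implication are introduced at once. -/
  | impR {n : ℕ} {Γ : Fin n → Formula} {T : Tm n} {D : Formula} (k : ℕ) (hk : 0 < k)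
      (A : Fin k → Formula) (M : Tm (n + k)) (C : Formula) (hC : C.NotImp)
      (hT : T = lams k M) (hD : D = imps A C)
      (d : FCK (Fin.append Γ A) M C) : FCK Γ T D
  /-- `Γ, y : (A₁,…,Aₖ) → c ⊢ y N₁ ⋯ Nₖ : c`, with `k ≥ 1` (`k = 0` is the axiom). -/
  | impLax {n : ℕ} {Γ : Fin n → Formula} {T : Tm n} {D : Formula} (y : Fin n) (k : ℕ)
      (hk : 0 < k) (A : Fin k → Formula) (N : Fin k → Tm n) (c : ℕ)
      (hy : Γ y = imps A (.atom c)) (hT : T = apps (.var y) N) (hD : D = .atom c)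
      (d : ∀ i, FCK Γ (N i) (A i)) : FCK Γ T D
  /-- `Δ, y₁ : □A₁, …, yₖ : □Aₖ ⊢ M[y₁,…,yₖ/x₁,…,xₖ] : □C` from `x₁ : A₁, …, xₖ : Aₖ ⊢ M : C`,
  where `FV(M) = {x₁,…,xₖ}`. -/
  | boxK {n : ℕ} {Γ : Fin n → Formula} {T : Tm n} {D : Formula} (k : ℕ) (M : Tm k)
      (y : Fin k → Fin n) (A : Fin k → Formula) (C : Formula)
      (hy : Function.Injective y) (hΓ : ∀ i, Γ (y i) = .box (A i)) (hM : ∀ x, Occurs M x)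
      (hT : T = .esub M (fun i => .var (y i))) (hD : D = .box C)
      (d : FCK A M C) : FCK Γ T D
  /-- From `Γ ⊢ U i j : A i j` and `Γ, x₁ : □B₁, …, xₘ : □Bₘ ⊢ M[N'] : □C` infer `Γ ⊢ M[N] : □C`.
  The arguments of the explicit substitution `M[N]` that are applications are those in the
  positions `e 1 < … < e m` (with `m ≥ 1`); the one in position `e i` is `f i` applied to
  `U i 1, …, U i (r i)`, where `r i ≥ 1` and `f i : (A i 1, …, A i (r i)) → □(B i)` is declared in
  `Γ`. In `N'` it is replaced by the new variable `x i`. All other arguments are variables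
  of `Γ`. -/
  | impLK {n : ℕ} {Γ : Fin n → Formula} {T : Tm n} {D : Formula} (k m : ℕ) (hm : 0 < m)
      (M : Tm k) (N : Fin k → Tm n) (N' : Fin k → Tm (n + m)) (e : Fin m → Fin k)
      (f : Fin m → Fin n) (r : Fin m → ℕ) (A : ∀ i, Fin (r i) → Formula)
      (U : ∀ i, Fin (r i) → Tm n) (B : Fin m → Formula) (C : Formula)
      (he : StrictMono e) (hr : ∀ i, 0 < r i) (hf : ∀ i, Γ (f i) = imps (A i) (.box (B i)))
      (hN : ∀ i, N (e i) = apps (.var (f i)) (U i) ∧ N' (e i) = .var (Fin.natAdd n i))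
      (hz : ∀ j, j ∉ Set.range e → ∃ z : Fin n, N j = .var z ∧ N' j = .var (Fin.castAdd m z))
      (hT : T = .esub M N) (hD : D = .box C)
      (d : ∀ i j, FCK Γ (U i j) (A i j))
      (d₀ : FCK (Fin.append Γ (fun i => .box (B i))) (.esub M N') (.box C)) : FCK Γ T D

/-! ## Arenas

The vertices of the arena of a formula are written as words: in the disjoint union forming the arena
of `A → B`, the vertex `v` of `A` is `false :: v` and the vertex `w` of `B` is `true :: w`. In the
arena of `□A`, the new vertex is `[false]` and the vertex `w` of `A` is `true :: w`. -/

/-- Vertices, as words. -/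
abbrev Vertex : Type := List Bool

/-- Labels: propositional variables, or `□`. -/
inductive Label : Type
  | atom (a : ℕ) : Label
  | box : Label

/-- The label of a vertex of the arena of a formula (`none` on words that are not vertices). -/
def label : Formula → Vertex → Option Label
  | .atom a, [] => some (.atom a)
  | .atom _, _ :: _ => none
  | .imp _ _, [] => none
  | .imp A _, false :: v => label A v
  | .imp _ B, true :: v => label B v
  | .box _, [] => none
  | .box _, [false] => some .box
  | .box _, false :: _ :: _ => none
  | .box A, true :: v => label A v

/-- `v` is a vertex of the arena of `F`. -/
def IsVertex (F : Formula) (v : Vertex) : Prop := label F v ≠ none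

/-- The edges `→` of the arena: the arena of `A → B` gets an edge from each `→`-root of `A` to each
`→`-root of `B`. -/
def iEdge : Formula → Vertex → Vertex → Prop
  | .atom _, _, _ => False
  | .imp A _, false :: v, false :: w => iEdge A v w
  | .imp _ B, true :: v, true :: w => iEdge B v w
  | .imp A B, false :: v, true :: w =>
      (IsVertex A v ∧ ∀ u, ¬ iEdge A v u) ∧ (IsVertex B w ∧ ∀ u, ¬ iEdge B w u)
  | .imp _ _, _, _ => False
  | .box A, true :: v, true :: w => iEdge A v w
  | .box _, _, _ => False

/-- `→`-roots. -/
def IRoot (F : Formula) (v : Vertex) : Prop := IsVertex F v ∧ ∀ u, ¬ iEdge F v u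

/-- The address of a vertex: the list of the modalities of the formula having it in their scope,
outermost first. -/
def addr : Formula → Vertex → List Vertex
  | .imp A _, false :: v => (addr A v).map (List.cons false)
  | .imp _ B, true :: v => (addr B v).map (List.cons true)
  | .box A, true :: v => [false] :: (addr A v).map (List.cons true)
  | _, _ => []

/-- `IPath F ℓ v w`: there is an `→`-path of length `ℓ` from `v` to `w`. -/
inductive IPath (F : Formula) : ℕ → Vertex → Vertex → Prop
  | nil (v : Vertex) : IPath F 0 v v
  | cons {ℓ : ℕ} {v u w : Vertex} : iEdge F v u → IPath F ℓ u w → IPath F (ℓ + 1) v w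

/-- The length of the `→`-paths from a vertex to the `→`-roots (see `depth_eq_of_path`). -/
def depth : Formula → Vertex → ℕ
  | .imp A _, false :: v => depth A v + 1
  | .imp _ B, true :: v => depth B v
  | .box A, true :: v => depth A v
  | _, _ => 0

/-- The unique `→`-root that is not labelled by `□`. -/
def headV : Formula → Vertex
  | .atom _ => []
  | .imp _ B => true :: headV B
  | .box A => true :: headV A

theorem IRoot_headV (F : Formula) : IRoot F (headV F) := by
  induction F with
  | atom a => exact ⟨by simp [IsVertex, headV, label], fun u h => by simp [iEdge] at h⟩
  | imp A B _ ihB =>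
    refine ⟨by simpa [IsVertex, headV, label] using ihB.1, fun u h => ?_⟩
    match u, h with
    | [], h => simp [headV, iEdge] at h
    | false :: u, h => simp [headV, iEdge] at h
    | true :: u, h => exact ihB.2 u (by simpa [headV, iEdge] using h)
  | box A ih =>
    refine ⟨by simpa [IsVertex, headV, label] using ih.1, fun u h => ?_⟩
    match u, h with
    | [], h => simp [headV, iEdge] at h
    | false :: u, h => simp [headV, iEdge] at h
    | true :: u, h => exact ih.2 u (by simpa [headV, iEdge] using h)

theorem depth_eq_zero {F : Formula} {v : Vertex} (h : IRoot F v) : depth F v = 0 := by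
  induction F generalizing v with
  | atom a => rfl
  | imp A B _ ihB =>
    match v, h with
    | [], _ => rfl
    | true :: v, h =>
      exact ihB ⟨by simpa [IsVertex, label] using h.1, fun u hu => h.2 (true :: u) hu⟩
    | false :: v, h =>
      have hv : IsVertex A v := by simpa [IsVertex, label] using h.1
      exact absurd ⟨⟨hv, fun u hu => h.2 (false :: u) hu⟩, IRoot_headV B⟩
        (h.2 (true :: headV B))
  | box A ih =>
    match v, h with
    | [], _ => rfl
    | false :: _, _ => rfl
    | true :: v, h =>
      exact ih ⟨by simpa [IsVertex, label] using h.1, fun u hu => h.2 (true :: u) hu⟩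

theorem depth_edge {F : Formula} {v w : Vertex} (h : iEdge F v w) :
    depth F v = depth F w + 1 := by
  induction F generalizing v w with
  | atom a => simp [iEdge] at h
  | imp A B ihA ihB =>
    match v, w, h with
    | false :: v, false :: w, h => simpa [depth] using ihA h
    | true :: v, true :: w, h => exact ihB h
    | false :: v, true :: w, h =>
      have h1 : depth A v = 0 := depth_eq_zero h.1
      have h2 : depth B w = 0 := depth_eq_zero h.2
      simp [depth, h1, h2]
    | true :: v, false :: w, h => simp [iEdge] at h
    | [], _, h => simp [iEdge] at h
    | _ :: _, [], h => simp [iEdge] at h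
  | box A ih =>
    match v, w, h with
    | true :: v, true :: w, h => exact ih h
    | false :: v, _, h => simp [iEdge] at h
    | true :: v, false :: w, h => simp [iEdge] at h
    | [], _, h => simp [iEdge] at h
    | _ :: _, [], h => simp [iEdge] at h

/-- All `→`-paths from a vertex to `→`-roots have length `depth`. -/
theorem depth_eq_of_path {F : Formula} {l : ℕ} {v w : Vertex} (hp : IPath F l v w)
    (hw : IRoot F w) : depth F v = l := by
  induction hp with
  | nil v => exact depth_eq_zero hw
  | cons h _ ih => rw [depth_edge h, ih hw]

/-! ## Views and strategies -/

/-- Sequences of moves with pointers. The entry in position `i` (counted from `0`) is the pair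
`(sᵢ, f(i))`; `f(0)`, which is meaningless, is fixed to be `0` in plays. -/
abbrev PSeq : Type := List (Vertex × ℕ)

/-- Plays: moves are vertices not labelled by `□`, the first one is an `→`-root, each other one
points to an earlier move it has an edge to, and polarities (the parities of the depth) alternate. -/
structure IsPlay (F : Formula) (p : PSeq) : Prop where
  moves : ∀ s ∈ p, ∃ a, label F s.1 = some (.atom a)
  initial : ∀ s, p[0]? = some s → IRoot F s.1 ∧ s.2 = 0
  pointer : ∀ i s, p[i + 1]? = some s → s.2 < i + 1 ∧ ∃ t, p[s.2]? = some t ∧ iEdge F s.1 t.1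
  alternating : ∀ i s t, p[i]? = some s → p[i + 1]? = some t →
    (Even (depth F s.1) ↔ Odd (depth F t.1))

/-- Views: `∘`-shortsighted and `•`-uniform plays. -/
structure IsView (F : Formula) (p : PSeq) : Prop extends IsPlay F p where
  shortsighted : ∀ k s, p[2 * k + 2]? = some s → s.2 = 2 * k + 1
  uniform : ∀ k s t, p[2 * k]? = some s → p[2 * k + 1]? = some t → label F t.1 = label F s.1

/-- Winning innocent strategies. -/
structure IsWIS (F : Formula) (S : Set PSeq) : Prop where
  finite : S.Finite
  nonempty : S.Nonempty
  prefixClosed : ∀ p ∈ S, ∀ q, q <+: p → q ∈ S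
  views : ∀ p ∈ S, IsView F p
  opponentComplete : ∀ p ∈ S, Even p.length → ∀ s, IsView F (p ++ [s]) → p ++ [s] ∈ S
  playerTotal : ∀ p ∈ S, Odd p.length → ∃! s, p ++ [s] ∈ S

/-- `h_p = 1 + max {|add v| : v ∈ p}`. -/
def height (F : Formula) (p : PSeq) : ℕ :=
  1 + (p.map (fun s => (addr F s.1).length)).foldr max 0

/-- The entry in row `h` and column `i` of the batched view of `p` (`none` stands for `ε`): row `0`
holds the moves, and the address of the `i`-th move fills the last rows of column `i`. -/
def batch (F : Formula) (p : PSeq) (h i : ℕ) : Option Vertex :=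
  (p[i]?).bind fun s =>
    if h = 0 then some s.1
    else if h ≤ height F p - (addr F s.1).length then none
    else (addr F s.1)[h - (height F p - (addr F s.1).length) - 1]?

/-- Well-batched views: the moves in positions `2k` and `2k+1` have addresses of equal length. -/
def WellBatched (F : Formula) (p : PSeq) : Prop :=
  ∀ k s t, p[2 * k]? = some s → p[2 * k + 1]? = some t →
    (addr F s.1).length = (addr F t.1).length

/-- The relation on vertices that generates the equivalence relation induced by `p`. -/
def Link (F : Formula) (p : PSeq) (u w : Vertex) : Prop :=
  ∃ k h, 2 * k + 1 < p.length ∧ h ≤ height F p ∧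
    batch F p h (2 * k) = some u ∧ batch F p h (2 * k + 1) = some w

/-- Linked strategies: views are well-batched, and each class of vertices linked in a view
contains exactly one vertex of even depth. -/
def Linked (F : Formula) (S : Set PSeq) : Prop :=
  ∀ p ∈ S, WellBatched F p ∧
    ∀ v, (∃ x, Link F p v x ∨ Link F p x v) →
      ∃! w, Relation.EqvGen (Link F p) v w ∧ Even (depth F w)

/-- `CK`-winning innocent strategies. -/
def IsCKWIS (F : Formula) (S : Set PSeq) : Prop := IsWIS F S ∧ Linked F S

/-! ## The strategy read off an `FCK`-derivation

In the arena of `A₁,…,Aₙ ⊢ C`, that is of `(A₁,…,Aₙ) → C`, vertices belong either to one of the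
`Aᵢ` or to `C`. -/

/-- The vertex `v` of the `i`-th hypothesis. -/
def hypV (i : ℕ) (v : Vertex) : Vertex := List.replicate i true ++ false :: v

/-- The vertex `v` of the conclusion of a sequent with `n` hypotheses. -/
def conV (n : ℕ) (v : Vertex) : Vertex := List.replicate n true ++ v

/-- Decompose a vertex of the arena of a sequent with `n` hypotheses. -/
def splitV : (n : ℕ) → Vertex → (Fin n × Vertex) ⊕ Vertex
  | 0, v => .inr v
  | _ + 1, [] => .inr []
  | _ + 1, false :: v => .inl (0, v)
  | n + 1, true :: v =>
    match splitV n v with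
    | .inl (i, w) => .inl (i.succ, w)
    | .inr w => .inr w

/-- Apply a map of vertices to all the moves, keeping the pointers. -/
def mapMoves (g : Vertex → Vertex) (p : PSeq) : PSeq := p.map (fun s => (g s.1, s.2))

/-- Transport a view `p` over `Γ ⊢ A` so that it can be played after a view `q` of length `b` over
`Γ ⊢ C` whose last move is the head of a hypothesis having `A` among its arguments; `A` is located in
that hypothesis by the word `π`. The first move of `p` now points to the last move of `q`; the moves
of `p` in `Γ` that pointed to the first move of `p` now point to the first move of `q`; the other
pointers are shifted. -/
def graft (n : ℕ) (π : Vertex) (b : ℕ) (p : PSeq) : PSeq :=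
  p.mapIdx fun t s =>
    match splitV n s.1 with
    | .inl _ => (s.1, if s.2 = 0 then 0 else s.2 + b)
    | .inr v => (π ++ v, if t = 0 then b - 1 else s.2 + b)

/-- From the arena of `A₁,…,Aₖ ⊢ C` to that of `Γ ⊢ □C`, where `□Aᵢ` is the hypothesis `y i`. -/
def boxMap (n : ℕ) {k : ℕ} (y : Fin k → Fin n) (v : Vertex) : Vertex :=
  match splitV k v with
  | .inl (i, w) => hypV (y i) (true :: w)
  | .inr w => conV n (true :: w)

/-- From the arena of `Γ, □B₁,…,□Bₘ ⊢ □C` to that of `Γ ⊢ □C`, where `□Bᵢ` is the target of the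
hypothesis `f i`, which has `r i` arguments. -/
def headMap (n : ℕ) {m : ℕ} (f : Fin m → Fin n) (r : Fin m → ℕ) (v : Vertex) : Vertex :=
  match splitV (n + m) v with
  | .inl (i, w) =>
      Fin.addCases (motive := fun _ => Vertex) (fun j => hypV j w)
        (fun i => hypV (f i) (List.replicate (r i) true ++ w)) i
  | .inr w => conV n w

/-- The strategy over the arena of `Γ ⊢ C` read off a derivation of `Γ ⊢ T : C`: it is
* `{ε, c, cc}` for an axiom;
* the strategy of the premise (up to the identification of vertices) for `impR` and `boxK`;
* `{ε, c, cc}` together with the views `c c p`, with `p ≠ ε` in the strategy of a premise,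
  for `impLax`;
* for `impLK`, the strategy of the main premise together with the views `q p`, where `q` is a view of
  the main premise that ends with the head of the new hypothesis `□(B i)` and `p ≠ ε` is a
  view of the premise for one of the arguments `U i j`. -/
def strategyOf : {n : ℕ} → {Γ : Fin n → Formula} → {T : Tm n} → {C : Formula} →
    FCK Γ T C → Set PSeq
  | n, _, _, _, .ax x _ _ _ _ =>
      {[], [(conV n [], 0)], [(conV n [], 0), (hypV x [], 0)]}
  | _, _, _, _, .impR _ _ _ _ _ _ _ _ d => strategyOf d
  | n, _, _, _, .impLax y k _ _ _ _ _ _ _ d =>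
      {[], [(conV n [], 0)], [(conV n [], 0), (hypV y (conV k []), 0)]} ∪
      {p | ∃ i, ∃ q ∈ strategyOf (d i), q ≠ [] ∧
        p = [(conV n [], 0), (hypV y (conV k []), 0)] ++ graft n (hypV y (hypV i [])) 2 q}
  | n, _, _, _, .boxK _ _ y _ _ _ _ _ _ _ d => mapMoves (boxMap n y) '' strategyOf d
  | n, _, _, _, .impLK _ _ _ _ _ _ _ f r _ _ B _ _ _ _ _ _ _ _ d d₀ =>
      mapMoves (headMap n f r) '' strategyOf d₀ ∪
      {p | ∃ i j, ∃ q ∈ strategyOf d₀, ∃ q' ∈ strategyOf (d i j), q' ≠ [] ∧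
        q.getLast?.map Prod.fst = some (hypV (n + i) (headV (.box (B i)))) ∧
        p = mapMoves (headMap n f r) q ++ graft n (hypV (f i) (hypV j [])) q.length q'}

/-- The pair `(|S|, |C|)` for the strategy `S` of a derivation of `Γ ⊢ T : C`. -/
noncomputable def measureOf {n : ℕ} {Γ : Fin n → Formula} {T : Tm n} {C : Formula}
    (d : FCK Γ T C) : ℕ ×ₗ ℕ := toLex ((strategyOf d).ncard, C.size)

/-- The derivation proceeds by induction on `(|S|, |C|)`: the strategy of each of its
subderivations is a `CK`-winning innocent strategy over the arena of the conclusion of that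
subderivation, and the pair `(|S|, |C|)` strictly decreases, in the lexicographic order,
from the conclusion of each rule to its premises. -/
def BuiltByInduction : {n : ℕ} → {Γ : Fin n → Formula} → {T : Tm n} → {C : Formula} →
    FCK Γ T C → Prop
  | _, Γ, _, C, .ax x c hx hT hD =>
      IsCKWIS (imps Γ C) (strategyOf (FCK.ax x c hx hT hD))
  | _, Γ, _, C, .impR k hk A M C' hC hT hD d =>
      IsCKWIS (imps Γ C) (strategyOf (FCK.impR k hk A M C' hC hT hD d)) ∧
      measureOf d < measureOf (FCK.impR k hk A M C' hC hT hD d) ∧ BuiltByInduction d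
  | _, Γ, _, C, .impLax y k hk A N c hy hT hD d =>
      IsCKWIS (imps Γ C) (strategyOf (FCK.impLax y k hk A N c hy hT hD d)) ∧
      ∀ i, measureOf (d i) < measureOf (FCK.impLax y k hk A N c hy hT hD d) ∧
        BuiltByInduction (d i)
  | _, Γ, _, C, .boxK k M y A C' hy hΓ hM hT hD d =>
      IsCKWIS (imps Γ C) (strategyOf (FCK.boxK k M y A C' hy hΓ hM hT hD d)) ∧
      measureOf d < measureOf (FCK.boxK k M y A C' hy hΓ hM hT hD d) ∧ BuiltByInduction d
  | _, Γ, _, C, .impLK k m hm M N N' e f r A U B C' he hr hf hN hz hT hD d d₀ =>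
      IsCKWIS (imps Γ C)
        (strategyOf (FCK.impLK k m hm M N N' e f r A U B C' he hr hf hN hz hT hD d d₀)) ∧
      (∀ i j, measureOf (d i j) <
          measureOf (FCK.impLK k m hm M N N' e f r A U B C' he hr hf hN hz hT hD d d₀) ∧
        BuiltByInduction (d i j)) ∧
      measureOf d₀ <
        measureOf (FCK.impLK k m hm M N N' e f r A U B C' he hr hf hN hz hT hD d d₀) ∧
      BuiltByInduction d₀

end CKGame

open CKGame

/-! The linking condition forbids repeated moves in a view. If an opponent move is repeated, so is
the player move just before it, its justifier. If a player move is repeated, the two opponent moves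
just before its occurrences are linked to the same vertex; both have even depth and a class contains
only one such vertex, so they are equal. Descending in this way, one would repeat the initial move,
which is impossible (`nodup_of_linked`). Among moves, each one other than the head of the formula
has a single possible justifier (`par`). Pointers therefore carry no information, and a strategy
amounts to a language of lists of vertices subject to `LW` (`lw_of_ckwis`, `ckwis_of_lw`).

A language over `Γ ⊢ C` is decomposed according to `C`. An implication only passes its premises to
the context. If `C` is an atom, the reply to the opening move is the head of a hypothesis `y` with
target `C`. The next opponent move selects an argument of `y`, and the continuations form a language
over that argument (`LW.arg`); this is a term `y N₁ ⋯ Nₖ`.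

The main case is `C = □C'`. Since linked moves have addresses of equal length, the player cannot
leave the scope of the outermost boxes of the conclusion and of the targets of hypotheses
(`LW.inside_player`). The opponent leaves it only by entering an argument of a hypothesis whose head
was just played (`LW.opponent_leaves`). From an argument the player never returns to earlier moves,
except to play the head of a hypothesis: another return would put the first box of a move of the
argument in the class of the outer box of the conclusion, which is excluded by parity
(`closed_box`). So each head played in the scope of the box comes with the languages of its
arguments. The finitely many pairs that arise (`exists_box_keys`) are the arguments of the explicit
substitution. The views that stay in scope, with each head replaced by the variable of its pair, are
the language of the body (`LW.body`). Languages of arguments have fewer views; that of the body has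
no more views and a shorter conclusion. Hence the induction of `exists_der`.

Conversely, a normal term is recovered from its language (`Der.canonical`). The languages of the
arguments can be read off the whole language (`neutLang_argLang`, `boxLang_argLang`). By induction
they determine the arguments; since those of an explicit substitution are pairwise distinct, they
correspond bijectively to the pairs above, whatever the order in which they are written.

All this is done for the calculus `Der`, where one rule types an explicit substitution. `FCK` splits
that rule in two, naming the applications and then applying `boxK`. `FCK.der` and `Der.exists_fck`
pass between the calculi and respect strategies, and `FCK.unique` holds because the term and its
type leave no choice of rule or premises. -/

namespace CKGame

/-! ## Moves of an arena -/

/-- The move justifying a given move; the initial move justifies itself. -/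
def par : Formula → Vertex → Vertex
  | .imp A B, false :: v => if v = headV A then true :: headV B else false :: par A v
  | .imp _ B, true :: v => true :: par B v
  | .box A, true :: v => true :: par A v
  | _, v => v

/-- Moves are vertices not labelled by `□`. -/
def Mv (F : Formula) (v : Vertex) : Prop := ∃ a, label F v = some (.atom a)

theorem Mv.isVertex {F : Formula} {v : Vertex} (h : Mv F v) : IsVertex F v := by
  obtain ⟨a, h⟩ := h; simp [IsVertex, h]

theorem mv_headV (F : Formula) : Mv F (headV F) := by
  induction F with
  | atom a => exact ⟨a, rfl⟩
  | imp A B _ ihB => simpa [Mv, headV, label] using ihB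
  | box A ih => simpa [Mv, headV, label] using ih

theorem par_headV (F : Formula) : par F (headV F) = headV F := by
  induction F with
  | atom a => rfl
  | imp A B _ ihB => simp [headV, par, ihB]
  | box A ih => simp [headV, par, ih]

theorem depth_headV (F : Formula) : depth F (headV F) = 0 := depth_eq_zero (IRoot_headV F)

/-- In `A → B` only the roots of `A` acquire edges, and the only root of `B` that is a move is its
head. So the head of `A` gets the head of `B` as justifier, and all other moves keep theirs. -/
theorem iEdge_par {F : Formula} {v : Vertex} (h : Mv F v) (hv : v ≠ headV F) :
    Mv F (par F v) ∧ iEdge F v (par F v) := by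
  induction F generalizing v with
  | atom a =>
    match v with
    | [] => exact absurd rfl hv
    | _ :: _ => simp [Mv, label] at h
  | imp A B ihA ihB =>
    match v with
    | [] => simp [Mv, label] at h
    | true :: v =>
      have := ihB (v := v) (by simpa [Mv, label] using h) (by simpa [headV] using hv)
      simpa [par, Mv, label, iEdge] using this
    | false :: v =>
      by_cases e : v = headV A
      · subst e
        simp only [par, if_true]
        exact ⟨by simpa [Mv, label] using mv_headV B, IRoot_headV A, IRoot_headV B⟩
      · have := ihA (v := v) (by simpa [Mv, label] using h) e
        simpa [par, e, Mv, label, iEdge] using this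
  | box A ih =>
    match v with
    | [] => simp [Mv, label] at h
    | [false] => simp [Mv, label] at h
    | false :: _ :: _ => simp [Mv, label] at h
    | true :: v =>
      have := ih (v := v) (by simpa [Mv, label] using h) (by simpa [headV] using hv)
      simpa [par, Mv, label, iEdge] using this

theorem eq_headV_of_IRoot {F : Formula} {v : Vertex} (h : Mv F v) (hr : IRoot F v) :
    v = headV F := by
  by_contra hv
  exact hr.2 _ (iEdge_par h hv).2

/-- An edge from `A` to `B` joins two roots, and a root that is a move is a head. Edges to boxes are
the reason for requiring that `w` be a move: they make the target of an edge ambiguous in general.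
-/
theorem par_eq_of_iEdge {F : Formula} {v w : Vertex} (hv : Mv F v) (hw : Mv F w)
    (h : iEdge F v w) : par F v = w := by
  induction F generalizing v w with
  | atom a => simp [iEdge] at h
  | imp A B ihA ihB =>
    match v, w, h with
    | [], _, h => simp [iEdge] at h
    | _ :: _, [], h => simp [iEdge] at h
    | false :: v, false :: w, h =>
      have hv' : Mv A v := by simpa [Mv, label] using hv
      have e : v ≠ headV A := by
        rintro rfl; exact (IRoot_headV A).2 _ (by simpa [iEdge] using h)
      simpa [par, e] using ihA hv' (by simpa [Mv, label] using hw) (by simpa [iEdge] using h)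
    | true :: v, true :: w, h =>
      simpa [par] using ihB (by simpa [Mv, label] using hv) (by simpa [Mv, label] using hw)
        (by simpa [iEdge] using h)
    | false :: v, true :: w, h =>
      have e1 := eq_headV_of_IRoot (by simpa [Mv, label] using hv) h.1
      have e2 := eq_headV_of_IRoot (by simpa [Mv, label] using hw) h.2
      simp [par, e1, e2]
    | true :: v, false :: w, h => simp [iEdge] at h
  | box A ih =>
    match v, w, h with
    | [], _, h => simp [iEdge] at h
    | _ :: _, [], h => simp [iEdge] at h
    | false :: v, _, h => simp [iEdge] at h
    | true :: v, false :: w, h => simp [iEdge] at h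
    | true :: v, true :: w, h =>
      simpa [par] using ih (by simpa [Mv, label] using hv) (by simpa [Mv, label] using hw)
        (by simpa [iEdge] using h)

theorem ne_headV_of_iEdge {F : Formula} {v w : Vertex} (h : iEdge F v w) : v ≠ headV F := by
  rintro rfl; exact (IRoot_headV F).2 _ h

theorem depth_par {F : Formula} {v : Vertex} (h : Mv F v) (hv : v ≠ headV F) :
    depth F v = depth F (par F v) + 1 := depth_edge (iEdge_par h hv).2

theorem mv_par {F : Formula} {v : Vertex} (h : Mv F v) : Mv F (par F v) := by
  by_cases hv : v = headV F
  · rw [hv, par_headV]; exact mv_headV F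
  · exact (iEdge_par h hv).1

theorem depth_of_mem_addr_headV {F : Formula} {b : Vertex} (h : b ∈ addr F (headV F)) :
    depth F b = 0 := by
  induction F generalizing b with
  | atom a => simp [addr] at h
  | imp A B _ ihB =>
    simp only [headV, addr, List.mem_map] at h
    obtain ⟨b, hb, rfl⟩ := h
    simpa [depth] using ihB hb
  | box A ih =>
    simp only [headV, addr, List.mem_cons, List.mem_map] at h
    rcases h with rfl | ⟨b, hb, rfl⟩
    · rfl
    · simpa [depth] using ih hb

/-- A box having a move in its scope either has the polarity of that move, or has the justifier of
the move in its scope as well. -/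
theorem addr_par {F : Formula} {v b : Vertex} {h : ℕ} (hv : Mv F v)
    (hb : (addr F v)[h]? = some b) :
    (Even (depth F b) ↔ Even (depth F v)) ∨ (v ≠ headV F ∧ (addr F (par F v))[h]? = some b) := by
  induction F generalizing v b h with
  | atom a => simp [addr] at hb
  | imp A B ihA ihB =>
    match v with
    | [] => simp [addr] at hb
    | true :: v =>
      simp only [addr, List.getElem?_map, Option.map_eq_some_iff] at hb
      obtain ⟨b, hb, rfl⟩ := hb
      rcases ihB (by simpa [Mv, label] using hv) hb with h1 | h1
      · exact .inl (by simpa [depth] using h1)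
      · exact .inr (by simpa [headV, par, addr] using h1)
    | false :: v =>
      simp only [addr, List.getElem?_map, Option.map_eq_some_iff] at hb
      obtain ⟨b, hb, rfl⟩ := hb
      -- The justifier lies outside `A` exactly when `v` is the head of `A`; the boxes around a head
      -- are roots, like the head itself.
      by_cases e : v = headV A
      · subst e
        left
        simp [depth, depth_headV, depth_of_mem_addr_headV (List.mem_of_getElem? hb)]
      · rcases ihA (by simpa [Mv, label] using hv) hb with h1 | h1
        · exact .inl (by simpa [depth, Nat.even_add_one] using not_congr h1)
        · exact .inr (by simpa [headV, par, addr, e] using h1.2)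
  | box A ih =>
    match v with
    | [] => simp [addr] at hb
    | false :: _ => simp [addr] at hb
    | true :: v =>
      have hv' : Mv A v := by simpa [Mv, label] using hv
      by_cases e : v = headV A
      · subst e
        left
        have : depth (.box A) b = 0 := depth_of_mem_addr_headV (F := .box A)
          (List.mem_of_getElem? hb)
        rw [this]
        simp [depth, depth_headV]
      -- When `v` is not the head of `A`, its justifier is still in `A`, hence in the scope of the
      -- outer box.
      · cases h with
        | zero => exact .inr ⟨by simpa [headV] using e, by simpa [addr, par] using hb⟩
        | succ h =>
          simp only [addr, List.getElem?_cons_succ, List.getElem?_map,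
            Option.map_eq_some_iff] at hb
          obtain ⟨b, hb, rfl⟩ := hb
          rcases ih hv' hb with h1 | h1
          · exact .inl (by simpa [depth] using h1)
          · exact .inr (by simpa [headV, par, addr] using h1)

/-! ## Arenas of sequents -/

theorem imps_zero (A : Fin 0 → Formula) (C : Formula) : imps A C = C := by simp [imps]

theorem imps_succ {n : ℕ} (A : Fin (n + 1) → Formula) (C : Formula) :
    imps A C = .imp (A 0) (imps (fun i => A i.succ) C) := by simp [imps, List.ofFn_succ]

theorem imps_append {n k : ℕ} (Γ : Fin n → Formula) (A : Fin k → Formula) (C : Formula) :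
    imps (Fin.append Γ A) C = imps Γ (imps A C) := by
  simp [imps, List.ofFn_fin_append]

theorem hypV_zero (v : Vertex) : hypV 0 v = false :: v := rfl

theorem hypV_succ (i : ℕ) (v : Vertex) : hypV (i + 1) v = true :: hypV i v := rfl

theorem conV_zero (v : Vertex) : conV 0 v = v := rfl

theorem conV_succ (i : ℕ) (v : Vertex) : conV (i + 1) v = true :: conV i v := rfl

theorem conV_inj {n : ℕ} {v w : Vertex} : conV n v = conV n w ↔ v = w := by simp [conV]

theorem hypV_inj {i j : ℕ} {v w : Vertex} : hypV i v = hypV j w ↔ i = j ∧ v = w := by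
  induction i generalizing j with
  | zero => cases j <;> simp [hypV_zero, hypV_succ]
  | succ i ih => cases j <;> simp [hypV_zero, hypV_succ, ih]

theorem hypV_ne_conV {i n : ℕ} (h : i < n) (v w : Vertex) : hypV i v ≠ conV n w := by
  induction i generalizing n with
  | zero => cases n with
    | zero => omega
    | succ n => simp [hypV_zero, conV_succ]
  | succ i ih => cases n with
    | zero => omega
    | succ n => simpa [hypV_succ, conV_succ] using ih (by omega)

theorem splitV_hypV {n : ℕ} (i : Fin n) (v : Vertex) : splitV n (hypV i v) = .inl (i, v) := by
  induction n with
  | zero => exact i.elim0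
  | succ n ih =>
    refine Fin.cases ?_ (fun i => ?_) i
    · rfl
    · simp [hypV_succ, splitV, ih]

theorem splitV_conV (n : ℕ) (v : Vertex) : splitV n (conV n v) = .inr v := by
  induction n with
  | zero => rfl
  | succ n ih => simp [conV_succ, splitV, ih]

theorem splitV_eq_inl {n : ℕ} {v w : Vertex} {i : Fin n} (h : splitV n v = .inl (i, w)) :
    v = hypV i w := by
  induction n generalizing v with
  | zero => exact i.elim0
  | succ n ih =>
    match v with
    | [] => simp [splitV] at h
    | false :: v =>
      simp only [splitV, Sum.inl.injEq, Prod.mk.injEq] at h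
      obtain ⟨rfl, rfl⟩ := h
      rfl
    | true :: v =>
      simp only [splitV] at h
      split at h
      · next j u e =>
        simp only [Sum.inl.injEq, Prod.mk.injEq] at h
        obtain ⟨rfl, rfl⟩ := h
        rw [ih e]; rfl
      · simp at h

theorem label_conV {n : ℕ} (Γ : Fin n → Formula) (C : Formula) (v : Vertex) :
    label (imps Γ C) (conV n v) = label C v := by
  induction n with
  | zero => simp [imps_zero, conV_zero]
  | succ n ih => simp [imps_succ, conV_succ, label, ih]

theorem label_hypV {n : ℕ} (Γ : Fin n → Formula) (C : Formula) (i : Fin n) (v : Vertex) :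
    label (imps Γ C) (hypV i v) = label (Γ i) v := by
  induction n with
  | zero => exact i.elim0
  | succ n ih =>
    refine Fin.cases ?_ (fun i => ?_) i
    · simp [imps_succ, hypV_zero, label]
    · simp [imps_succ, hypV_succ, label, ih]

theorem vertex_cases {n : ℕ} {Γ : Fin n → Formula} {C : Formula} {v : Vertex}
    (h : IsVertex (imps Γ C) v) : (∃ w, v = conV n w) ∨ ∃ (i : Fin n) (w : Vertex),
      v = hypV i w := by
  induction n generalizing v with
  | zero => exact .inl ⟨v, rfl⟩
  | succ n ih =>
    rw [imps_succ] at h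
    match v with
    | [] => simp [IsVertex, label] at h
    | false :: v => exact .inr ⟨0, v, rfl⟩
    | true :: v =>
      rcases ih (v := v) (by simpa [IsVertex, label] using h) with ⟨w, rfl⟩ | ⟨i, w, rfl⟩
      · exact .inl ⟨w, rfl⟩
      · exact .inr ⟨i.succ, w, rfl⟩

theorem mv_conV {n : ℕ} {Γ : Fin n → Formula} {C : Formula} {v : Vertex} :
    Mv (imps Γ C) (conV n v) ↔ Mv C v := by simp [Mv, label_conV]

theorem mv_hypV {n : ℕ} {Γ : Fin n → Formula} {C : Formula} {i : Fin n} {v : Vertex} :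
    Mv (imps Γ C) (hypV i v) ↔ Mv (Γ i) v := by simp [Mv, label_hypV]

theorem headV_imps {n : ℕ} (Γ : Fin n → Formula) (C : Formula) :
    headV (imps Γ C) = conV n (headV C) := by
  induction n with
  | zero => simp [imps_zero, conV_zero]
  | succ n ih => simp [imps_succ, conV_succ, headV, ih]

theorem depth_conV {n : ℕ} (Γ : Fin n → Formula) (C : Formula) (v : Vertex) :
    depth (imps Γ C) (conV n v) = depth C v := by
  induction n with
  | zero => simp [imps_zero, conV_zero]
  | succ n ih => simp [imps_succ, conV_succ, depth, ih]

theorem depth_hypV {n : ℕ} (Γ : Fin n → Formula) (C : Formula) (i : Fin n) (v : Vertex) :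
    depth (imps Γ C) (hypV i v) = depth (Γ i) v + 1 := by
  induction n with
  | zero => exact i.elim0
  | succ n ih =>
    refine Fin.cases ?_ (fun i => ?_) i
    · simp [imps_succ, hypV_zero, depth]
    · simp [imps_succ, hypV_succ, depth, ih]

theorem addr_conV {n : ℕ} (Γ : Fin n → Formula) (C : Formula) (v : Vertex) :
    addr (imps Γ C) (conV n v) = (addr C v).map (conV n) := by
  induction n with
  | zero =>
    have : conV 0 = id := rfl
    simp [imps_zero, this]
  | succ n ih => simp [imps_succ, conV_succ, addr, ih, Function.comp_def]

theorem addr_hypV {n : ℕ} (Γ : Fin n → Formula) (C : Formula) (i : Fin n) (v : Vertex) :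
    addr (imps Γ C) (hypV i v) = (addr (Γ i) v).map (hypV i) := by
  induction n with
  | zero => exact i.elim0
  | succ n ih =>
    refine Fin.cases ?_ (fun i => ?_) i
    · simp [imps_succ, hypV_zero, addr]
    · simp [imps_succ, hypV_succ, addr, ih]

theorem par_conV {n : ℕ} (Γ : Fin n → Formula) (C : Formula) (v : Vertex) :
    par (imps Γ C) (conV n v) = conV n (par C v) := by
  induction n with
  | zero => simp [imps_zero, conV_zero]
  | succ n ih => simp [imps_succ, conV_succ, par, ih]

theorem par_hypV {n : ℕ} (Γ : Fin n → Formula) (C : Formula) (i : Fin n) (v : Vertex) :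
    par (imps Γ C) (hypV i v) =
      if v = headV (Γ i) then conV n (headV C) else hypV i (par (Γ i) v) := by
  induction n with
  | zero => exact i.elim0
  | succ n ih =>
    refine Fin.cases ?_ (fun i => ?_) i
    · simp only [imps_succ, Fin.val_zero, hypV_zero, par, headV_imps]; rfl
    · simp only [imps_succ, Fin.val_succ, hypV_succ, par, ih]
      split <;> rfl

/-! ## Arity, arguments and target of a formula -/

/-- The number of arguments of a formula. -/
def ar : Formula → ℕ
  | .imp _ B => ar B + 1
  | _ => 0

/-- The arguments of a formula. -/
def argF : Formula → ℕ → Formula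
  | .imp A _, 0 => A
  | .imp _ B, j + 1 => argF B j
  | F, _ => F

/-- The target of a formula. -/
def tgt : Formula → Formula
  | .imp _ B => tgt B
  | F => F

theorem imps_tgt (F : Formula) : imps (fun j : Fin (ar F) => argF F j) (tgt F) = F := by
  induction F with
  | atom a => exact imps_zero _ _
  | box A => exact imps_zero _ _
  | imp A B _ ihB =>
    simp only [ar, imps_succ]
    simpa [argF, tgt] using ihB

theorem tgt_notImp (F : Formula) : (tgt F).NotImp := by
  induction F with
  | atom a => intro A B; simp [tgt]
  | box A => intro A B; simp [tgt]
  | imp A B _ ihB => exact ihB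

theorem tgt_cases (F : Formula) : (∃ c, tgt F = .atom c) ∨ ∃ B, tgt F = .box B := by
  have := tgt_notImp F
  cases h : tgt F with
  | atom c => exact .inl ⟨c, rfl⟩
  | box B => exact .inr ⟨B, rfl⟩
  | imp A B => exact absurd h (this A B)

/-- As `C` is not an implication, peeling off premises stops exactly at `C`. -/
theorem imps_spec {k : ℕ} (A : Fin k → Formula) {C : Formula} (hC : C.NotImp) :
    ar (imps A C) = k ∧ tgt (imps A C) = C ∧ ∀ j : Fin k, argF (imps A C) j = A j := by
  induction k with
  | zero =>
    rw [imps_zero]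
    refine ⟨?_, ?_, fun j => j.elim0⟩ <;>
    · cases C with
      | imp A B => exact absurd rfl (hC A B)
      | _ => rfl
  | succ k ih =>
    rw [imps_succ]
    obtain ⟨h1, h2, h3⟩ := ih (fun i => A i.succ)
    refine ⟨by simp [ar, h1], by simp [tgt, h2], fun j => ?_⟩
    refine Fin.cases rfl (fun j => ?_) j
    simpa [argF] using h3 j

theorem headV_tgt (F : Formula) : headV F = conV (ar F) (headV (tgt F)) := by
  conv_lhs => rw [← imps_tgt F]
  rw [headV_imps]

theorem size_imps {k : ℕ} (hk : 0 < k) (A : Fin k → Formula) (C : Formula) :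
    C.size < (imps A C).size := by
  induction k with
  | zero => omega
  | succ k ih =>
    rw [imps_succ]
    rcases Nat.eq_zero_or_pos k with rfl | hk
    · rw [imps_zero]; simp only [Formula.size]; omega
    · have := ih hk (fun i => A i.succ)
      simp only [Formula.size]; omega

section
variable {H : Formula}

theorem label_arg {j : ℕ} (hj : j < ar H) (v : Vertex) :
    label H (hypV j v) = label (argF H j) v := by
  have := label_hypV (fun j : Fin (ar H) => argF H j) (tgt H) ⟨j, hj⟩ v
  rwa [imps_tgt] at this

theorem label_tgt (v : Vertex) : label H (conV (ar H) v) = label (tgt H) v := by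
  have := label_conV (fun j : Fin (ar H) => argF H j) (tgt H) v
  rwa [imps_tgt] at this

theorem depth_arg {j : ℕ} (hj : j < ar H) (v : Vertex) :
    depth H (hypV j v) = depth (argF H j) v + 1 := by
  have := depth_hypV (fun j : Fin (ar H) => argF H j) (tgt H) ⟨j, hj⟩ v
  rwa [imps_tgt] at this

theorem depth_tgt (v : Vertex) : depth H (conV (ar H) v) = depth (tgt H) v := by
  have := depth_conV (fun j : Fin (ar H) => argF H j) (tgt H) v
  rwa [imps_tgt] at this

theorem addr_arg {j : ℕ} (hj : j < ar H) (v : Vertex) :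
    addr H (hypV j v) = (addr (argF H j) v).map (hypV j) := by
  have := addr_hypV (fun j : Fin (ar H) => argF H j) (tgt H) ⟨j, hj⟩ v
  rwa [imps_tgt] at this

theorem addr_tgt (v : Vertex) :
    addr H (conV (ar H) v) = (addr (tgt H) v).map (conV (ar H)) := by
  have := addr_conV (fun j : Fin (ar H) => argF H j) (tgt H) v
  rwa [imps_tgt] at this

theorem par_arg {j : ℕ} (hj : j < ar H) (v : Vertex) :
    par H (hypV j v) =
      if v = headV (argF H j) then headV H else hypV j (par (argF H j) v) := by
  have := par_hypV (fun j : Fin (ar H) => argF H j) (tgt H) ⟨j, hj⟩ v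
  rwa [imps_tgt, ← headV_tgt] at this

theorem par_tgt (v : Vertex) : par H (conV (ar H) v) = conV (ar H) (par (tgt H) v) := by
  have := par_conV (fun j : Fin (ar H) => argF H j) (tgt H) v
  rwa [imps_tgt] at this

theorem vertex_cases_formula {v : Vertex} (h : IsVertex H v) :
    (∃ w, v = conV (ar H) w) ∨ ∃ j < ar H, ∃ w, v = hypV j w := by
  rw [← imps_tgt H] at h
  rcases vertex_cases h with h | ⟨i, w, h⟩
  · exact .inl h
  · exact .inr ⟨i, i.2, w, h⟩

end

/-! ## Renaming -/

theorem liftRen_last {n m : ℕ} (ρ : Fin n → Fin m) : liftRen ρ (Fin.last n) = Fin.last m := by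
  simp [liftRen]

theorem liftRen_castSucc {n m : ℕ} (ρ : Fin n → Fin m) (i : Fin n) :
    liftRen ρ i.castSucc = (ρ i).castSucc := by
  simp [liftRen]

theorem liftRen_id (n : ℕ) : liftRen (id : Fin n → Fin n) = id := by
  funext i
  refine Fin.lastCases ?_ (fun i => ?_) i
  · exact liftRen_last _
  · exact liftRen_castSucc _ _

theorem liftRen_comp {n m l : ℕ} (ρ : Fin n → Fin m) (θ : Fin m → Fin l) :
    liftRen θ ∘ liftRen ρ = liftRen (θ ∘ ρ) := by
  funext i
  refine Fin.lastCases ?_ (fun i => ?_) i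
  · simp [liftRen_last]
  · simp [liftRen_castSucc]

theorem rename_id {n : ℕ} (t : Tm n) : t.rename id = t := by
  induction t with
  | var x => rfl
  | lam M ih => simp [Tm.rename, liftRen_id, ih]
  | app M N ihM ihN => simp [Tm.rename, ihM, ihN]
  | esub M N ihM ihN => simp [Tm.rename, ihN]

theorem rename_comp {n m l : ℕ} (ρ : Fin n → Fin m) (θ : Fin m → Fin l) (t : Tm n) :
    (t.rename ρ).rename θ = t.rename (θ ∘ ρ) := by
  induction t generalizing m l with
  | var x => rfl
  | lam M ih => simp [Tm.rename, ih, liftRen_comp]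
  | app M N ihM ihN => simp [Tm.rename, ihM, ihN]
  | esub M N ihM ihN => simp [Tm.rename, ihN]

theorem rename_rename_of_inv {n m : ℕ} {ρ : Fin n → Fin m} {θ : Fin m → Fin n}
    (h : θ ∘ ρ = id) (t : Tm n) : (t.rename ρ).rename θ = t := by
  rw [rename_comp, h, rename_id]

/-! ## The permutation congruence, structurally -/

/-- A syntax-directed presentation of `PermEq`. -/
inductive Sim : {n : ℕ} → Tm n → Tm n → Prop
  | var {n : ℕ} (x : Fin n) : Sim (.var x) (.var x)
  | lam {n : ℕ} {M M' : Tm (n + 1)} : Sim M M' → Sim (.lam M) (.lam M')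
  | app {n : ℕ} {M M' N N' : Tm n} : Sim M M' → Sim N N' → Sim (.app M N) (.app M' N')
  | esub {n k : ℕ} {M M' : Tm k} {N N' : Fin k → Tm n} (σ : Equiv.Perm (Fin k)) :
      Sim (M.rename σ.symm) M' → (∀ i, Sim (N (σ i)) (N' i)) → Sim (.esub M N) (.esub M' N')

theorem Sim.refl {n : ℕ} (t : Tm n) : Sim t t := by
  induction t with
  | var x => exact .var x
  | lam M ih => exact .lam ih
  | app M N ihM ihN => exact .app ihM ihN
  | esub M N ihM ihN =>
    refine .esub (Equiv.refl _) ?_ ihN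
    rw [Equiv.refl_symm, Equiv.coe_refl, rename_id]; exact ihM

theorem Sim.rename {n m : ℕ} {s t : Tm n} (h : Sim s t) (ρ : Fin n → Fin m) :
    Sim (s.rename ρ) (t.rename ρ) := by
  induction h generalizing m with
  | var x => exact .var _
  | lam _ ih => exact .lam (ih _)
  | app _ _ ih1 ih2 => exact .app (ih1 _) (ih2 _)
  | esub σ h1 _ _ ih2 => exact .esub σ h1 (fun i => ih2 i ρ)

theorem Sim.symm {n : ℕ} {s t : Tm n} (h : Sim s t) : Sim t s := by
  induction h with
  | var x => exact .var x
  | lam _ ih => exact .lam ih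
  | app _ _ ih1 ih2 => exact .app ih1 ih2
  | esub σ _ _ ih1 ih2 =>
    refine .esub σ.symm ?_ (fun i => ?_)
    · have := ih1.rename σ
      rwa [rename_rename_of_inv (by ext; simp)] at this
    · simpa using ih2 (σ.symm i)

theorem Sim.trans {n : ℕ} {s t u : Tm n} (h : Sim s t) (h' : Sim t u) : Sim s u := by
  induction h with
  | var x => exact h'
  | lam _ ih => cases h' with | lam h' => exact .lam (ih h')
  | app _ _ ih1 ih2 => cases h' with | app h1 h2 => exact .app (ih1 h1) (ih2 h2)
  | esub σ h1 _ ih1 ih2 =>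
    cases h' with
    | esub τ k1 k2 =>
      -- The `i`-th argument at the end is congruent to argument `σ (τ i)` at the start. For the
      -- bodies, the second congruence is first renamed by `τ` so that the induction hypothesis
      -- applies, and renamed back afterwards.
      refine .esub (τ.trans σ) ?_ (fun i => ?_)
      · have e := h1.rename τ.symm
        rw [rename_comp] at e
        have e2 : (⇑(Equiv.symm (τ.trans σ)) : Fin _ → Fin _) = ⇑τ.symm ∘ ⇑σ.symm := rfl
        rw [e2]
        have k3 := k1.rename τ
        rw [rename_rename_of_inv (by ext; simp)] at k3
        have := (ih1 k3).rename τ.symm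
        rwa [rename_comp, rename_rename_of_inv (by ext; simp)] at this
      · exact ih2 (τ i) (k2 i)

theorem Sim.permEq {n : ℕ} {s t : Tm n} (h : Sim s t) : PermEq s t := by
  induction h with
  | var x => exact .refl _
  | lam _ ih => exact .lam ih
  | app _ _ ih1 ih2 => exact .app ih1 ih2
  | esub σ _ _ ih1 ih2 => exact .trans (.perm _ _ σ) (.esub ih1 ih2)

/-- `Sim` is already symmetric and transitive, so these closure rules can be eliminated. Congruent
terms can then be compared constructor by constructor. -/
theorem PermEq.sim {n : ℕ} {s t : Tm n} (h : PermEq s t) : Sim s t := by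
  induction h with
  | refl M => exact .refl M
  | symm _ ih => exact ih.symm
  | trans _ _ ih1 ih2 => exact ih1.trans ih2
  | lam _ ih => exact .lam ih
  | app _ _ ih1 ih2 => exact .app ih1 ih2
  | esub _ _ ih1 ih2 =>
    refine .esub (Equiv.refl _) ?_ ih2
    rw [Equiv.refl_symm, Equiv.coe_refl, rename_id]; exact ih1
  | perm M N σ => exact .esub σ (.refl _) (fun i => .refl _)

/-! ## Spines -/

theorem apps_zero {n : ℕ} (M : Tm n) (N : Fin 0 → Tm n) : apps M N = M := by simp [apps]

theorem apps_succ {n k : ℕ} (M : Tm n) (N : Fin (k + 1) → Tm n) :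
    apps M N = .app (apps M (fun i => N i.castSucc)) (N (Fin.last k)) := by
  rw [apps, List.ofFn_succ', List.concat_eq_append, List.foldl_append]; rfl

theorem rename_apps {n m k : ℕ} (ρ : Fin n → Fin m) (M : Tm n) (N : Fin k → Tm n) :
    (apps M N).rename ρ = apps (M.rename ρ) (fun i => (N i).rename ρ) := by
  induction k with
  | zero => simp [apps_zero]
  | succ k ih => simp [apps_succ, Tm.rename, ih]

/-- The head of the spine is a variable and not an application, so the number of arguments can be
read off the term. -/
theorem apps_var_inj {n k l : ℕ} {x y : Fin n} {N : Fin k → Tm n} {N' : Fin l → Tm n}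
    (h : apps (.var x) N = apps (.var y) N') :
    x = y ∧ ∃ e : k = l, ∀ i, N i = N' (Fin.cast e i) := by
  induction k generalizing l with
  | zero =>
    cases l with
    | zero =>
      rw [apps_zero, apps_zero] at h
      exact ⟨by simpa using h, rfl, fun i => i.elim0⟩
    | succ l => rw [apps_zero, apps_succ] at h; simp at h
  | succ k ih =>
    cases l with
    | zero => rw [apps_zero, apps_succ] at h; simp at h
    | succ l =>
      rw [apps_succ, apps_succ, Tm.app.injEq] at h
      obtain ⟨h1, e, h2⟩ := ih h.1
      subst e
      refine ⟨h1, rfl, fun i => ?_⟩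
      refine Fin.lastCases ?_ (fun i => ?_) i
      · exact h.2
      · exact h2 i

theorem occurs_apps {n k : ℕ} {x y : Fin n} {N : Fin k → Tm n} :
    Occurs (apps (.var y) N) x ↔ x = y ∨ ∃ i, Occurs (N i) x := by
  induction k with
  | zero => simp [apps_zero, Occurs]
  | succ k ih => simp [apps_succ, Occurs, ih, Fin.exists_fin_succ', or_assoc]

theorem Sim.apps {n k : ℕ} {x : Fin n} {N N' : Fin k → Tm n} (h : ∀ i, Sim (N i) (N' i)) :
    Sim (apps (.var x) N) (apps (.var x) N') := by
  induction k with
  | zero => simpa only [apps_zero] using Sim.var x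
  | succ k ih =>
    rw [apps_succ, apps_succ]
    exact .app (ih fun i => h _) (h _)

theorem Sim.of_apps {n k : ℕ} {x : Fin n} {N : Fin k → Tm n} {t : Tm n}
    (h : Sim (CKGame.apps (.var x) N) t) :
    ∃ N' : Fin k → Tm n, t = CKGame.apps (.var x) N' ∧ ∀ i, Sim (N i) (N' i) := by
  induction k generalizing t with
  | zero =>
    rw [apps_zero] at h
    cases h
    exact ⟨N, (apps_zero _ _).symm, fun i => i.elim0⟩
  | succ k ih =>
    rw [apps_succ] at h
    cases h with
    | app h1 h2 =>
      obtain ⟨N', rfl, h3⟩ := ih h1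
      refine ⟨Fin.snoc (α := fun _ => Tm n) N' _, by rw [apps_succ]; simp; rfl, fun i => ?_⟩
      refine Fin.lastCases ?_ (fun i => ?_) i
      · simpa using h2
      · simpa using h3 i

/-! ## Iterated abstractions -/

/-- The extension of a renaming under `k` binders. -/
def liftRenN {n m : ℕ} (ρ : Fin n → Fin m) : (k : ℕ) → Fin (n + k) → Fin (m + k)
  | 0 => ρ
  | k + 1 => liftRen (liftRenN ρ k)

theorem rename_lams {n m : ℕ} (ρ : Fin n → Fin m) (k : ℕ) (M : Tm (n + k)) :
    (lams k M).rename ρ = lams k (M.rename (liftRenN ρ k)) := by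
  induction k with
  | zero => rfl
  | succ k ih => exact ih (.lam M)

theorem liftRenN_castAdd {n m : ℕ} (ρ : Fin n → Fin m) (k : ℕ) (x : Fin n) :
    liftRenN ρ k (Fin.castAdd k x) = Fin.castAdd k (ρ x) := by
  induction k with
  | zero => rfl
  | succ k ih =>
    have : Fin.castAdd (k + 1) x = (Fin.castAdd k x).castSucc := rfl
    rw [liftRenN, this, liftRen_castSucc, ih]; rfl

theorem liftRenN_natAdd {n m : ℕ} (ρ : Fin n → Fin m) (k : ℕ) (j : Fin k) :
    liftRenN ρ k (Fin.natAdd n j) = Fin.natAdd m j := by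
  induction k with
  | zero => exact j.elim0
  | succ k ih =>
    rw [liftRenN]
    refine Fin.lastCases ?_ (fun j => ?_) j
    · exact liftRen_last _
    · have : Fin.natAdd n j.castSucc = (Fin.natAdd n j).castSucc := rfl
      rw [this, liftRen_castSucc, ih]; rfl

theorem lams_inj {n k : ℕ} {M M' : Tm (n + k)} (h : lams k M = lams k M') : M = M' := by
  induction k with
  | zero => exact h
  | succ k ih => simpa using ih h

theorem occurs_lams {n k : ℕ} {M : Tm (n + k)} {x : Fin n} :
    Occurs (lams k M) x ↔ Occurs M (Fin.castAdd k x) := by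
  induction k with
  | zero => rfl
  | succ k ih => exact ih (M := .lam M)

theorem Sim.lams {n k : ℕ} {M M' : Tm (n + k)} (h : Sim M M') :
    Sim (lams k M) (lams k M') := by
  induction k with
  | zero => exact h
  | succ k ih => exact ih (.lam h)

theorem Sim.of_lams {n k : ℕ} {M : Tm (n + k)} {t : Tm n} (h : Sim (CKGame.lams k M) t) :
    ∃ M', t = CKGame.lams k M' ∧ Sim M M' := by
  induction k with
  | zero => exact ⟨t, rfl, h⟩
  | succ k ih =>
    obtain ⟨X, rfl, h'⟩ := ih (M := .lam M) h
    cases h' with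
    | lam h1 => exact ⟨_, rfl, h1⟩

/-! ## Occurrences -/

theorem occurs_rename {n m : ℕ} {t : Tm n} {ρ : Fin n → Fin m} {x : Fin n} (h : Occurs t x) :
    Occurs (t.rename ρ) (ρ x) := by
  induction t generalizing m with
  | var y => simp only [Occurs] at h; subst h; rfl
  | lam M ih =>
    simp only [Tm.rename, Occurs] at h ⊢
    rw [← liftRen_castSucc]
    exact ih h
  | app M N ihM ihN => exact h.imp ihM ihN
  | esub M N ihM ihN =>
    obtain ⟨i, h⟩ := h
    exact ⟨i, ihN i h⟩

theorem Sim.occurs {n : ℕ} {s t : Tm n} (h : Sim s t) {x : Fin n} (hx : Occurs s x) :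
    Occurs t x := by
  induction h with
  | var y => exact hx
  | lam _ ih => exact ih hx
  | app _ _ ih1 ih2 => exact Or.imp ih1 ih2 hx
  | esub σ _ _ _ ih2 =>
    obtain ⟨i, hx⟩ := hx
    exact ⟨σ.symm i, ih2 _ (by simpa using hx)⟩

/-! ## Terms whose explicit substitutions have pairwise distinct arguments -/

/-- In all explicit substitutions of the term, the arguments are pairwise distinct. -/
def Dst : {n : ℕ} → Tm n → Prop
  | _, .var _ => True
  | _, .lam M => Dst M
  | _, .app M N => Dst M ∧ Dst N
  | _, .esub M N => Dst M ∧ (∀ i, Dst (N i)) ∧ ∀ i j, Sim (N i) (N j) → i = j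

/-- The left inverse `θ` undoes a congruence between two renamed arguments; a renaming that
identifies variables could make distinct arguments equal. -/
theorem Dst.rename {n m : ℕ} {t : Tm n} (h : Dst t) {ρ : Fin n → Fin m} {θ : Fin m → Fin n}
    (hρ : θ ∘ ρ = id) : Dst (t.rename ρ) := by
  induction t generalizing m with
  | var x => trivial
  | lam M ih => exact ih h (θ := liftRen θ) (by rw [liftRen_comp, hρ, liftRen_id])
  | app M N ihM ihN => exact ⟨ihM h.1 hρ, ihN h.2 hρ⟩
  | esub M N ihM ihN =>
    refine ⟨h.1, fun i => ihN i (h.2.1 i) hρ, fun i j hij => h.2.2 i j ?_⟩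
    have := hij.rename θ
    rwa [rename_rename_of_inv hρ, rename_rename_of_inv hρ] at this

theorem Sim.dst {n : ℕ} {s t : Tm n} (h : Sim s t) (hs : Dst s) : Dst t := by
  induction h with
  | var x => trivial
  | lam _ ih => exact ih hs
  | app _ _ ih1 ih2 => exact ⟨ih1 hs.1, ih2 hs.2⟩
  | esub σ _ h2 ih1 ih2 =>
    refine ⟨ih1 (hs.1.rename (θ := σ) (by ext; simp)), fun i => ih2 i (hs.2.1 _),
      fun i j hij => ?_⟩
    exact σ.injective (hs.2.2 _ _ (((h2 i).trans hij).trans (h2 j).symm))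

theorem dst_apps {n k : ℕ} {x : Fin n} {N : Fin k → Tm n} :
    Dst (apps (.var x) N) ↔ ∀ i, Dst (N i) := by
  induction k with
  | zero => simp [apps_zero, Dst]
  | succ k ih => simp [apps_succ, Dst, ih, Fin.forall_fin_succ']

theorem dst_lams {n k : ℕ} {M : Tm (n + k)} : Dst (lams k M) ↔ Dst M := by
  induction k with
  | zero => rfl
  | succ k ih => exact ih (M := .lam M)

/-- Distinctness is the part of normality that a derivation in `Der` does not enforce. Conversely
`Der.normal` recovers normality from it. -/
theorem IsNormal.dst {n : ℕ} {t : Tm n} (h : IsNormal t) : Dst t := by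
  induction h with
  | neutral Γ x N A c _ _ _ ih => exact dst_apps.2 ih
  | lam Γ A C M _ _ ih => exact ih
  | esub Γ B C M N y r U _ _ _ hd hN _ _ ihM ihU =>
    refine ⟨ihM, fun i => ?_, fun i j hij => ?_⟩
    · rw [hN]; exact dst_apps.2 (ihU i)
    · by_contra hne
      exact hd i j hne hij.permEq

/-! ## Views without pointers -/

/-- The moves of a play. -/
def vs (p : PSeq) : List Vertex := p.map Prod.fst

/-- The play with the given moves, without repetitions, in which each move points to its
justifier. -/
def ptr (F : Formula) (l : List Vertex) : PSeq := l.map fun v => (v, l.idxOf (par F v))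

theorem vs_ptr (F : Formula) (l : List Vertex) : vs (ptr F l) = l := by
  simp [vs, ptr, Function.comp_def]

/-- Sequences of moves that start with the initial move, and in which the justifier of each other
move occurs before it. -/
inductive Struct (F : Formula) : List Vertex → Prop
  | nil : Struct F []
  | init : Struct F [headV F]
  | snoc {l : List Vertex} {v : Vertex} : Struct F l → Mv F v → v ≠ headV F → par F v ∈ l →
      Struct F (l ++ [v])

theorem Struct.mv {F : Formula} {l : List Vertex} (h : Struct F l) {v : Vertex} (hv : v ∈ l) :
    Mv F v := by
  induction h with
  | nil => simp at hv
  | init => rw [List.mem_singleton] at hv; subst hv; exact mv_headV F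
  | snoc _ h1 _ _ ih =>
    rcases List.mem_append.1 hv with hv | hv
    · exact ih hv
    · rw [List.mem_singleton] at hv; subst hv; exact h1

theorem Struct.par_mem {F : Formula} {l : List Vertex} (h : Struct F l) {v : Vertex}
    (hv : v ∈ l) : par F v ∈ l := by
  induction h with
  | nil => simp at hv
  | init => rw [List.mem_singleton] at hv; subst hv; simp [par_headV]
  | snoc _ _ _ h3 ih =>
    rcases List.mem_append.1 hv with hv | hv
    · exact List.mem_append_left _ (ih hv)
    · rw [List.mem_singleton] at hv; subst hv; exact List.mem_append_left _ h3

theorem Struct.snoc_iff {F : Formula} {l : List Vertex} {v : Vertex} :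
    Struct F (l ++ [v]) ↔ (l = [] ∧ v = headV F) ∨
      (l ≠ [] ∧ Struct F l ∧ Mv F v ∧ v ≠ headV F ∧ par F v ∈ l) := by
  constructor
  · intro h
    generalize e : l ++ [v] = m at h
    cases h with
    | nil => simp at e
    | init =>
      have := List.append_eq_singleton_iff.1 e
      rcases this with ⟨h1, h2⟩ | ⟨_, h2⟩
      · exact .inl ⟨h1, by simpa using h2⟩
      · simp at h2
    | snoc h1 h2 h3 h4 =>
      obtain ⟨rfl, e⟩ := List.append_inj' e rfl
      obtain rfl : v = _ := by simpa using e
      exact .inr ⟨List.ne_nil_of_mem h4, h1, h2, h3, h4⟩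
  · rintro (⟨rfl, rfl⟩ | ⟨_, h1, h2, h3, h4⟩)
    · exact .init
    · exact .snoc h1 h2 h3 h4

theorem Struct.pre {F : Formula} {l m : List Vertex} (h : Struct F (l ++ m)) : Struct F l := by
  induction m using List.reverseRecOn with
  | nil => simpa using h
  | append_singleton m v ih =>
    rw [← List.append_assoc] at h
    rcases Struct.snoc_iff.1 h with ⟨h1, _⟩ | ⟨_, h1, _⟩
    · exact ih (by rw [h1]; exact .nil)
    · exact ih h1

theorem Struct.head {F : Formula} {l : List Vertex} {v : Vertex} (h : Struct F (v :: l)) :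
    v = headV F := by
  have : Struct F ([] ++ [v]) := Struct.pre (m := l) (by simpa using h)
  rcases Struct.snoc_iff.1 this with ⟨_, h⟩ | ⟨h, _⟩
  · exact h
  · simp at h

theorem Struct.head_mem {F : Formula} {l : List Vertex} (h : Struct F l) (hl : l ≠ []) :
    headV F ∈ l := by
  cases l with
  | nil => simp at hl
  | cons v l => rw [h.head]; simp

/-- Property of a vertex inherited by justifiers, up to the initial move. -/
theorem Struct.ptr_snoc {F : Formula} {l : List Vertex} {v : Vertex} (h : Struct F (l ++ [v]))
    (hn : (l ++ [v]).Nodup) : ptr F (l ++ [v]) = ptr F l ++ [(v, l.idxOf (par F v))] := by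
  rcases Struct.snoc_iff.1 h with ⟨rfl, rfl⟩ | ⟨_, h1, _, _, h4⟩
  · simp [ptr, par_headV]
  · rw [ptr, List.map_append, ptr]
    congr 1
    · refine List.map_congr_left fun u hu => ?_
      rw [List.idxOf_append_of_mem (h1.par_mem hu)]
    · simp [List.idxOf_append_of_mem h4]

/-- The generating links of the equivalence relation of a view. -/
def Lk (F : Formula) (l : List Vertex) (u w : Vertex) : Prop :=
  ∃ l' o p, Even l'.length ∧ l' ++ [o, p] <+: l ∧
    ((u = o ∧ w = p) ∨ ∃ h : ℕ, (addr F o)[h]? = some u ∧ (addr F p)[h]? = some w)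

theorem Lk.mono {F : Formula} {l m : List Vertex} {u w : Vertex} (h : Lk F l u w)
    (hm : l <+: m) : Lk F m u w := by
  obtain ⟨l', o, p, h1, h2, h3⟩ := h
  exact ⟨l', o, p, h1, h2.trans hm, h3⟩

/-- `CK`-winning innocent strategies, as sets of views without pointers. -/
structure LW (F : Formula) (L : Set (List Vertex)) : Prop where
  fin : L.Finite
  nil : [] ∈ L
  pre : ∀ l v, l ++ [v] ∈ L → l ∈ L
  struct : ∀ l ∈ L, Struct F l
  nodup : ∀ l ∈ L, l.Nodup
  init : [headV F] ∈ L
  opp : ∀ l u v, l ++ [u] ∈ L → Odd l.length → Mv F v → v ≠ headV F → par F v = u →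
    l ++ [u, v] ∈ L
  oppar : ∀ l u v, l ++ [u, v] ∈ L → Odd l.length → par F v = u
  parity : ∀ l v, l ++ [v] ∈ L → (Even (depth F v) ↔ Even l.length)
  player : ∀ l ∈ L, Odd l.length → ∃! v, l ++ [v] ∈ L
  lab : ∀ l u v, l ++ [u, v] ∈ L → Even l.length →
    label F v = label F u ∧ (addr F v).length = (addr F u).length
  link : ∀ l ∈ L, ∀ u w, Relation.EqvGen (Lk F l) u w → Even (depth F u) → Even (depth F w) →
    u = w

theorem LW.prefix {F : Formula} {L : Set (List Vertex)} (h : LW F L) {l m : List Vertex}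
    (hl : l ++ m ∈ L) : l ∈ L := by
  induction m using List.reverseRecOn with
  | nil => simpa using hl
  | append_singleton m v ih => exact ih (h.pre _ v (by simpa using hl))

/-! ## From strategies to languages -/

/-- In the batched view addresses are aligned at the bottom rows. When the moves in positions `2k`
and `2k+1` have addresses of equal length, a row therefore meets both addresses at the same index,
and row `0` pairs the moves themselves. -/
theorem link_iff {F : Formula} {p : PSeq} (hp : WellBatched F p) {u w : Vertex} :
    Link F p u w ↔ Lk F (vs p) u w := by
  have hh : ∀ (i : ℕ) (s : Vertex × ℕ), p[i]? = some s → (addr F s.1).length < height F p := by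
    intro i s hs
    have : s ∈ p := List.mem_of_getElem? hs
    clear hs hp
    rw [height]
    induction p with
    | nil => simp at this
    | cons t p ih =>
      simp only [List.map_cons, List.foldr_cons]
      rcases List.mem_cons.1 this with rfl | h
      · omega
      · have := ih h; omega
  constructor
  · rintro ⟨k, h, hk, hh', h1, h2⟩
    obtain ⟨s, hs⟩ : ∃ s, p[2 * k]? = some s := ⟨p[2 * k], by simp⟩
    obtain ⟨t, ht⟩ : ∃ t, p[2 * k + 1]? = some t := ⟨p[2 * k + 1], by simp⟩
    refine ⟨(vs p).take (2 * k), s.1, t.1, ?_, ?_, ?_⟩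
    · simp only [vs, List.length_take, List.length_map]
      rw [min_eq_left (by omega)]; simp
    · have : List.take (2 * k) (vs p) ++ [s.1, t.1] = (vs p).take (2 * k + 2) := by
        rw [List.take_add_one, List.take_add_one]
        simp [vs, hs, ht]
      rw [this]; exact List.take_prefix _ _
    · have hlen := hp k s t hs ht
      simp only [batch, hs, ht, Option.bind_some] at h1 h2
      by_cases h0 : h = 0
      · simp only [h0, if_true, Option.some.injEq] at h1 h2
        exact .inl ⟨h1.symm, h2.symm⟩
      · rw [if_neg h0] at h1 h2
        split at h1
        · simp at h1
        · rw [← hlen] at h2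
          rw [if_neg (by assumption)] at h2
          exact .inr ⟨_, h1, h2⟩
  · rintro ⟨l', o, q, hl', ⟨r, hr⟩, h⟩
    obtain ⟨k, hk⟩ := hl'
    have hk : l'.length = 2 * k := by omega
    have hv : ∀ i : ℕ, (vs p)[i]? = (p[i]?).map Prod.fst := fun i => by simp [vs]
    obtain ⟨s, hs, rfl⟩ : ∃ s, p[2 * k]? = some s ∧ s.1 = o := by
      have := hv (2 * k)
      rw [← hr, ← hk] at this
      simpa [eq_comm, hk] using this
    obtain ⟨t, ht, rfl⟩ : ∃ t, p[2 * k + 1]? = some t ∧ t.1 = q := by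
      have := hv (2 * k + 1)
      rw [← hr, ← hk] at this
      simpa [eq_comm, hk] using this
    have hlt : 2 * k + 1 < p.length := (List.getElem?_eq_some_iff.1 ht).1
    have hlen := hp k s t hs ht
    rcases h with ⟨rfl, rfl⟩ | ⟨h, h1, h2⟩
    · exact ⟨k, 0, hlt, by omega, by simp [batch, hs], by simp [batch, ht]⟩
    · have hH := hh _ _ hs
      have hL : h < (addr F s.1).length := (List.getElem?_eq_some_iff.1 h1).1
      refine ⟨k, height F p - (addr F s.1).length + h + 1, hlt, by omega, ?_, ?_⟩
      · simp only [batch, hs, Option.bind_some]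
        rw [if_neg (by omega), if_neg (by omega), ← h1]
        congr 1; omega
      · simp only [batch, ht, Option.bind_some, ← hlen]
        rw [if_neg (by omega), if_neg (by omega), ← h2]
        congr 1; omega

theorem EqvGen.map {α β : Type*} {r : α → α → Prop} {s : β → β → Prop} {f : α → β}
    (h : ∀ a b, r a b → s (f a) (f b)) {a b : α} (hab : Relation.EqvGen r a b) :
    Relation.EqvGen s (f a) (f b) := by
  induction hab with
  | rel a b hr => exact .rel _ _ (h _ _ hr)
  | refl a => exact .refl _
  | symm a b _ ih => exact .symm _ _ ih
  | trans a b c _ _ ih1 ih2 => exact .trans _ _ _ ih1 ih2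

theorem depth_even_of_play {F : Formula} {p : PSeq} (hp : IsPlay F p) (i : ℕ) (s : Vertex × ℕ)
    (hs : p[i]? = some s) : Even (depth F s.1) ↔ Even i := by
  induction i generalizing s with
  | zero => simp [depth_eq_zero (hp.initial s hs).1]
  | succ i ih =>
    obtain ⟨t, ht⟩ : ∃ t, p[i]? = some t :=
      ⟨p[i]'(by have := (List.getElem?_eq_some_iff.1 hs).1; omega), by simp⟩
    have h1 := ih t ht
    have h2 := hp.alternating i t s ht hs
    rw [Nat.even_add_one, ← h1, h2, Nat.not_odd_iff_even]

theorem play_par {F : Formula} {p : PSeq} (hp : IsPlay F p) {i : ℕ} {s : Vertex × ℕ}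
    (hs : p[i + 1]? = some s) : s.1 ≠ headV F ∧ s.2 < i + 1 ∧ (vs p)[s.2]? = some (par F s.1) := by
  obtain ⟨h1, t, ht, he⟩ := hp.pointer i s hs
  refine ⟨ne_headV_of_iEdge he, h1, ?_⟩
  rw [par_eq_of_iEdge (hp.moves s (List.mem_of_getElem? hs)) (hp.moves t (List.mem_of_getElem? ht))
    he]
  simp [vs, ht]

theorem IsPlay.pre {F : Formula} {p q : PSeq} (hp : IsPlay F p) (h : q <+: p) : IsPlay F q := by
  have hq : ∀ (i : ℕ) (s : Vertex × ℕ), q[i]? = some s → p[i]? = some s := by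
    intro i s hs
    obtain ⟨r, rfl⟩ := h
    rw [List.getElem?_append_left (List.getElem?_eq_some_iff.1 hs).1]; exact hs
  refine ⟨fun s hs => hp.moves s (h.subset hs), fun s hs => hp.initial s (hq _ _ hs),
    fun i s hs => ?_, fun i s t hs ht => hp.alternating i s t (hq _ _ hs) (hq _ _ ht)⟩
  obtain ⟨h1, t, ht, he⟩ := hp.pointer i s (hq _ _ hs)
  refine ⟨h1, t, ?_, he⟩
  have : i + 1 < q.length := (List.getElem?_eq_some_iff.1 hs).1
  obtain ⟨r, rfl⟩ := h
  rwa [List.getElem?_append_left (by omega)] at ht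

theorem vs_getElem? (p : PSeq) (i : ℕ) : (vs p)[i]? = (p[i]?).map Prod.fst := by simp [vs]

theorem vs_append (p q : PSeq) : vs (p ++ q) = vs p ++ vs q := by simp [vs]

theorem length_vs (p : PSeq) : (vs p).length = p.length := by simp [vs]

/-- A repetition at positions `i + 1 < j + 1` yields one at `i < j`, and the descent ends at the
initial move, which no later move can equal because later moves have an outgoing edge. -/
theorem nodup_of_linked {F : Formula} {p : PSeq} (hp : IsView F p)
    (hl : ∀ u w, Relation.EqvGen (Lk F (vs p)) u w → Even (depth F u) → Even (depth F w) → u = w) :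
    (vs p).Nodup := by
  have key : ∀ (i j : ℕ) (v : Vertex), i < j →
      (vs p)[i]? = some v → (vs p)[j]? = some v → False := by
    intro i
    induction i with
    | zero =>
      intro j v hj h1 h2
      rw [vs_getElem?] at h1 h2
      obtain ⟨s, hs, rfl⟩ := Option.map_eq_some_iff.1 h1
      obtain ⟨t, ht, e⟩ := Option.map_eq_some_iff.1 h2
      obtain ⟨j, rfl⟩ : ∃ k, j = k + 1 := ⟨j - 1, by omega⟩
      apply (play_par hp.toIsPlay ht).1
      rw [e]
      exact eq_headV_of_IRoot (hp.moves s (List.mem_of_getElem? hs)) (hp.initial s hs).1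
    | succ i ih =>
      intro j v hj h1 h2
      obtain ⟨j, rfl⟩ : ∃ k, j = k + 1 := ⟨j - 1, by omega⟩
      rw [vs_getElem?] at h1 h2
      obtain ⟨s, hs, rfl⟩ := Option.map_eq_some_iff.1 h1
      obtain ⟨t, ht, e⟩ := Option.map_eq_some_iff.1 h2
      have d1 := depth_even_of_play hp.toIsPlay _ _ hs
      have d2 := depth_even_of_play hp.toIsPlay _ _ ht
      rw [e] at d2
      have hd := d1.symm.trans d2
      have hjl : j + 1 < p.length := (List.getElem?_eq_some_iff.1 ht).1
      obtain ⟨s', hs'⟩ : ∃ s', p[i]? = some s' := ⟨p[i]'(by omega), by simp⟩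
      obtain ⟨t', ht'⟩ : ∃ t', p[j]? = some t' := ⟨p[j]'(by omega), by simp⟩
      suffices s'.1 = t'.1 from
        ih j s'.1 (by omega) (by rw [vs_getElem?, hs']; rfl) (by rw [vs_getElem?, ht', this]; rfl)
      -- Depth parity is position parity, so `i + 1` and `j + 1` have the same one. At even
      -- positions the preceding move is the justifier, which depends only on the move.
      by_cases hi : Even (i + 1)
      · obtain ⟨k, hk⟩ := hi
        obtain ⟨m, hm⟩ := hd.1 ⟨k, hk⟩
        obtain ⟨k, rfl⟩ : ∃ k', k = k' + 1 := ⟨k - 1, by omega⟩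
        obtain ⟨m, rfl⟩ : ∃ k', m = k' + 1 := ⟨m - 1, by omega⟩
        obtain rfl : i = 2 * k + 1 := by omega
        obtain rfl : j = 2 * m + 1 := by omega
        have e1 := hp.shortsighted k s hs
        have e2 := hp.shortsighted m t ht
        have f1 := (play_par hp.toIsPlay hs).2.2
        have f2 := (play_par hp.toIsPlay ht).2.2
        rw [e1, vs_getElem?, hs'] at f1
        rw [e2, vs_getElem?, ht', e] at f2
        simp only [Option.map_some, Option.some.injEq] at f1 f2
        rw [f1, f2]
      · have hi' := hi
        have hj' : ¬ Even (j + 1) := fun h => hi (hd.2 h)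
        rw [Nat.even_add_one, not_not] at hi hj'
        obtain ⟨k, hk⟩ := hi
        obtain ⟨m, hm⟩ := hj'
        obtain rfl : i = 2 * k := by omega
        obtain rfl : j = 2 * m := by omega
        have pf : ∀ k (a b : Vertex × ℕ), p[2 * k]? = some a → p[2 * k + 1]? = some b →
            Lk F (vs p) a.1 b.1 := by
          intro k a b ha hb
          have hlt : 2 * k + 1 < p.length := (List.getElem?_eq_some_iff.1 hb).1
          refine ⟨(vs p).take (2 * k), a.1, b.1, ?_, ?_, .inl ⟨rfl, rfl⟩⟩
          · rw [List.length_take, length_vs, min_eq_left (by omega)]; simp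
          · have : List.take (2 * k) (vs p) ++ [a.1, b.1] = (vs p).take (2 * k + 2) := by
              rw [List.take_add_one, List.take_add_one]
              simp [vs, ha, hb]
            rw [this]; exact List.take_prefix _ _
        have g1 := pf k s' s hs' hs
        have g2 := pf m t' t ht' ht
        rw [e] at g2
        -- At odd positions both preceding opponent moves are linked to the repeated player move,
        -- and they have even depth.
        refine hl _ _ (.trans _ _ _ (.rel _ _ g1) (.symm _ _ (.rel _ _ g2))) ?_ ?_
        · exact (depth_even_of_play hp.toIsPlay _ _ hs').2 ⟨k, by omega⟩
        · exact (depth_even_of_play hp.toIsPlay _ _ ht').2 ⟨m, by omega⟩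
  rw [List.nodup_iff_getElem?_ne_getElem?]
  intro i j hij hj he
  exact key i j _ hij (List.getElem?_eq_getElem (by omega))
    (by rw [← he]; exact List.getElem?_eq_getElem (by omega))

theorem struct_of_play {F : Formula} {p : PSeq} (hp : IsPlay F p) : Struct F (vs p) := by
  induction p using List.reverseRecOn with
  | nil => exact .nil
  | append_singleton p s ih =>
    have h1 := ih (hp.pre (List.prefix_append _ _))
    rw [vs_append]
    have hs : (p ++ [s])[p.length]? = some s := by simp
    cases hp' : p with
    | nil =>
      subst hp'
      have := eq_headV_of_IRoot (hp.moves s (by simp)) (hp.initial s (by simp)).1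
      simp only [vs, List.map_nil, List.map_cons, List.nil_append, this]
      exact .init
    | cons a p' =>
      rw [← hp']
      obtain ⟨i, hi⟩ : ∃ i, p.length = i + 1 := ⟨p'.length, by simp [hp']⟩
      rw [hi] at hs
      obtain ⟨h2, h3, h4⟩ := play_par hp hs
      refine .snoc h1 (hp.moves s (by simp)) h2 ?_
      rw [vs_append, List.getElem?_append_left (by rw [length_vs]; omega)] at h4
      exact List.mem_of_getElem? h4

/-- The target of a pointer is the justifier `par` of the move, and without repetitions a vertex
determines its position. The meaningless first pointer is `0` on both sides because `par` fixes the
head. -/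
theorem eq_ptr_of_play {F : Formula} {p : PSeq} (hp : IsPlay F p) (hn : (vs p).Nodup) :
    p = ptr F (vs p) := by
  apply List.ext_getElem?
  intro i
  by_cases hi : i < p.length
  · obtain ⟨s, hs⟩ : ∃ s, p[i]? = some s := ⟨p[i], by simp⟩
    rw [hs, ptr, List.getElem?_map, vs_getElem?, hs]
    simp only [Option.map_some, Option.some.injEq]
    refine Prod.ext rfl ?_
    simp only
    cases i with
    | zero =>
      obtain ⟨h1, h2⟩ := hp.initial s hs
      have h0 := eq_headV_of_IRoot (hp.moves s (List.mem_of_getElem? hs)) h1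
      rw [h2, h0, par_headV, ← h0]
      cases p with
      | nil => simp at hi
      | cons a p => simp at hs; simp [vs, hs]
    | succ i =>
      obtain ⟨_, h2, h3⟩ := play_par hp hs
      have hlt : s.2 < (vs p).length := by rw [length_vs]; omega
      have := hn.idxOf_getElem s.2 hlt
      rw [List.getElem?_eq_getElem hlt, Option.some.injEq] at h3
      rw [h3] at this
      exact this.symm
  · rw [List.getElem?_eq_none (by omega), List.getElem?_eq_none (by simp [ptr, vs]; omega)]

/-- The pointers of the views without repetitions of a strategy are determined. -/
theorem lw_of_ckwis {F : Formula} {S : Set PSeq} (hS : IsCKWIS F S) :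
    LW F (vs '' S) ∧ ∀ p ∈ S, p = ptr F (vs p) := by
  obtain ⟨hW, hL⟩ := hS
  have hlink : ∀ p ∈ S, ∀ u w, Relation.EqvGen (Lk F (vs p)) u w → Even (depth F u) →
      Even (depth F w) → u = w := by
    intro p hp u w h hu hw
    obtain ⟨h1, h2⟩ := hL p hp
    have h' : Relation.EqvGen (Link F p) u w := by
      refine EqvGen.map (f := id) ?_ h
      intro a b hab; exact (link_iff h1).2 hab
    -- `Linked` speaks only of vertices involved in a link; any other vertex is alone in its class.
    by_cases hx : ∃ x, Link F p u x ∨ Link F p x u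
    · exact (h2 u hx).unique ⟨.refl _, hu⟩ ⟨h', hw⟩
    · have : ∀ a b, Relation.EqvGen (Link F p) a b → (a = u ↔ b = u) := by
        intro a b hab
        induction hab with
        | rel a b hr =>
          constructor
          · rintro rfl; exact absurd ⟨b, .inl hr⟩ hx
          · rintro rfl; exact absurd ⟨a, .inr hr⟩ hx
        | refl a => rfl
        | symm a b _ ih => exact ih.symm
        | trans a b c _ _ ih1 ih2 => exact ih1.trans ih2
      exact ((this u w h').1 rfl).symm
  have hnd : ∀ p ∈ S, (vs p).Nodup := fun p hp => nodup_of_linked (hW.views p hp) (hlink p hp)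
  have hptr : ∀ p ∈ S, p = ptr F (vs p) := fun p hp =>
    eq_ptr_of_play (hW.views p hp).toIsPlay (hnd p hp)
  have hmem : ∀ l, l ∈ vs '' S ↔ ptr F l ∈ S := by
    intro l
    constructor
    · rintro ⟨p, hp, rfl⟩; rwa [← hptr p hp]
    · intro h; exact ⟨_, h, vs_ptr F l⟩
  have hpre : ∀ l v, l ++ [v] ∈ vs '' S → ∃ p s, p ++ [s] ∈ S ∧ vs p = l ∧ s.1 = v := by
    rintro l v ⟨p, hp, e⟩
    obtain ⟨q, r, rfl, h1, h2⟩ := List.map_eq_append_iff.1 e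
    obtain ⟨s, rfl, hs⟩ := List.map_eq_singleton_iff.1 h2
    exact ⟨q, s, hp, h1, hs⟩
  have hnil : [] ∈ S := by
    obtain ⟨p, hp⟩ := hW.nonempty
    exact hW.prefixClosed p hp [] (List.nil_prefix)
  refine ⟨?_, hptr⟩
  refine
    { fin := hW.finite.image _
      nil := ⟨[], hnil, rfl⟩
      pre := ?_
      struct := ?_
      nodup := by rintro _ ⟨p, hp, rfl⟩; exact hnd p hp
      init := ?_
      opp := ?_
      oppar := ?_
      parity := ?_
      player := ?_
      lab := ?_
      link := by rintro _ ⟨p, hp, rfl⟩; exact hlink p hp }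
  · intro l v h
    obtain ⟨p, s, h1, rfl, rfl⟩ := hpre l v h
    exact ⟨p, hW.prefixClosed _ h1 _ (List.prefix_append _ _), rfl⟩
  · rintro _ ⟨p, hp, rfl⟩
    exact struct_of_play (hW.views p hp).toIsPlay
  · refine ⟨[(headV F, 0)], ?_, rfl⟩
    refine hW.opponentComplete [] hnil (by simp) (headV F, 0) ⟨⟨?_, ?_, ?_, ?_⟩, ?_, ?_⟩
    · intro s hs
      simp only [List.nil_append, List.mem_singleton] at hs
      subst hs; exact mv_headV F
    · intro s hs
      simp only [List.nil_append, List.getElem?_cons_zero, Option.some.injEq] at hs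
      subst hs; exact ⟨IRoot_headV F, rfl⟩
    · intro i s hs; simp at hs
    · intro i s t _ hs; simp at hs
    · intro k s hs; simp at hs
    · intro k s t _ hs; simp at hs
  · intro l u v h hl hv hv0 hpar
    obtain ⟨p, s, h1, rfl, rfl⟩ := hpre l u h
    have hlen : Even (p ++ [s]).length := by
      rw [length_vs] at hl
      simp [hl]
    have V := hW.views _ h1
    have e1 : ∀ (i : ℕ) (a : Vertex × ℕ), (p ++ [s] ++ [(v, p.length)])[i]? = some a →
        ((p ++ [s])[i]? = some a) ∨ (i = p.length + 1 ∧ a = (v, p.length)) := by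
      intro i a ha
      by_cases hi : i < (p ++ [s]).length
      · rw [List.getElem?_append_left hi] at ha; exact .inl ha
      · rw [List.getElem?_append_right (by omega)] at ha
        have : i - (p ++ [s]).length = 0 := by
          have := (List.getElem?_eq_some_iff.1 ha).1
          simp at this; simp; omega
        rw [this] at ha
        simp at ha this
        simp only [List.length_append, List.length_singleton] at hi
        exact .inr ⟨by omega, ha.symm⟩
    have e2 : ∀ (i : ℕ) (a : Vertex × ℕ), (p ++ [s])[i]? = some a →
        (p ++ [s] ++ [(v, p.length)])[i]? = some a := by
      intro i a ha
      rw [List.getElem?_append_left (List.getElem?_eq_some_iff.1 ha).1]; exact ha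
    have e3 : ∀ (i : ℕ) (a : Vertex × ℕ), (p ++ [s])[i]? = some a → i ≤ p.length := by
      intro i a ha
      have := (List.getElem?_eq_some_iff.1 ha).1
      simp at this; omega
    have hs : (p ++ [s])[p.length]? = some s := by simp
    have ds := depth_even_of_play V.toIsPlay _ _ hs
    have dv : depth F v = depth F s.1 + 1 := by rw [depth_par hv hv0, hpar]
    -- Views are shortsighted, so the opponent's move has to point to the last move `s`, whose
    -- position is `p.length`.
    have : p ++ [s] ++ [(v, p.length)] ∈ S := by
      refine hW.opponentComplete _ h1 hlen _ ⟨⟨?_, ?_, ?_, ?_⟩, ?_, ?_⟩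
      · intro a ha
        rcases List.mem_append.1 ha with ha | ha
        · exact V.moves a ha
        · simp only [List.mem_singleton] at ha; subst ha; exact hv
      · intro a ha
        rcases e1 _ _ ha with ha | ⟨ha, _⟩
        · exact V.initial a ha
        · omega
      · intro i a ha
        rcases e1 _ _ ha with ha | ⟨hi, rfl⟩
        · obtain ⟨h1, t, ht, he⟩ := V.pointer i a ha
          exact ⟨h1, t, e2 _ _ ht, he⟩
        · refine ⟨by simpa using hi.ge, s, e2 _ _ hs, ?_⟩
          simp only
          rw [← hpar]; exact (iEdge_par hv hv0).2
      · intro i a b ha hb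
        rcases e1 _ _ hb with hb | ⟨hi, rfl⟩
        · rcases e1 _ _ ha with ha | ⟨hi, _⟩
          · exact V.alternating i a b ha hb
          · have := e3 _ _ hb; omega
        · rcases e1 _ _ ha with ha | ⟨hi', _⟩
          · obtain rfl : i = p.length := by omega
            obtain rfl : s = a := by simpa using ha
            simp only
            rw [dv, Nat.odd_add_one, Nat.not_odd_iff_even]
          · omega
      · intro k a ha
        rcases e1 _ _ ha with ha | ⟨hi, rfl⟩
        · exact V.shortsighted k a ha
        · simp only; omega
      · intro k a b ha hb
        rcases e1 _ _ hb with hb | ⟨hi, rfl⟩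
        · rcases e1 _ _ ha with ha | ⟨hi, _⟩
          · exact V.uniform k a b ha hb
          · have := e3 _ _ hb; omega
        · simp only [List.length_append, List.length_singleton] at hlen
          obtain ⟨m, hm⟩ := hlen; omega
    exact ⟨_, this, by simp [vs]⟩
  · intro l u v h hl
    rw [show l ++ [u, v] = (l ++ [u]) ++ [v] by simp] at h
    obtain ⟨p, s, h1, h2, rfl⟩ := hpre _ v h
    have V := hW.views _ h1
    have hpl : p.length = l.length + 1 := by rw [← length_vs, h2]; simp
    obtain ⟨m, hm⟩ := hl
    have hs : (p ++ [s])[2 * m + 1 + 1]? = some s := by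
      rw [show 2 * m + 1 + 1 = p.length by omega]; simp
    have f := (play_par V.toIsPlay hs).2.2
    rw [V.shortsighted m s hs, vs_append, h2, ← hm] at f
    simpa using f.symm
  · intro l v h
    obtain ⟨p, s, h1, rfl, rfl⟩ := hpre l v h
    rw [length_vs]
    exact depth_even_of_play (hW.views _ h1).toIsPlay _ _ (by simp)
  · intro l hl hodd
    have hp := (hmem l).1 hl
    obtain ⟨s, hs, hu⟩ := hW.playerTotal _ hp (by simpa [ptr] using hodd)
    refine ⟨s.1, ⟨_, hs, by rw [vs_append, vs_ptr]; rfl⟩, ?_⟩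
    -- Two continuations of the same list of moves continue the same view, since its pointers are
    -- determined.
    intro v hv
    obtain ⟨q, t, h1, h2, rfl⟩ := hpre l v hv
    have hq : q ∈ S := hW.prefixClosed _ h1 _ (List.prefix_append _ _)
    rw [hptr q hq, h2] at h1
    rw [hu t h1]
  · intro l u v h hl
    obtain ⟨p, hp, e⟩ := h
    have V := hW.views _ hp
    obtain ⟨m, hm⟩ := hl
    have g : ∀ i : ℕ, (vs p)[i]? = (l ++ [u, v])[i]? := fun i => by rw [e]
    have g1 := g (2 * m)
    have g2 := g (2 * m + 1)
    rw [show 2 * m = l.length by omega, vs_getElem?] at g1 g2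
    rw [show (l ++ [u, v])[l.length]? = some u by simp, Option.map_eq_some_iff] at g1
    rw [show (l ++ [u, v])[l.length + 1]? = some v by simp, Option.map_eq_some_iff] at g2
    obtain ⟨s, hs, rfl⟩ := g1
    obtain ⟨t, ht, rfl⟩ := g2
    rw [show l.length = 2 * m by omega] at hs ht
    exact ⟨V.uniform m s t hs ht, ((hL p hp).1 m s t hs ht).symm⟩

/-! ## From languages to strategies -/

section
variable {F : Formula} {L : Set (List Vertex)}

theorem LW.take (h : LW F L) {l : List Vertex} (hl : l ∈ L) {i : ℕ} {v : Vertex}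
    (hv : l[i]? = some v) : l.take i ++ [v] ∈ L := by
  have : l.take i ++ [v] = l.take (i + 1) := by rw [List.take_add_one]; simp [hv]
  rw [this]
  exact h.prefix (m := l.drop (i + 1)) (by rwa [List.take_append_drop])

theorem LW.take_pair (h : LW F L) {l : List Vertex} (hl : l ∈ L) {i : ℕ} {u v : Vertex}
    (hu : l[i]? = some u) (hv : l[i + 1]? = some v) : l.take i ++ [u, v] ∈ L := by
  have := h.take hl hv
  rwa [List.take_add_one, hu, List.append_assoc] at this

theorem length_take_of_getElem? {l : List Vertex} {i : ℕ} {v : Vertex} (hv : l[i]? = some v) :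
    (l.take i).length = i := by
  have := (List.getElem?_eq_some_iff.1 hv).1
  rw [List.length_take]; omega

theorem getElem?_ptr (F : Formula) (l : List Vertex) (i : ℕ) :
    (ptr F l)[i]? = (l[i]?).map fun v => (v, l.idxOf (par F v)) := by simp [ptr]

theorem LW.par_index (h : LW F L) {l : List Vertex} (hl : l ∈ L) {i : ℕ} {v : Vertex}
    (hv : l[i + 1]? = some v) :
    v ≠ headV F ∧ l.idxOf (par F v) < i + 1 ∧ l[l.idxOf (par F v)]? = some (par F v) := by
  have h1 := h.struct _ (h.take hl hv)
  have hlen := length_take_of_getElem? hv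
  rcases Struct.snoc_iff.1 h1 with ⟨h2, _⟩ | ⟨_, _, _, h3, h4⟩
  · rw [h2] at hlen; simp at hlen
  · refine ⟨h3, ?_, ?_⟩
    · have : l = l.take (i + 1) ++ l.drop (i + 1) := (List.take_append_drop _ _).symm
      rw [this, List.idxOf_append_of_mem h4]
      have := List.idxOf_lt_length_of_mem h4
      omega
    · have hm : par F v ∈ l := List.take_subset _ _ h4
      rw [List.getElem?_eq_getElem (List.idxOf_lt_length_of_mem hm), List.getElem_idxOf]

theorem LW.isView (h : LW F L) {l : List Vertex} (hl : l ∈ L) : IsView F (ptr F l) := by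
  have hS := h.struct l hl
  refine ⟨⟨?_, ?_, ?_, ?_⟩, ?_, ?_⟩
  · intro s hs
    obtain ⟨v, hv, rfl⟩ := List.mem_map.1 hs
    exact hS.mv hv
  · intro s hs
    rw [getElem?_ptr, Option.map_eq_some_iff] at hs
    obtain ⟨v, hv, rfl⟩ := hs
    cases l with
    | nil => simp at hv
    | cons a l =>
      obtain rfl : a = v := by simpa using hv
      have := hS.head
      subst this
      exact ⟨IRoot_headV F, by simp [par_headV]⟩
  · intro i s hs
    rw [getElem?_ptr, Option.map_eq_some_iff] at hs
    obtain ⟨v, hv, rfl⟩ := hs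
    obtain ⟨h1, h2, h3⟩ := h.par_index hl hv
    refine ⟨h2, _, by rw [getElem?_ptr, h3]; rfl, ?_⟩
    exact (iEdge_par (hS.mv (List.mem_of_getElem? hv)) h1).2
  · intro i s t hs ht
    rw [getElem?_ptr, Option.map_eq_some_iff] at hs ht
    obtain ⟨v, hv, rfl⟩ := hs
    obtain ⟨w, hw, rfl⟩ := ht
    have h1 := h.parity _ _ (h.take hl hv)
    have h2 := h.parity _ _ (h.take hl hw)
    rw [length_take_of_getElem? hv] at h1
    rw [length_take_of_getElem? hw] at h2
    simp only
    rw [h1, ← Nat.not_even_iff_odd, h2, Nat.even_add_one, not_not]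
  · intro k s hs
    rw [getElem?_ptr, Option.map_eq_some_iff] at hs
    obtain ⟨v, hv, rfl⟩ := hs
    have hlt : 2 * k + 1 < l.length := by
      have := (List.getElem?_eq_some_iff.1 hv).1; omega
    have hu : l[2 * k + 1]? = some l[2 * k + 1] := List.getElem?_eq_getElem hlt
    have := h.oppar _ _ _ (h.take_pair hl hu hv) (by
      rw [length_take_of_getElem? hu]; exact ⟨k, by omega⟩)
    simp only
    rw [this]
    exact (h.nodup l hl).idxOf_getElem _ hlt
  · intro k s t hs ht
    rw [getElem?_ptr, Option.map_eq_some_iff] at hs ht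
    obtain ⟨v, hv, rfl⟩ := hs
    obtain ⟨w, hw, rfl⟩ := ht
    exact (h.lab _ _ _ (h.take_pair hl hv hw)
      (by rw [length_take_of_getElem? hv]; exact ⟨k, by omega⟩)).1

theorem LW.wellBatched (h : LW F L) {l : List Vertex} (hl : l ∈ L) :
    WellBatched F (ptr F l) := by
  intro k s t hs ht
  rw [getElem?_ptr, Option.map_eq_some_iff] at hs ht
  obtain ⟨v, hv, rfl⟩ := hs
  obtain ⟨w, hw, rfl⟩ := ht
  exact (h.lab _ _ _ (h.take_pair hl hv hw)
    (by rw [length_take_of_getElem? hv]; exact ⟨k, by omega⟩)).2.symm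

/-- Each box having a move of a view in its scope is linked to a box of even depth. -/
theorem LW.exists_even (h : LW F L) {l : List Vertex} (hl : l ∈ L) :
    ∀ (v b : Vertex) (i : ℕ), v ∈ l → (addr F v)[i]? = some b → l.length % 2 = 0 →
      ∃ w, Relation.EqvGen (Lk F l) b w ∧ Even (depth F w) := by
  obtain ⟨N, hN⟩ : ∃ N, l.length = N := ⟨_, rfl⟩
  induction N using Nat.strong_induction_on generalizing l with
  | _ N ih =>
  intro v b i hv hb hev
  rcases List.eq_nil_or_concat' l with rfl | ⟨l1, p, rfl⟩
  · simp at hv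
  rcases List.eq_nil_or_concat' l1 with rfl | ⟨l2, o, rfl⟩
  · simp at hev
  simp only [List.append_assoc, List.cons_append, List.nil_append,
    List.length_append, List.length_cons, List.length_nil] at hl hv hev hN ⊢
  have hev2 : l2.length % 2 = 0 := by omega
  have h2 : l2 ∈ L := h.prefix hl
  have hE : Even l2.length := Nat.even_iff.2 hev2
  have old : ∀ (v b : Vertex) (i : ℕ), v ∈ l2 → (addr F v)[i]? = some b →
      ∃ w, Relation.EqvGen (Lk F (l2 ++ [o, p])) b w ∧ Even (depth F w) := by
    intro v b i hv hb
    obtain ⟨w, hw, he⟩ := ih _ (by omega) h2 rfl v b i hv hb hev2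
    exact ⟨w, hw.mono fun a b hab => hab.mono (List.prefix_append _ _), he⟩
  have ho : ∀ (b : Vertex) (i : ℕ), (addr F o)[i]? = some b →
      ∃ w, Relation.EqvGen (Lk F (l2 ++ [o, p])) b w ∧ Even (depth F w) := by
    intro b i hb
    have hlo : l2 ++ [o] ∈ L := h.prefix (m := [p]) (by simpa using hl)
    have hm : Mv F o := (h.struct _ hlo).mv (by simp)
    -- A box around an opponent move has even depth itself or also surrounds the justifier, which
    -- occurs earlier in the view.
    rcases addr_par hm hb with h3 | ⟨h3, h4⟩
    · exact ⟨b, .refl _, h3.2 ((h.parity _ _ hlo).2 hE)⟩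
    · rcases Struct.snoc_iff.1 (h.struct _ hlo) with ⟨_, h5⟩ | ⟨_, _, _, _, h5⟩
      · exact absurd h5 h3
      · exact old _ _ _ h5 h4
  have hlen := (h.lab _ _ _ hl hE).2
  simp only [List.mem_append, List.mem_cons, List.not_mem_nil, or_false] at hv
  rcases hv with hv | rfl | rfl
  · exact old v b i hv hb
  · exact ho b i hb
  -- A box around a player move is linked to the box of the same index around the preceding opponent
  -- move.
  · have hi : i < (addr F o).length := by
      rw [← hlen]; exact (List.getElem?_eq_some_iff.1 hb).1
    obtain ⟨w, hw, he⟩ := ho _ i (List.getElem?_eq_getElem hi)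
    refine ⟨w, .trans _ _ _ (.symm _ _ (.rel _ _ ?_)) hw, he⟩
    exact ⟨l2, o, v, hE, List.prefix_rfl, .inr ⟨i, List.getElem?_eq_getElem hi, hb⟩⟩

/-- `LW` records only that a class has at most one vertex of even depth; `LW.exists_even` supplies
one. Legality of the pointers chosen by `ptr` is `LW.isView`. -/
theorem ckwis_of_lw (h : LW F L) : IsCKWIS F (ptr F '' L) := by
  have hsn : ∀ l v, l ++ [v] ∈ L → ptr F (l ++ [v]) = ptr F l ++ [(v, l.idxOf (par F v))] :=
    fun l v hl => (h.struct _ hl).ptr_snoc (h.nodup _ hl)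
  have hinv : ∀ l s, ptr F l ++ [s] ∈ ptr F '' L → l ++ [s.1] ∈ L := by
    rintro l s ⟨m, hm, e⟩
    have := congrArg vs e
    rw [vs_ptr, vs_append, vs_ptr] at this
    rw [this] at hm; exact hm
  refine ⟨⟨h.fin.image _, ⟨_, _, h.nil, rfl⟩, ?_, ?_, ?_, ?_⟩, ?_⟩
  · rintro _ ⟨l, hl, rfl⟩ q hq
    induction l using List.reverseRecOn with
    | nil =>
      obtain rfl : q = [] := by simpa [ptr] using hq
      exact ⟨[], h.nil, rfl⟩
    | append_singleton l v ih =>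
      rw [hsn l v hl] at hq
      rcases List.prefix_concat_iff.1 hq with hq | hq
      · exact ⟨_, hl, by rw [hsn l v hl, hq]⟩
      · exact ih (h.pre _ _ hl) hq
  · rintro _ ⟨l, hl, rfl⟩
    exact h.isView hl
  -- The move of a legal extension is allowed by `init` or `opp`; its pointer is then the one given
  -- by `ptr`, because the extended list has no repetitions.
  · rintro _ ⟨l, hl, rfl⟩ hev s hV
    rw [show (ptr F l).length = l.length by simp [ptr]] at hev
    have hst := struct_of_play hV.toIsPlay
    rw [vs_append, vs_ptr] at hst
    have hmem : l ++ [s.1] ∈ L := by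
      rcases Struct.snoc_iff.1 hst with ⟨rfl, e⟩ | ⟨h1, h2, h3, h4, h5⟩
      · rw [e]; exact h.init
      · rcases List.eq_nil_or_concat' l with rfl | ⟨l', u, rfl⟩
        · simp at h1
        · simp only [List.length_append, List.length_singleton] at hev
          rw [Nat.even_add_one, Nat.not_even_iff_odd] at hev
          rw [List.append_assoc]
          refine h.opp l' u s.1 hl hev h3 h4 ?_
          obtain ⟨m, hm⟩ := hev
          have hs : (ptr F (l' ++ [u]) ++ [s])[2 * m + 1 + 1]? = some s := by
            rw [List.getElem?_append_right (by simp [ptr, hm])]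
            simp [ptr, hm]
          have f := (play_par hV.toIsPlay hs).2.2
          rw [hV.shortsighted m s hs, vs_append, vs_ptr, ← hm] at f
          simpa using f.symm
    refine ⟨_, hmem, ?_⟩
    have := eq_ptr_of_play hV.toIsPlay (by
      rw [vs_append, vs_ptr]; exact h.nodup _ hmem)
    rw [this, vs_append, vs_ptr]; rfl
  · rintro _ ⟨l, hl, rfl⟩ hodd
    rw [show (ptr F l).length = l.length by simp [ptr]] at hodd
    obtain ⟨v, hv, hu⟩ := h.player l hl hodd
    refine ⟨_, ⟨_, hv, hsn _ _ hv⟩, ?_⟩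
    intro s hs
    have h1 := hinv l s hs
    have h2 := hu s.1 h1
    obtain ⟨m, hm, e⟩ := hs
    have e' := congrArg vs e
    rw [vs_ptr, vs_append, vs_ptr] at e'
    have e'' : m = l ++ [s.1] := e'
    rw [e'', hsn _ _ h1] at e
    have := List.append_cancel_left e
    simp only [List.cons.injEq, and_true] at this
    rw [← this, h2]
  · rintro _ ⟨l, hl, rfl⟩
    have hwb := h.wellBatched hl
    refine ⟨hwb, ?_⟩
    intro v hv
    have heq : ∀ a b, Relation.EqvGen (Link F (ptr F l)) a b ↔ Relation.EqvGen (Lk F l) a b := by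
      intro a b
      have : Link F (ptr F l) = Lk F l := by
        funext a b; rw [eq_iff_iff, link_iff hwb, vs_ptr]
      rw [this]
    simp only [link_iff hwb, vs_ptr, heq] at hv ⊢
    have hex : ∀ x y, Lk F l x y → ∃ w, Relation.EqvGen (Lk F l) x w ∧ Even (depth F w) := by
      rintro x y ⟨l', o, p, h1, h2, h3⟩
      have hlm : l' ++ [o, p] ∈ L := by obtain ⟨r, rfl⟩ := h2; exact h.prefix hl
      rcases h3 with ⟨rfl, rfl⟩ | ⟨i, h4, h5⟩
      · refine ⟨x, .refl _, (h.parity l' x (h.prefix (m := [y]) (by simpa using hlm))).2 h1⟩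
      · obtain ⟨w, hw, he⟩ := h.exists_even hlm o x i (by simp) h4 (by
          rw [List.length_append]; simp [Nat.even_iff.1 h1])
        exact ⟨w, hw.mono fun a b hab => hab.mono h2, he⟩
    have : ∃ w, Relation.EqvGen (Lk F l) v w ∧ Even (depth F w) := by
      obtain ⟨x, hx | hx⟩ := hv
      · exact hex _ _ hx
      · obtain ⟨w, hw, he⟩ := hex _ _ hx
        exact ⟨w, .trans _ _ _ (.symm _ _ (.rel _ _ hx)) hw, he⟩
    obtain ⟨w, hw, he⟩ := this
    refine ⟨w, ⟨hw, he⟩, ?_⟩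
    rintro w' ⟨hw', he'⟩
    exact h.link l hl _ _ (.trans _ _ _ (.symm _ _ hw') hw) he' he

end

/-! ## Maps between arenas -/

/-- From the arena of `Γ ⊢ A`, where `A` is the `j`-th argument of the hypothesis `y`, to the arena
of a sequent with hypotheses `Γ`. -/
def argMap (n y j : ℕ) (v : Vertex) : Vertex :=
  match splitV n v with
  | .inl _ => v
  | .inr w => hypV y (hypV j w)

/-- From the arena of `B₁,…,Bₖ ⊢ C` to that of `Γ ⊢ □C`, where `□Bᵢ` is the target of the
hypothesis `y i`. -/
def bodyMap {n : ℕ} (Γ : Fin n → Formula) {k : ℕ} (y : Fin k → Fin n) (v : Vertex) : Vertex :=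
  match splitV k v with
  | .inl (i, w) => hypV (y i) (conV (ar (Γ (y i))) (true :: w))
  | .inr w => conV n (true :: w)

/-- The action on vertices of a renaming of hypotheses. -/
def renV {n m : ℕ} (ρ : Fin n → Fin m) (v : Vertex) : Vertex :=
  match splitV n v with
  | .inl (i, w) => hypV (ρ i) w
  | .inr w => conV m w

theorem argMap_hypV {n : ℕ} (y j : ℕ) (i : Fin n) (w : Vertex) :
    argMap n y j (hypV i w) = hypV i w := by simp [argMap, splitV_hypV]

theorem argMap_conV (n y j : ℕ) (w : Vertex) : argMap n y j (conV n w) = hypV y (hypV j w) := by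
  simp [argMap, splitV_conV]

theorem bodyMap_hypV {n k : ℕ} (Γ : Fin n → Formula) (y : Fin k → Fin n) (i : Fin k)
    (w : Vertex) : bodyMap Γ y (hypV i w) = hypV (y i) (conV (ar (Γ (y i))) (true :: w)) := by
  simp [bodyMap, splitV_hypV]

theorem bodyMap_conV {n k : ℕ} (Γ : Fin n → Formula) (y : Fin k → Fin n) (w : Vertex) :
    bodyMap Γ y (conV k w) = conV n (true :: w) := by
  simp [bodyMap, splitV_conV]

theorem renV_hypV {n m : ℕ} (ρ : Fin n → Fin m) (i : Fin n) (w : Vertex) :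
    renV ρ (hypV i w) = hypV (ρ i) w := by simp [renV, splitV_hypV]

theorem renV_conV {n m : ℕ} (ρ : Fin n → Fin m) (w : Vertex) :
    renV ρ (conV n w) = conV m w := by simp [renV, splitV_conV]

theorem Mv.cases {n : ℕ} {Γ : Fin n → Formula} {C : Formula} {v : Vertex}
    (h : Mv (imps Γ C) v) : (∃ w, v = conV n w ∧ Mv C w) ∨
      ∃ (i : Fin n) (w : Vertex), v = hypV i w ∧ Mv (Γ i) w := by
  rcases vertex_cases h.isVertex with ⟨w, rfl⟩ | ⟨i, w, rfl⟩
  · exact .inl ⟨w, rfl, mv_conV.1 h⟩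
  · exact .inr ⟨i, w, rfl, mv_hypV.1 h⟩

theorem hypV_add (n j : ℕ) (w : Vertex) : hypV (n + j) w = conV n (hypV j w) := by
  rw [hypV, List.replicate_add, List.append_assoc]; rfl

theorem conV_add (n k : ℕ) (w : Vertex) : conV (n + k) w = conV n (conV k w) := by
  rw [conV, List.replicate_add, List.append_assoc]; rfl

/-- Maps of moves that preserve the initial move, justifiers, labels and polarities. -/
structure Emb (F G : Formula) (g : Vertex → Vertex) : Prop where
  label : ∀ v, Mv F v → label G (g v) = label F v
  parity : ∀ v, Mv F v → (Even (depth G (g v)) ↔ Even (depth F v))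
  head : g (headV F) = headV G
  par : ∀ v, Mv F v → v ≠ headV F → g v ≠ headV G ∧ par G (g v) = g (par F v)

theorem Emb.mv {F G : Formula} {g : Vertex → Vertex} (h : Emb F G g) {v : Vertex}
    (hv : Mv F v) : Mv G (g v) := by
  obtain ⟨a, ha⟩ := hv
  exact ⟨a, by rw [h.label v ⟨a, ha⟩, ha]⟩

theorem Emb.struct {F G : Formula} {g : Vertex → Vertex} (h : Emb F G g) {l : List Vertex}
    (hl : Struct F l) : Struct G (l.map g) := by
  induction hl with
  | nil => exact .nil
  | init => rw [List.map_singleton, h.head]; exact .init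
  | snoc _ h1 h2 h3 ih =>
    rw [List.map_append]
    obtain ⟨h4, h5⟩ := h.par _ h1 h2
    exact .snoc ih (h.mv h1) h4 (by rw [h5]; exact List.mem_map_of_mem h3)

theorem Emb.ptr {F G : Formula} {g : Vertex → Vertex} (h : Emb F G g) {l : List Vertex}
    (hl : Struct F l) (hn : (l.map g).Nodup) : ptr G (l.map g) = mapMoves g (ptr F l) := by
  rw [CKGame.ptr, mapMoves, CKGame.ptr, List.map_map, List.map_map]
  refine List.map_congr_left fun v hv => ?_
  simp only [Function.comp_apply, Prod.mk.injEq, true_and]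
  have hp : CKGame.par G (g v) = g (CKGame.par F v) := by
    by_cases e : v = headV F
    · rw [e, h.head, par_headV, par_headV, h.head]
    · exact (h.par v (hl.mv hv) e).2
  have hm := List.idxOf_lt_length_of_mem (hl.par_mem hv)
  have := hn.idxOf_getElem _ (by rwa [List.length_map])
  rw [List.getElem_map, List.getElem_idxOf] at this
  rw [hp, this]

/-- Passing to the target of a hypothesis and then under its box changes neither depth nor edges,
and sends the head of `B i` to the head of the hypothesis `y i`. Only addresses change, by one
additional outermost box. -/
theorem emb_bodyMap {n k : ℕ} {Γ : Fin n → Formula} {y : Fin k → Fin n} {B : Fin k → Formula}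
    (C : Formula) (hy : ∀ i, tgt (Γ (y i)) = .box (B i)) :
    Emb (imps B C) (imps Γ (.box C)) (bodyMap Γ y) := by
  refine ⟨fun v hv => ?_, fun v hv => ?_, ?_, fun v hv h0 => ?_⟩
  · rcases hv.cases with ⟨w, rfl, _⟩ | ⟨i, w, rfl, _⟩
    · rw [bodyMap_conV, label_conV, label_conV]; rfl
    · rw [bodyMap_hypV, label_hypV, label_hypV, label_tgt, hy]; rfl
  · rcases hv.cases with ⟨w, rfl, _⟩ | ⟨i, w, rfl, _⟩
    · rw [bodyMap_conV, depth_conV, depth_conV]; rfl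
    · rw [bodyMap_hypV, depth_hypV, depth_hypV, depth_tgt, hy]; rfl
  · rw [headV_imps, headV_imps, bodyMap_conV]; rfl
  · rw [headV_imps] at h0 ⊢
    rcases hv.cases with ⟨w, rfl, _⟩ | ⟨i, w, rfl, _⟩
    · rw [bodyMap_conV, par_conV, par_conV, bodyMap_conV]
      rw [Ne, conV_inj] at h0
      exact ⟨by rw [Ne, conV_inj]; simpa [headV] using h0, rfl⟩
    · rw [bodyMap_hypV, par_hypV, par_hypV]
      refine ⟨hypV_ne_conV (y i).2 _ _, ?_⟩
      have hh : headV (Γ (y i)) = conV (ar (Γ (y i))) (true :: headV (B i)) := by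
        rw [headV_tgt, hy]; rfl
      by_cases e : w = headV (B i)
      · rw [if_pos e, if_pos (by rw [e, hh]), bodyMap_conV]; rfl
      · rw [if_neg e, if_neg (by rw [hh, conV_inj]; simpa using e), bodyMap_hypV, par_tgt, hy]
        rfl

section
variable {n : ℕ} {Γ : Fin n → Formula} {C : Formula} {y : Fin n} {j : ℕ}

theorem label_argMap (hj : j < ar (Γ y)) {v : Vertex} (hv : IsVertex (imps Γ (argF (Γ y) j)) v) :
    label (imps Γ C) (argMap n y j v) = label (imps Γ (argF (Γ y) j)) v := by
  rcases vertex_cases hv with ⟨w, rfl⟩ | ⟨i, w, rfl⟩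
  · rw [argMap_conV, label_hypV, label_arg hj, label_conV]
  · rw [argMap_hypV, label_hypV, label_hypV]

theorem parity_argMap (hj : j < ar (Γ y)) {v : Vertex}
    (hv : (∃ w, v = conV n w) ∨ ∃ (i : Fin n) (w : Vertex), v = hypV i w) :
    Even (depth (imps Γ C) (argMap n y j v)) ↔ Even (depth (imps Γ (argF (Γ y) j)) v) := by
  rcases hv with ⟨w, rfl⟩ | ⟨i, w, rfl⟩
  · rw [argMap_conV, depth_hypV, depth_arg hj, depth_conV, Nat.even_add_one, Nat.even_add_one,
      not_not]
  · rw [argMap_hypV, depth_hypV, depth_hypV]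

theorem addr_argMap (hj : j < ar (Γ y)) {v : Vertex} (hv : IsVertex (imps Γ (argF (Γ y) j)) v) :
    addr (imps Γ C) (argMap n y j v) = (addr (imps Γ (argF (Γ y) j)) v).map (argMap n y j) := by
  rcases vertex_cases hv with ⟨w, rfl⟩ | ⟨i, w, rfl⟩
  · rw [argMap_conV, addr_hypV, addr_arg hj, addr_conV, List.map_map, List.map_map]
    refine List.map_congr_left fun b _ => ?_
    simp [argMap_conV]
  · rw [argMap_hypV, addr_hypV, addr_hypV, List.map_map]
    refine List.map_congr_left fun b _ => ?_
    simp [argMap_hypV]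

theorem headV_argMap : argMap n y j (headV (imps Γ (argF (Γ y) j))) =
    hypV y (hypV j (headV (argF (Γ y) j))) := by
  rw [headV_imps, argMap_conV]

theorem par_argMap_head (hj : j < ar (Γ y)) :
    par (imps Γ C) (argMap n y j (headV (imps Γ (argF (Γ y) j)))) = hypV y (headV (Γ y)) := by
  rw [headV_argMap, par_hypV, if_neg, par_arg hj, if_pos rfl]
  rw [headV_tgt (Γ y)]
  exact hypV_ne_conV hj _ _

theorem argMap_ne_headV {v : Vertex} (hv : Mv (imps Γ (argF (Γ y) j)) v) :
    argMap n y j v ≠ headV (imps Γ C) := by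
  rw [headV_imps]
  rcases hv.cases with ⟨w, rfl, _⟩ | ⟨i, w, rfl, _⟩
  · rw [argMap_conV]; exact hypV_ne_conV y.2 _ _
  · rw [argMap_hypV]; exact hypV_ne_conV i.2 _ _

/-- Justifiers along `argMap`. -/
theorem par_argMap (hj : j < ar (Γ y)) {v : Vertex} (hv : Mv (imps Γ (argF (Γ y) j)) v)
    (h0 : v ≠ headV (imps Γ (argF (Γ y) j))) :
    ((∃ x : Fin n, v = hypV x (headV (Γ x))) ∧
      par (imps Γ C) (argMap n y j v) = headV (imps Γ C) ∧
      par (imps Γ (argF (Γ y) j)) v = headV (imps Γ (argF (Γ y) j))) ∨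
    ((¬ ∃ x : Fin n, v = hypV x (headV (Γ x))) ∧
      par (imps Γ C) (argMap n y j v) = argMap n y j (par (imps Γ (argF (Γ y) j)) v)) := by
  rcases hv.cases with ⟨w, rfl, _⟩ | ⟨i, w, rfl, _⟩
  · right
    refine ⟨?_, ?_⟩
    · rintro ⟨x, hx⟩; exact hypV_ne_conV x.2 _ _ hx.symm
    · rw [headV_imps, Ne, conV_inj] at h0
      rw [argMap_conV, par_conV, argMap_conV, par_hypV, if_neg, par_arg hj, if_neg h0]
      rw [headV_tgt (Γ y)]
      exact hypV_ne_conV hj _ _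
  · by_cases e : w = headV (Γ i)
    · left
      refine ⟨⟨i, by rw [e]⟩, ?_, ?_⟩
      · rw [argMap_hypV, par_hypV, if_pos e, headV_imps]
      · rw [par_hypV, if_pos e, headV_imps]
    · right
      refine ⟨?_, ?_⟩
      · rintro ⟨x, hx⟩
        obtain ⟨h1, h2⟩ := hypV_inj.1 hx
        obtain rfl := Fin.ext h1
        exact e h2
      · rw [argMap_hypV, par_hypV, if_neg e, par_hypV, if_neg e, argMap_hypV]

/-- Justifiers change in two places only: the opening move of the argument is now justified by the
head of `y`, and heads of hypotheses by the opening move of the whole sequence. Both are in `q`. -/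
theorem struct_graft (hj : j < ar (Γ y)) {q l : List Vertex} (hq : Struct (imps Γ C) q)
    (hyq : hypV y (headV (Γ y)) ∈ q) (hl : Struct (imps Γ (argF (Γ y) j)) l) :
    Struct (imps Γ C) (q ++ l.map (argMap n y j)) := by
  have hmv : ∀ v, Mv (imps Γ (argF (Γ y) j)) v → Mv (imps Γ C) (argMap n y j v) := by
    rintro v ⟨a, ha⟩
    exact ⟨a, by rw [label_argMap hj (Mv.isVertex ⟨a, ha⟩), ha]⟩
  induction hl with
  | nil => simpa using hq
  | init =>
    refine .snoc hq (hmv _ (mv_headV _)) (argMap_ne_headV (mv_headV _)) ?_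
    rw [par_argMap_head hj]; exact hyq
  | snoc _ h1 h2 h3 ih =>
    rw [List.map_append, ← List.append_assoc]
    refine .snoc ih (hmv _ h1) (argMap_ne_headV h1) ?_
    rcases par_argMap (C := C) hj h1 h2 with ⟨_, h4, _⟩ | ⟨_, h4⟩
    · rw [h4]; exact List.mem_append_left _ (hq.head_mem (List.ne_nil_of_mem hyq))
    · rw [h4]; exact List.mem_append_right _ (List.mem_map_of_mem h3)

end

/-- A structured sequence playing in a hypothesis plays its head. -/
theorem Struct.hyp_head {n : ℕ} {Γ : Fin n → Formula} {C : Formula} {l : List Vertex}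
    (h : Struct (imps Γ C) l) {x : Fin n} {w : Vertex} (hx : hypV x w ∈ l) :
    hypV x (headV (Γ x)) ∈ l := by
  induction h generalizing w with
  | nil => simp at hx
  | init =>
    rw [List.mem_singleton, headV_imps] at hx
    exact absurd hx (hypV_ne_conV x.2 _ _)
  | snoc _ _ _ h3 ih =>
    rcases List.mem_append.1 hx with hx | hx
    · exact List.mem_append_left _ (ih hx)
    · rw [List.mem_singleton] at hx
      subst hx
      rw [par_hypV] at h3
      split at h3
      · next e => rw [e]; simp
      · exact List.mem_append_left _ (ih h3)

/-! ## Typing derivations with their languages -/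

/-- The language of `y N₁ ⋯ Nₖ`, given those of the arguments. -/
def neutLang {n : ℕ} (Γ : Fin n → Formula) (y : Fin n) (LU : ℕ → Set (List Vertex)) :
    Set (List Vertex) :=
  {[], [conV n []], [conV n [], hypV y (headV (Γ y))]} ∪
    {l | ∃ j < ar (Γ y), ∃ m ∈ LU j,
      l = [conV n [], hypV y (headV (Γ y))] ++ m.map (argMap n y j)}

/-- The language of `M[N₁,…,Nₖ/x₁,…,xₖ]`, given that of `M` and those of the arguments of the
`Nᵢ`. -/
def boxLang {n : ℕ} (Γ : Fin n → Formula) {k : ℕ} (y : Fin k → Fin n) (B : Fin k → Formula)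
    (LM : Set (List Vertex)) (LU : Fin k → ℕ → Set (List Vertex)) : Set (List Vertex) :=
  List.map (bodyMap Γ y) '' LM ∪
    {l | ∃ i, ∃ j < ar (Γ (y i)), ∃ q ∈ LM, q.getLast? = some (hypV i (headV (B i))) ∧
      ∃ m ∈ LU i j, l = q.map (bodyMap Γ y) ++ m.map (argMap n (y i) j)}

/-- `Der Γ t C L`: there is a derivation of `Γ ⊢ t : C` with language `L`. An axiom is a neutral
term without arguments, and all the arguments of an explicit substitution are treated at once. -/
inductive Der : {n : ℕ} → (Fin n → Formula) → Tm n → Formula → Set (List Vertex) → Prop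
  | neut {n : ℕ} {Γ : Fin n → Formula} {T : Tm n} {D : Formula} {L : Set (List Vertex)}
      (y : Fin n) (c : ℕ) (U : ℕ → Tm n) (LU : ℕ → Set (List Vertex))
      (hy : tgt (Γ y) = .atom c)
      (hT : T = apps (.var y) (fun j : Fin (ar (Γ y)) => U j)) (hD : D = .atom c)
      (hL : L = neutLang Γ y LU)
      (d : ∀ j < ar (Γ y), Der Γ (U j) (argF (Γ y) j) (LU j)) : Der Γ T D L
  | lams {n : ℕ} {Γ : Fin n → Formula} {T : Tm n} {D : Formula} {L : Set (List Vertex)}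
      (k : ℕ) (hk : 0 < k) (A : Fin k → Formula) (M : Tm (n + k)) (C : Formula)
      (hC : C.NotImp) (hT : T = lams k M) (hD : D = imps A C)
      (d : Der (Fin.append Γ A) M C L) : Der Γ T D L
  | box {n : ℕ} {Γ : Fin n → Formula} {T : Tm n} {D : Formula} {L : Set (List Vertex)}
      (k : ℕ) (M : Tm k) (y : Fin k → Fin n) (B : Fin k → Formula) (C : Formula)
      (U : Fin k → ℕ → Tm n) (LM : Set (List Vertex)) (LU : Fin k → ℕ → Set (List Vertex))
      (hy : ∀ i, tgt (Γ (y i)) = .box (B i))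
      (hinj : ∀ i i', ar (Γ (y i)) = 0 → y i = y i' → i = i') (hM : ∀ x, Occurs M x)
      (hT : T = .esub M (fun i => apps (.var (y i)) (fun j : Fin (ar (Γ (y i))) => U i j)))
      (hD : D = .box C) (hL : L = boxLang Γ y B LM LU) (dM : Der B M C LM)
      (dU : ∀ i, ∀ j < ar (Γ (y i)), Der Γ (U i j) (argF (Γ (y i)) j) (LU i j)) : Der Γ T D L

theorem headV_atom_tgt {F : Formula} {c : ℕ} (h : tgt F = .atom c) :
    headV F = conV (ar F) [] := by rw [headV_tgt, h]; rfl

theorem struct_neut {n : ℕ} {Γ : Fin n → Formula} (y : Fin n) (c : ℕ) :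
    Struct (imps Γ (.atom c)) [conV n [], hypV y (headV (Γ y))] := by
  have h0 : headV (imps Γ (.atom c)) = conV n [] := headV_imps _ _
  have : Struct (imps Γ (.atom c)) [conV n []] := by rw [← h0]; exact .init
  refine .snoc this (mv_hypV.2 (mv_headV _)) ?_ ?_
  · rw [h0]; exact hypV_ne_conV y.2 _ _
  · rw [par_hypV, if_pos rfl]; simp [headV]

theorem bodyMap_head {n k : ℕ} {Γ : Fin n → Formula} {y : Fin k → Fin n} {B : Fin k → Formula}
    (hy : ∀ i, tgt (Γ (y i)) = .box (B i)) (i : Fin k) :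
    bodyMap Γ y (hypV i (headV (B i))) = hypV (y i) (headV (Γ (y i))) := by
  rw [bodyMap_hypV, headV_tgt (Γ (y i)), hy]; rfl

theorem Der.struct {n : ℕ} {Γ : Fin n → Formula} {t : Tm n} {C : Formula}
    {L : Set (List Vertex)} (d : Der Γ t C L) : ∀ l ∈ L, Struct (imps Γ C) l := by
  induction d with
  | @neut n Γ T D L y c U LU hy hT hD hL d ih =>
    subst hD hL
    have hs := struct_neut (Γ := Γ) y c
    rintro l (hl | ⟨j, hj, m, hm, rfl⟩)
    · rcases hl with rfl | rfl | rfl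
      · exact .nil
      · exact Struct.pre (m := [_]) hs
      · exact hs
    · exact struct_graft hj hs (by simp) (ih j hj m hm)
  | lams k hk A M C hC hT hD d ih => subst hD; rwa [imps_append] at ih
  | box k M y B C U LM LU hy hinj hM hT hD hL dM dU ihM ihU =>
    subst hD hL
    rintro l (⟨m, hm, rfl⟩ | ⟨i, j, hj, q, hq, hlast, m, hm, rfl⟩)
    · exact (emb_bodyMap C hy).struct (ihM m hm)
    · refine struct_graft hj ((emb_bodyMap C hy).struct (ihM q hq)) ?_ (ihU i j hj m hm)
      rw [← bodyMap_head hy]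
      exact List.mem_map_of_mem (List.mem_of_getLast? hlast)

theorem Der.nil_mem_and_init_mem {n : ℕ} {Γ : Fin n → Formula} {t : Tm n} {C : Formula}
    {L : Set (List Vertex)} (d : Der Γ t C L) : [] ∈ L ∧ [headV (imps Γ C)] ∈ L := by
  induction d with
  | neut y c U LU hy hT hD hL d ih =>
    subst hD hL
    rw [headV_imps]
    exact ⟨.inl (.inl rfl), .inl (.inr (.inl rfl))⟩
  | lams k hk A M C hC hT hD d ih => subst hD; rwa [imps_append] at ih
  | box k M y B C U LM LU hy hinj hM hT hD hL dM dU ihM ihU =>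
    subst hD hL
    refine ⟨.inl ⟨_, ihM.1, rfl⟩, .inl ⟨_, ihM.2, ?_⟩⟩
    rw [List.map_singleton, (emb_bodyMap C hy).head]

/-- A variable occurring in a term is played in its language. -/
theorem Der.exists_last {n : ℕ} {Γ : Fin n → Formula} {t : Tm n} {C : Formula}
    {L : Set (List Vertex)} (d : Der Γ t C L) {x : Fin n} (hx : Occurs t x) :
    ∃ l ∈ L, l.getLast? = some (hypV x (headV (Γ x))) := by
  induction d with
  | neut y c U LU hy hT hD hL d ih =>
    subst hT hL
    rw [occurs_apps] at hx
    rcases hx with rfl | ⟨i, hx⟩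
    · exact ⟨_, .inl (.inr (.inr rfl)), rfl⟩
    · obtain ⟨l, hl, h⟩ := ih i i.2 hx
      refine ⟨_, .inr ⟨i, i.2, l, hl, rfl⟩, ?_⟩
      rw [List.getLast?_append, List.getLast?_map, h]
      simp [argMap_hypV]
  | lams k hk A M C hC hT hD d ih =>
    subst hT
    obtain ⟨l, hl, h⟩ := ih (occurs_lams.1 hx)
    exact ⟨l, hl, by simpa using h⟩
  | @box n Γ T D L k M y B C U LM LU hy hinj hM hT hD hL dM dU ihM ihU =>
    subst hT hL
    obtain ⟨i, hx⟩ := hx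
    rw [occurs_apps] at hx
    -- Every bound variable occurs in the body, so some view of the body ends with its head; the
    -- arguments of the `i`-th term are grafted there.
    obtain ⟨q, hq, hlast⟩ := ihM (hM i)
    rcases hx with rfl | ⟨j, hx⟩
    · refine ⟨_, .inl ⟨q, hq, rfl⟩, ?_⟩
      rw [List.getLast?_map, hlast, Option.map_some, bodyMap_head hy]
    · obtain ⟨l, hl, h⟩ := ihU i j j.2 hx
      refine ⟨_, .inr ⟨i, j, j.2, q, hq, hlast, l, hl, rfl⟩, ?_⟩
      rw [List.getLast?_append, List.getLast?_map (l := l), h]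
      simp [argMap_hypV]

/-- A hypothesis played in the language of a term occurs in it. -/
theorem Der.occurs {n : ℕ} {Γ : Fin n → Formula} {t : Tm n} {C : Formula}
    {L : Set (List Vertex)} (d : Der Γ t C L) {x : Fin n} {w : Vertex} {l : List Vertex}
    (hl : l ∈ L) (hx : hypV x w ∈ l) : Occurs t x := by
  have argc : ∀ {n : ℕ} {Γ : Fin n → Formula} {F : Formula} {y x : Fin n} {j : ℕ} {w : Vertex}
      {m : List Vertex}, Struct (imps Γ F) m → hypV x w ∈ m.map (argMap n y j) →
      x = y ∨ hypV x w ∈ m := by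
    intro n Γ F y x j w m hm h
    obtain ⟨v, hv, e⟩ := List.mem_map.1 h
    rcases (hm.mv hv).cases with ⟨u, rfl, _⟩ | ⟨i, u, rfl, _⟩
    · rw [argMap_conV] at e
      exact .inl (Fin.ext (hypV_inj.1 e).1.symm)
    · rw [argMap_hypV] at e
      exact .inr (e ▸ hv)
  induction d generalizing w l with
  | @neut n Γ T D L y c U LU hy hT hD hL d ih =>
    subst hT hL
    rw [occurs_apps]
    have base : ∀ v ∈ [conV n [], hypV y (headV (Γ y))], v = hypV x w → x = y := by
      rintro v hv rfl
      simp only [List.mem_cons, List.not_mem_nil, or_false] at hv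
      rcases hv with hv | hv
      · exact absurd hv (hypV_ne_conV x.2 _ _)
      · exact Fin.ext (hypV_inj.1 hv).1
    rcases hl with hl | ⟨j, hj, m, hm, rfl⟩
    · rcases hl with rfl | rfl | rfl
      · simp at hx
      · exact .inl (base _ (List.mem_cons.2 (.inl (List.mem_singleton.1 hx))) rfl)
      · exact .inl (base _ hx rfl)
    · rcases List.mem_append.1 hx with hx | hx
      · exact .inl (base _ hx rfl)
      · rcases argc ((d j hj).struct m hm) hx with h | h
        · exact .inl h
        · exact .inr ⟨⟨j, hj⟩, ih j hj hm h⟩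
  | @lams n Γ T D L k hk A M C hC hT hD d ih =>
    subst hT
    exact occurs_lams.2 (ih (x := Fin.castAdd k x) hl hx)
  | @box n Γ T D L k M y B C U LM LU hy hinj hM hT hD hL dM dU ihM ihU =>
    subst hT hL
    have bodyc : ∀ m ∈ LM, hypV x w ∈ m.map (bodyMap Γ y) → ∃ i, x = y i := by
      intro m hm h
      obtain ⟨v, hv, e⟩ := List.mem_map.1 h
      rcases ((dM.struct m hm).mv hv).cases with ⟨u, rfl, _⟩ | ⟨i, u, rfl, _⟩
      · rw [bodyMap_conV] at e
        exact absurd e.symm (hypV_ne_conV x.2 _ _)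
      · rw [bodyMap_hypV] at e
        exact ⟨i, Fin.ext (hypV_inj.1 e).1.symm⟩
    have hyp : ∀ i, x = y i → Occurs (Tm.esub M fun i => apps (.var (y i))
        (fun j : Fin (ar (Γ (y i))) => U i j)) x :=
      fun i h => ⟨i, occurs_apps.2 (.inl h)⟩
    rcases hl with ⟨m, hm, rfl⟩ | ⟨i, j, hj, q, hq, hlast, m, hm, rfl⟩
    · obtain ⟨i, h⟩ := bodyc m hm hx
      exact hyp i h
    · rcases List.mem_append.1 hx with hx | hx
      · obtain ⟨i, h⟩ := bodyc q hq hx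
        exact hyp i h
      · rcases argc ((dU i j hj).struct m hm) hx with h | h
        · exact hyp i h
        · exact ⟨i, occurs_apps.2 (.inr ⟨⟨j, hj⟩, ihU i j hj hm h⟩)⟩

/-! ## Typing in natural deduction and normality -/

theorem ND.apps {n k : ℕ} {Γ : Fin n → Formula} {M : Tm n} {N : Fin k → Tm n}
    {A : Fin k → Formula} {C : Formula} (hM : ND Γ M (imps A C)) (hN : ∀ i, ND Γ (N i) (A i)) :
    ND Γ (CKGame.apps M N) C := by
  induction k generalizing C with
  | zero => rwa [apps_zero, ← imps_zero A C]
  | succ k ih =>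
    rw [apps_succ]
    refine .app (hN (Fin.last k)) (ih (A := fun i => A i.castSucc) ?_ (fun i => hN _))
    have : imps A C = imps (fun i : Fin k => A i.castSucc) (.imp (A (Fin.last k)) C) := by
      rw [imps, List.ofFn_succ', List.concat_eq_append, List.foldr_append]; rfl
    rwa [← this]

theorem append_snoc_init {n k : ℕ} (Γ : Fin n → Formula) (A : Fin (k + 1) → Formula) :
    Fin.append Γ A = Fin.snoc (α := fun _ => Formula) (Fin.append Γ fun i : Fin k => A i.castSucc)
      (A (Fin.last k)) := by
  funext i
  refine Fin.addCases (fun i => ?_) (fun i => ?_) i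
  · rw [Fin.append_left]
    have : Fin.castAdd (k + 1) i = (Fin.castAdd k i).castSucc := rfl
    rw [this, Fin.snoc_castSucc, Fin.append_left]
  · rw [Fin.append_right]
    refine Fin.lastCases ?_ (fun i => ?_) i
    · have : Fin.natAdd n (Fin.last k) = Fin.last (n + k) := rfl
      rw [this, Fin.snoc_last]
    · have : Fin.natAdd n i.castSucc = (Fin.natAdd n i).castSucc := rfl
      rw [this, Fin.snoc_castSucc, Fin.append_right]

theorem ND.lams {n k : ℕ} {Γ : Fin n → Formula} {A : Fin k → Formula} {M : Tm (n + k)}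
    {C : Formula} (h : ND (Fin.append Γ A) M C) : ND Γ (CKGame.lams k M) (imps A C) := by
  induction k generalizing C with
  | zero =>
    rw [imps_zero]
    have : Fin.append Γ A = Γ := by
      funext i; exact Fin.append_left Γ A i
    rw [this] at h
    exact h
  | succ k ih =>
    have e : imps A C = imps (fun i : Fin k => A i.castSucc) (.imp (A (Fin.last k)) C) := by
      rw [imps, List.ofFn_succ', List.concat_eq_append, List.foldr_append]; rfl
    rw [e]
    refine ih (M := .lam M) (.abs ?_)
    rwa [append_snoc_init] at h

theorem Der.nd {n : ℕ} {Γ : Fin n → Formula} {t : Tm n} {C : Formula}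
    {L : Set (List Vertex)} (d : Der Γ t C L) : ND Γ t C := by
  have hvar : ∀ {n : ℕ} (Γ : Fin n → Formula) (x : Fin n),
      ND Γ (.var x) (imps (fun j : Fin (ar (Γ x)) => argF (Γ x) j) (tgt (Γ x))) := by
    intro n Γ x; rw [imps_tgt]; exact .id Γ x
  induction d with
  | @neut n Γ T D L y c U LU hy hT hD hL d ih =>
    subst hT hD
    rw [← hy]
    exact ND.apps (hvar Γ y) fun j => ih j j.2
  | lams k hk A M C hC hT hD d ih => subst hT hD; exact ih.lams
  | @box n Γ T D L k M y B C U LM LU hy hinj hM hT hD hL dM dU ihM ihU =>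
    subst hT hD
    refine .boxSubst (A := B) (fun i => ?_) ihM
    rw [← hy]
    exact ND.apps (hvar Γ (y i)) fun j => ihU i j j.2

theorem IsNormal.lams {n k : ℕ} {Γ : Fin n → Formula} {A : Fin k → Formula} {M : Tm (n + k)}
    {C : Formula} (hM : IsNormal M) (h : ND (Fin.append Γ A) M C) :
    IsNormal (CKGame.lams k M) := by
  induction k generalizing C with
  | zero => exact hM
  | succ k ih =>
    rw [append_snoc_init] at h
    exact ih (M := .lam M) (.lam _ _ _ _ hM h) (.abs h)

/-- The derivation supplies the types, the heads and the occurrence of all bound variables that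
normality asks for; `Dst` supplies the distinctness of arguments. -/
theorem Der.normal {n : ℕ} {Γ : Fin n → Formula} {t : Tm n} {C : Formula}
    {L : Set (List Vertex)} (d : Der Γ t C L) (ht : Dst t) : IsNormal t := by
  induction d with
  | @neut n Γ T D L y c U LU hy hT hD hL d ih =>
    subst hT hD
    rw [dst_apps] at ht
    refine .neutral Γ y _ (fun j => argF (Γ y) j) c (fun j => ih j j.2 (ht j)) ?_
      fun j => (d j j.2).nd
    rw [← hy, imps_tgt]; exact .id Γ y
  | lams k hk A M C hC hT hD d ih =>
    subst hT
    exact (ih (dst_lams.1 ht)).lams d.nd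
  | @box n Γ T D L k M y B C U LM LU hy hinj hM hT hD hL dM dU ihM ihU =>
    subst hT
    obtain ⟨h1, h2, h3⟩ := ht
    refine .esub Γ B C M _ y (fun i => ar (Γ (y i))) (fun i j => U i j) (ihM h1) hM dM.nd ?_
      (fun i => rfl) (fun i j => ihU i j j.2 (dst_apps.1 (h2 i) j)) fun i => ?_
    · intro i j hij h
      exact hij (h3 i j h.sim)
    · rw [← hy]
      refine ND.apps ?_ fun j => (dU i j j.2).nd
      rw [imps_tgt]; exact .id Γ (y i)

/-! ## Renaming and permutation of explicit substitutions -/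

theorem argMap_renV {n m : ℕ} (ρ : Fin n → Fin m) (y : Fin n) (j : ℕ) (v : Vertex) :
    argMap m (ρ y) j (renV ρ v) = renV ρ (argMap n y j v) := by
  cases h : splitV n v with
  | inl p =>
    obtain ⟨i, w⟩ := p
    rw [splitV_eq_inl h, renV_hypV, argMap_hypV, argMap_hypV, renV_hypV]
  | inr w =>
    have h1 : renV ρ v = conV m w := by simp [renV, h]
    have h2 : argMap n y j v = hypV y (hypV j w) := by simp [argMap, h]
    rw [h1, h2, argMap_conV, renV_hypV]

theorem bodyMap_renV_left {n m k : ℕ} {Γ : Fin n → Formula} {Γ' : Fin m → Formula}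
    {ρ : Fin n → Fin m} (hρ : ∀ x, Γ' (ρ x) = Γ x) (y : Fin k → Fin n) (v : Vertex) :
    bodyMap Γ' (fun i => ρ (y i)) v = renV ρ (bodyMap Γ y v) := by
  cases h : splitV k v with
  | inl p =>
    obtain ⟨i, w⟩ := p
    rw [splitV_eq_inl h, bodyMap_hypV, bodyMap_hypV, renV_hypV, hρ]
  | inr w =>
    have h1 : bodyMap Γ' (fun i => ρ (y i)) v = conV m (true :: w) := by simp [bodyMap, h]
    have h2 : bodyMap Γ y v = conV n (true :: w) := by simp [bodyMap, h]
    rw [h1, h2, renV_conV]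

theorem bodyMap_renV_right {n k l : ℕ} {Γ : Fin n → Formula} (ρ : Fin k → Fin l)
    (y : Fin l → Fin n) (v : Vertex) :
    bodyMap Γ y (renV ρ v) = bodyMap Γ (fun i => y (ρ i)) v := by
  cases h : splitV k v with
  | inl p =>
    obtain ⟨i, w⟩ := p
    rw [splitV_eq_inl h, renV_hypV, bodyMap_hypV, bodyMap_hypV]
  | inr w =>
    have h1 : renV ρ v = conV l w := by simp [renV, h]
    rw [h1, bodyMap_conV]; simp [bodyMap, h]

theorem renV_eq_hypV {n m : ℕ} {ρ : Fin n → Fin m} (hρ : Function.Injective ρ) {v w : Vertex}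
    {i : Fin n} (h : renV ρ v = hypV (ρ i) w) : v = hypV i w := by
  cases hs : splitV n v with
  | inl p =>
    obtain ⟨j, u⟩ := p
    rw [splitV_eq_inl hs, renV_hypV, hypV_inj] at h
    rw [splitV_eq_inl hs, hρ (Fin.ext h.1), h.2]
  | inr u =>
    have h1 : renV ρ v = conV m u := by simp [renV, hs]
    rw [h1] at h
    exact absurd h.symm (hypV_ne_conV (ρ i).2 _ _)

theorem renV_append {n m k : ℕ} (ρ : Fin n → Fin m) {Γ : Fin n → Formula} {A : Fin k → Formula}
    {C : Formula} {v : Vertex} (hv : Mv (imps (Fin.append Γ A) C) v) :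
    renV (liftRenN ρ k) v = renV ρ v := by
  rcases hv.cases with ⟨w, rfl, _⟩ | ⟨i, w, rfl, _⟩
  · rw [renV_conV, conV_add, conV_add, renV_conV]
  · rw [renV_hypV]
    refine Fin.addCases (fun i => ?_) (fun i => ?_) i
    · rw [liftRenN_castAdd]
      simp only [Fin.val_castAdd]
      rw [renV_hypV]
    · rw [liftRenN_natAdd]
      simp only [Fin.val_natAdd]
      rw [hypV_add, hypV_add, renV_conV]

/-- Injectivity of `ρ` keeps apart the variables that are arguments of an explicit substitution, as
the rule `box` requires. -/
theorem Der.rename {n m : ℕ} {Γ : Fin n → Formula} {t : Tm n} {C : Formula}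
    {L : Set (List Vertex)} (d : Der Γ t C L) {Γ' : Fin m → Formula} {ρ : Fin n → Fin m}
    (hinj : Function.Injective ρ) (hρ : ∀ x, Γ' (ρ x) = Γ x) :
    Der Γ' (t.rename ρ) C (List.map (renV ρ) '' L) := by
  induction d generalizing m with
  | @neut n Γ T D L y c U LU hy hT hD hL d ih =>
    subst hT hL
    refine .neut (ρ y) c (fun j => (U j).rename ρ) (fun j => List.map (renV ρ) '' LU j)
      (by rw [hρ, hy]) ?_ hD ?_ fun j hj => ?_
    · rw [rename_apps, hρ]; rfl
    · rw [neutLang, neutLang, Set.image_union, Set.image_insert_eq, Set.image_pair]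
      congr 1
      · simp [renV_conV, renV_hypV, hρ]
      · ext l
        constructor
        · rintro ⟨_, ⟨j, hj, m', hm, rfl⟩, rfl⟩
          refine ⟨j, by rwa [hρ], _, ⟨m', hm, rfl⟩, ?_⟩
          simp [renV_conV, renV_hypV, hρ, Function.comp_def, argMap_renV]
        · rintro ⟨j, hj, _, ⟨m', hm, rfl⟩, rfl⟩
          refine ⟨_, ⟨j, by rwa [hρ] at hj, m', hm, rfl⟩, ?_⟩
          simp [renV_conV, renV_hypV, hρ, Function.comp_def, argMap_renV]
    · rw [hρ] at hj ⊢
      exact ih j hj hinj hρ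
  | @lams n Γ T D L k hk A M C hC hT hD d ih =>
    subst hT
    refine .lams k hk A (M.rename (liftRenN ρ k)) C hC (rename_lams _ _ _) hD ?_
    -- The abstracted hypotheses belong to the conclusion when seen over `Γ`, and neither renaming
    -- of vertices alters them.
    have e : List.map (renV ρ) '' L = List.map (renV (liftRenN ρ k)) '' L := by
      refine Set.image_congr fun l hl => List.map_congr_left fun v hv => ?_
      exact (renV_append ρ ((d.struct l hl).mv hv)).symm
    rw [e]
    refine ih ?_ ?_
    · intro a b
      refine Fin.addCases (fun a => ?_) (fun a => ?_) a <;>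
      refine Fin.addCases (fun b => ?_) (fun b => ?_) b <;>
      simp only [liftRenN_castAdd, liftRenN_natAdd] <;> intro h
      · rw [hinj (Fin.castAdd_injective _ _ h)]
      · exact absurd (congrArg Fin.val h) (by simp; omega)
      · exact absurd (congrArg Fin.val h) (by simp; omega)
      · rw [Fin.natAdd_injective _ _ h]
    · intro x
      refine Fin.addCases (fun x => ?_) (fun x => ?_) x
      · rw [liftRenN_castAdd, Fin.append_left, Fin.append_left, hρ]
      · rw [liftRenN_natAdd, Fin.append_right, Fin.append_right]
  | @box n Γ T D L k M y B C U LM LU hy hi hM hT hD hL dM dU ihM ihU =>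
    subst hT hL
    refine .box k M (fun i => ρ (y i)) B C (fun i j => (U i j).rename ρ) LM
      (fun i j => List.map (renV ρ) '' LU i j) (fun i => by rw [hρ, hy])
      (fun i i' h1 h2 => hi i i' (by rwa [hρ] at h1) (hinj h2)) hM ?_ hD ?_ dM fun i j hj => ?_
    · simp only [Tm.rename, Tm.esub.injEq, heq_eq_eq, true_and]
      funext i
      rw [rename_apps, hρ]; rfl
    · rw [boxLang, boxLang, Set.image_union, Set.image_image]
      congr 1
      · refine Set.image_congr fun l _ => ?_
        rw [List.map_map]
        exact List.map_congr_left fun v _ => (bodyMap_renV_left hρ y v).symm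
      · have hb : ∀ q : List Vertex, q.map (bodyMap Γ' fun i => ρ (y i)) =
            (q.map (bodyMap Γ y)).map (renV ρ) := fun q => by
          rw [List.map_map]
          exact List.map_congr_left fun v _ => bodyMap_renV_left hρ y v
        have ha : ∀ (i : Fin k) (j : ℕ) (q : List Vertex),
            (q.map (renV ρ)).map (argMap m (ρ (y i)) j) =
            (q.map (argMap n (y i) j)).map (renV ρ) := fun i j q => by
          rw [List.map_map, List.map_map]
          exact List.map_congr_left fun v _ => argMap_renV ρ (y i) j v
        ext l
        constructor
        · rintro ⟨_, ⟨i, j, hj, q, hq, hlast, m', hm, rfl⟩, rfl⟩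
          refine ⟨i, j, by rwa [hρ], q, hq, hlast, _, ⟨m', hm, rfl⟩, ?_⟩
          rw [List.map_append, hb, ha]
        · rintro ⟨i, j, hj, q, hq, hlast, _, ⟨m', hm, rfl⟩, rfl⟩
          refine ⟨_, ⟨i, j, by rwa [hρ] at hj, q, hq, hlast, m', hm, rfl⟩, ?_⟩
          rw [List.map_append, hb, ha]
    · rw [hρ] at hj ⊢
      exact ihU i j hj hinj hρ

/-- Extension of a finite family. -/
theorem exists_extend {α : Type*} [Nonempty α] {r : ℕ} (N : Fin r → α) :
    ∃ f : ℕ → α, ∀ j : Fin r, f j = N j :=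
  ⟨fun j => if h : j < r then N ⟨j, h⟩ else Classical.arbitrary α, fun j => by simp⟩

/-- A permutation only renumbers the bound hypotheses, and `bodyMap` replaces their numbers by the
hypotheses of `Γ` that they stand for. -/
theorem boxLang_perm {n k : ℕ} (Γ : Fin n → Formula) (y : Fin k → Fin n) (B : Fin k → Formula)
    (LM : Set (List Vertex)) (LU : Fin k → ℕ → Set (List Vertex)) (σ : Equiv.Perm (Fin k)) :
    boxLang Γ (fun i => y (σ i)) (fun i => B (σ i)) (List.map (renV σ.symm) '' LM)
      (fun i => LU (σ i)) = boxLang Γ y B LM LU := by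
  have hb : ∀ q : List Vertex, (q.map (renV σ.symm)).map (bodyMap Γ fun i => y (σ i)) =
      q.map (bodyMap Γ y) := fun q => by
    rw [List.map_map]
    refine List.map_congr_left fun v _ => ?_
    rw [Function.comp_apply, bodyMap_renV_right]; simp
  rw [boxLang, boxLang, Set.image_image]
  congr 1
  · exact Set.image_congr fun l _ => hb l
  · ext l
    constructor
    · rintro ⟨i, j, hj, _, ⟨q, hq, rfl⟩, hlast, m, hm, rfl⟩
      refine ⟨σ i, j, hj, q, hq, ?_, m, hm, by rw [hb]⟩
      rw [List.getLast?_map, Option.map_eq_some_iff] at hlast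
      obtain ⟨v, hv, e⟩ := hlast
      rw [hv]
      congr 1
      refine renV_eq_hypV σ.symm.injective ?_
      rw [e]; simp
    · rintro ⟨i, j, hj, q, hq, hlast, m, hm, rfl⟩
      refine ⟨σ.symm i, j, by simpa using hj, _, ⟨q, hq, rfl⟩, ?_, m, by simpa using hm, ?_⟩
      · rw [List.getLast?_map, hlast, Option.map_some, renV_hypV]; simp
      · rw [hb]; simp

/-- This makes the language an invariant of the term up to permutation, and gives a derivation for
every order of the explicit substitutions. -/
theorem Der.sim {n : ℕ} {Γ : Fin n → Formula} {t t' : Tm n} {C : Formula}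
    {L : Set (List Vertex)} (d : Der Γ t C L) (h : Sim t t') : Der Γ t' C L := by
  induction d with
  | @neut n Γ T D L y c U LU hy hT hD hL d ih =>
    subst hT
    obtain ⟨N', rfl, hN⟩ := h.of_apps
    have : Nonempty (Tm n) := ⟨.var y⟩
    obtain ⟨U', hU⟩ := exists_extend N'
    refine .neut y c U' LU hy (by simp [hU]) hD hL fun j hj => ih j hj ?_
    have := hN ⟨j, hj⟩
    rwa [← hU] at this
  | lams k hk A M C hC hT hD d ih =>
    subst hT
    obtain ⟨M', rfl, hM⟩ := h.of_lams
    exact .lams k hk A M' C hC rfl hD (ih hM)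
  | @box n Γ T D L k M y B C U LM LU hy hinj hM hT hD hL dM dU ihM ihU =>
    subst hT hL
    cases h with
    | @esub _ _ _ M' _ N' σ h1 h2 =>
      have hx : ∀ i, ∃ U' : ℕ → Tm n,
          N' i = apps (.var (y (σ i))) (fun j : Fin (ar (Γ (y (σ i)))) => U' j) ∧
          ∀ j < ar (Γ (y (σ i))), Sim (U (σ i) j) (U' j) := by
        intro i
        obtain ⟨N1, e, hN⟩ := (h2 i).of_apps
        have : Nonempty (Tm n) := ⟨.var (y (σ i))⟩
        obtain ⟨U', hU⟩ := exists_extend N1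
        refine ⟨U', by simp [hU, e], fun j hj => ?_⟩
        have := hN ⟨j, hj⟩
        rwa [← hU] at this
      choose U' hU1 hU2 using hx
      have h3 : Sim M (M'.rename σ) := by
        have := h1.rename σ
        rwa [rename_rename_of_inv (by ext; simp)] at this
      have dM' := (ihM h3).rename (Γ' := fun i => B (σ i)) (ρ := σ.symm) σ.symm.injective
        (fun x => by simp)
      rw [rename_rename_of_inv (by ext; simp)] at dM'
      refine .box k M' (fun i => y (σ i)) (fun i => B (σ i)) C U' _ (fun i => LU (σ i))
        (fun i => hy _) (fun i i' e1 e2 => σ.injective (hinj _ _ e1 e2)) ?_ ?_ hD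
        (boxLang_perm Γ y B LM LU σ).symm dM' (fun i j hj => ihU _ _ hj (hU2 i j hj))
      · intro x
        have := occurs_rename (ρ := σ.symm) (hM (σ x))
        rw [Equiv.symm_apply_apply] at this
        exact h1.occurs this
      · congr 1
        funext i; exact hU1 i

/-! ### Reflecting equality and links along maps of vertices -/

theorem map_inj_of {α β : Type*} {g : α → β} {l l' : List α} (h : l.map g = l'.map g)
    (hg : ∀ a ∈ l, ∀ b ∈ l', g a = g b → a = b) : l = l' := by
  induction l generalizing l' with
  | nil => simpa [eq_comm] using h
  | cons a l ih =>
    cases l' with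
    | nil => simp at h
    | cons b l' =>
      simp only [List.map_cons, List.cons.injEq] at h
      rw [hg a (by simp) b (by simp) h.1,
        ih h.2 fun a ha b hb => hg a (by simp [ha]) b (by simp [hb])]

/-- The map `g` sends classes into classes, but need not be injective. It is so on the set `Z` of
vertices that can take part in links, and a vertex outside `Z` is equivalent only to itself. -/
theorem link_pullback {F G : Formula} {g : Vertex → Vertex} {l l' : List Vertex}
    {Z : Vertex → Prop}
    (hLk : ∀ a b, Lk F l a b → Relation.EqvGen (Lk G l') (g a) (g b) ∧ Z a ∧ Z b)
    (hinj : ∀ a b, Z a → Z b → g a = g b → a = b)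
    (hpar : ∀ a, Z a → Even (depth F a) → Even (depth G (g a)))
    (hG : ∀ u w, Relation.EqvGen (Lk G l') u w → Even (depth G u) → Even (depth G w) → u = w)
    {u w : Vertex} (h : Relation.EqvGen (Lk F l) u w) (hu : Even (depth F u))
    (hw : Even (depth F w)) : u = w := by
  have key : Relation.EqvGen (Lk G l') (g u) (g w) ∧ (u = w ∨ (Z u ∧ Z w)) := by
    clear hu hw
    induction h with
    | rel a b h => exact ⟨(hLk a b h).1, .inr (hLk a b h).2⟩
    | refl a => exact ⟨.refl _, .inl rfl⟩
    | symm a b _ ih => exact ⟨.symm _ _ ih.1, ih.2.imp Eq.symm And.symm⟩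
    | trans a b c _ _ ih1 ih2 =>
      refine ⟨.trans _ _ _ ih1.1 ih2.1, ?_⟩
      rcases ih1.2 with rfl | h1
      · exact ih2.2
      · rcases ih2.2 with rfl | h2
        · exact .inr h1
        · exact .inr ⟨h1.1, h2.2⟩
  rcases key.2 with h1 | ⟨h1, h2⟩
  · exact h1
  · exact hinj _ _ h1 h2 (hG _ _ key.1 (hpar _ h1 hu) (hpar _ h2 hw))

/-! ## The language of an argument -/

/-- The language over `Γ ⊢ A`, where `A` is the `j`-th argument of the hypothesis `y`, of the
continuations in `L` of `p`. -/
def argLang {n : ℕ} (Γ : Fin n → Formula) (L : Set (List Vertex)) (p : List Vertex) (y : Fin n)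
    (j : ℕ) : Set (List Vertex) :=
  {l | Struct (imps Γ (argF (Γ y) j)) l ∧ p ++ l.map (argMap n y j) ∈ L}

section
variable {n : ℕ} {Γ : Fin n → Formula} {C : Formula} {y : Fin n} {j : ℕ}

/-- Vertices that are not in the hypothesis `y`. -/
def Away {n : ℕ} (y : Fin n) (v : Vertex) : Prop :=
  (∃ w, v = conV n w) ∨ ∃ (x : Fin n) (w : Vertex), v = hypV x w ∧ x ≠ y

theorem Away.cases {v : Vertex} (h : Away y v) :
    (∃ w, v = conV n w) ∨ ∃ (i : Fin n) (w : Vertex), v = hypV i w :=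
  h.imp id fun ⟨x, w, h, _⟩ => ⟨x, w, h⟩

theorem Away.argMap_inj {v v' : Vertex} (h : Away y v) (h' : Away y v')
    (e : argMap n y j v = argMap n y j v') : v = v' := by
  rcases h with ⟨w, rfl⟩ | ⟨x, w, rfl, hx⟩ <;> rcases h' with ⟨w', rfl⟩ | ⟨x', w', rfl, hx'⟩
  · rw [argMap_conV, argMap_conV, hypV_inj, hypV_inj] at e
    rw [e.2.2]
  · rw [argMap_conV, argMap_hypV, hypV_inj] at e
    exact absurd (Fin.ext e.1.symm) hx'
  · rw [argMap_conV, argMap_hypV, hypV_inj] at e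
    exact absurd (Fin.ext e.1) hx
  · rwa [argMap_hypV, argMap_hypV] at e

/-- To play in the hypothesis `y`, its head must be played first; but this head is already in `p`.
This matters because `argMap` confuses the conclusion with the `j`-th argument of `y`, and is
injective only away from `y`. -/
theorem away_of_nodup {F : Formula} {p l : List Vertex} (hp : hypV y (headV (Γ y)) ∈ p)
    (hn : (p ++ l.map (argMap n y j)).Nodup) (hl : Struct (imps Γ F) l) :
    ∀ v ∈ l, Away y v := by
  intro v hv
  rcases (hl.mv hv).cases with ⟨w, rfl, _⟩ | ⟨x, w, rfl, _⟩
  · exact .inl ⟨w, rfl⟩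
  · refine .inr ⟨x, w, rfl, ?_⟩
    rintro rfl
    have h1 := List.mem_map_of_mem (f := argMap n x j) (hl.hyp_head hv)
    rw [argMap_hypV] at h1
    exact (List.nodup_append.1 hn).2.2 _ hp _ h1 rfl

theorem map_argMap_inj {F : Formula} {p l l' : List Vertex} (hp : hypV y (headV (Γ y)) ∈ p)
    (hn : (p ++ l.map (argMap n y j)).Nodup) (hl : Struct (imps Γ F) l)
    (hl' : Struct (imps Γ F) l') (h : l.map (argMap n y j) = l'.map (argMap n y j)) : l = l' := by
  have h1 := away_of_nodup hp hn hl
  rw [h] at hn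
  have h2 := away_of_nodup hp hn hl'
  exact map_inj_of h fun a ha b hb e => (h1 a ha).argMap_inj (h2 b hb) e

/-- The image of `argMap` lies in the hypotheses, and a move justified in a hypothesis is in the
same hypothesis. If the justifier is in the `j`-th argument of `y`, so is the move, because edges
out of that argument only lead to the target. -/
theorem child_lift (hj : j < ar (Γ y)) {u s : Vertex} (hu : Mv (imps Γ (argF (Γ y) j)) u)
    (hs : Mv (imps Γ C) s) (hs0 : s ≠ headV (imps Γ C))
    (h : par (imps Γ C) s = argMap n y j u) :
    ∃ v, Mv (imps Γ (argF (Γ y) j)) v ∧ v ≠ headV (imps Γ (argF (Γ y) j)) ∧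
      par (imps Γ (argF (Γ y) j)) v = u ∧ s = argMap n y j v := by
  have hg : ∃ (x : Fin n) (a : Vertex), argMap n y j u = hypV x a := by
    rcases hu.cases with ⟨w, rfl, _⟩ | ⟨x, w, rfl, _⟩
    · exact ⟨y, _, argMap_conV _ _ _ _⟩
    · exact ⟨x, _, argMap_hypV _ _ _ _⟩
  rcases hs.cases with ⟨s', rfl, _⟩ | ⟨x, s', rfl, hs'⟩
  · obtain ⟨x, a, e⟩ := hg
    rw [par_conV, e] at h
    exact absurd h.symm (hypV_ne_conV x.2 _ _)
  · rw [par_hypV] at h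
    split at h
    · obtain ⟨x, a, e⟩ := hg
      rw [e] at h
      exact absurd h.symm (hypV_ne_conV x.2 _ _)
    · next hne =>
      rcases hu.cases with ⟨w, rfl, _⟩ | ⟨x', w, rfl, _⟩
      · rw [argMap_conV, hypV_inj] at h
        obtain ⟨h1, h2⟩ := h
        obtain rfl := Fin.ext h1
        rcases vertex_cases_formula hs'.isVertex with ⟨a, rfl⟩ | ⟨j', hj', a, rfl⟩
        · rw [par_tgt] at h2
          exact absurd h2.symm (hypV_ne_conV hj _ _)
        · rw [par_arg hj'] at h2
          split at h2
          · rw [headV_tgt] at h2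
            exact absurd h2.symm (hypV_ne_conV hj _ _)
          · next hne' =>
            obtain ⟨rfl, rfl⟩ := hypV_inj.1 h2
            refine ⟨conV n a, mv_conV.2 ?_, ?_, by rw [par_conV], by rw [argMap_conV]⟩
            · obtain ⟨b, hb⟩ := hs'
              exact ⟨b, by rw [← label_arg hj', hb]⟩
            · rw [headV_imps, Ne, conV_inj]; exact hne'
      · rw [argMap_hypV, hypV_inj] at h
        obtain ⟨h1, h2⟩ := h
        obtain rfl := Fin.ext h1
        refine ⟨hypV x s', mv_hypV.2 hs', ?_, ?_, by rw [argMap_hypV]⟩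
        · rw [headV_imps]; exact hypV_ne_conV x.2 _ _
        · rw [par_hypV, if_neg hne, h2]

theorem argMap_mv (hj : j < ar (Γ y)) {v : Vertex} (hv : Mv (imps Γ (argF (Γ y) j)) v) :
    Mv (imps Γ C) (argMap n y j v) := by
  obtain ⟨a, ha⟩ := hv
  exact ⟨a, by rw [label_argMap hj (Mv.isVertex ⟨a, ha⟩), ha]⟩

variable {L : Set (List Vertex)} {p : List Vertex}

/-- After `p`, moves of the player are not justified in `p`, except for heads of hypotheses. -/
def Closed {n : ℕ} (Γ : Fin n → Formula) (C : Formula) (L : Set (List Vertex)) (p : List Vertex)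
    (y : Fin n) (j : ℕ) : Prop :=
  ∀ l v, l ∈ argLang Γ L p y j → Odd l.length → p ++ l.map (argMap n y j) ++ [v] ∈ L →
    par (imps Γ C) v ∈ p → ∃ x : Fin n, v = hypV x (headV (Γ x))

/-- All conditions are inherited from `L` except that the player must always have a reply inside the
new arena; this is what `Closed` provides. Links are reflected because all moves avoid `y`, where
`argMap` is not injective. -/
theorem LW.arg (h : LW (imps Γ C) L) (hp : p ∈ L) (hev : Even p.length)
    (hlast : p.getLast? = some (hypV y (headV (Γ y)))) (hj : j < ar (Γ y))
    (hcl : Closed Γ C L p y j) : LW (imps Γ (argF (Γ y) j)) (argLang Γ L p y j) := by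
  have hmem : hypV y (headV (Γ y)) ∈ p := List.mem_of_getLast? hlast
  have haway : ∀ l ∈ argLang Γ L p y j, ∀ v ∈ l, Away y v := fun l hl =>
    away_of_nodup hmem (h.nodup _ hl.2) hl.1
  have hinj : ∀ l ∈ argLang Γ L p y j, ∀ l' ∈ argLang Γ L p y j,
      l.map (argMap n y j) = l'.map (argMap n y j) → l = l' := fun l hl l' hl' e =>
    map_argMap_inj hmem (h.nodup _ hl.2) hl.1 hl'.1 e
  have hsn : ∀ (l : List Vertex) (v : Vertex), p ++ (l ++ [v]).map (argMap n y j) =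
      (p ++ l.map (argMap n y j)) ++ [argMap n y j v] := fun l v => by simp
  have hsn2 : ∀ (l : List Vertex) (u v : Vertex), p ++ (l ++ [u, v]).map (argMap n y j) =
      (p ++ l.map (argMap n y j)) ++ [argMap n y j u, argMap n y j v] := fun l u v => by simp
  have hpar : ∀ l : List Vertex, (p ++ l.map (argMap n y j)).length % 2 = l.length % 2 :=
    fun l => by
    rw [List.length_append, List.length_map]
    have := Nat.even_iff.1 hev; omega
  have hodd : ∀ l : List Vertex, Odd l.length → Odd (p ++ l.map (argMap n y j)).length :=
    fun l hl => by rw [Nat.odd_iff] at hl ⊢; rw [hpar, hl]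
  have hevn : ∀ l : List Vertex, Even (p ++ l.map (argMap n y j)).length ↔ Even l.length :=
    fun l => by rw [Nat.even_iff, Nat.even_iff, hpar]
  have hpre : ∀ l v, l ++ [v] ∈ argLang Γ L p y j → l ∈ argLang Γ L p y j := by
    rintro l v ⟨h1, h2⟩
    rw [hsn] at h2
    exact ⟨h1.pre, h.pre _ _ h2⟩
  -- Justifiers fail to commute with `argMap` only at heads of hypotheses, which have odd depth and
  -- are never played by the opponent.
  have hparG : ∀ l v, l ++ [v] ∈ argLang Γ L p y j → Even l.length → l ≠ [] →
      par (imps Γ C) (argMap n y j v) = argMap n y j (par (imps Γ (argF (Γ y) j)) v) := by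
    rintro l v ⟨h1, h2⟩ hl h0
    rcases Struct.snoc_iff.1 h1 with ⟨h3, _⟩ | ⟨_, _, h3, h4, _⟩
    · exact absurd h3 h0
    · rcases par_argMap (C := C) hj h3 h4 with ⟨⟨x, rfl⟩, _, _⟩ | ⟨_, h5⟩
      · rw [hsn] at h2
        have := (h.parity _ _ h2).2 ((hevn l).2 hl)
        rw [argMap_hypV, depth_hypV, depth_headV] at this
        simp at this
      · exact h5
  refine
    { fin := ?_
      nil := ⟨.nil, by simpa using hp⟩
      pre := hpre
      struct := fun l hl => hl.1
      nodup := fun l hl => (List.nodup_append.1 (h.nodup _ hl.2)).2.1.of_map _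
      init := ⟨.init, ?_⟩
      opp := ?_
      oppar := ?_
      parity := ?_
      player := ?_
      lab := ?_
      link := ?_ }
  · refine Set.Finite.of_finite_image (f := fun l => p ++ l.map (argMap n y j)) ?_ ?_
    · exact h.fin.subset (by rintro _ ⟨l, hl, rfl⟩; exact hl.2)
    · intro l hl l' hl' e
      exact hinj l hl l' hl' (List.append_cancel_left e)
  -- The opponent may open the argument because its head is justified by the last move of `p`, the
  -- head of `y`.
  · obtain ⟨p', rfl⟩ := List.getLast?_eq_some_iff.1 hlast
    rw [List.map_singleton, List.append_assoc]
    refine h.opp p' _ _ hp ?_ (argMap_mv hj (mv_headV _)) (argMap_ne_headV (mv_headV _))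
      (par_argMap_head hj)
    simpa [Nat.even_add_one] using hev
  · intro l u v hl ho hv hv0 hpv
    have hl0 : l ≠ [] := by rintro rfl; simp at ho
    have hu0 : u ≠ headV (imps Γ (argF (Γ y) j)) := by
      rcases Struct.snoc_iff.1 hl.1 with ⟨h3, _⟩ | ⟨_, _, _, h4, _⟩
      · exact absurd h3 hl0
      · exact h4
    refine ⟨?_, ?_⟩
    · have := Struct.snoc (v := v) hl.1 hv hv0 (by rw [hpv]; simp)
      simpa using this
    · rw [hsn2]
      have h2 := hl.2
      rw [hsn] at h2
      refine h.opp _ _ _ h2 (hodd l ho) (argMap_mv hj hv) (argMap_ne_headV hv) ?_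
      rcases par_argMap (C := C) hj hv hv0 with ⟨_, _, h5⟩ | ⟨_, h5⟩
      · exact absurd (hpv.symm.trans h5) hu0
      · rw [h5, hpv]
  · intro l u v hl ho
    have hl' : (l ++ [u]) ++ [v] ∈ argLang Γ L p y j := by simpa using hl
    have h1 := hparG _ _ hl' (by simpa [Nat.even_add_one] using ho) (by simp)
    have h2 := hl.2
    rw [hsn2] at h2
    rw [h.oppar _ _ _ h2 (hodd l ho)] at h1
    have h3 := haway _ hl
    refine (h3 _ ?_).argMap_inj (h3 u (by simp)) h1.symm
    exact hl.1.par_mem (by simp)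
  · intro l v hl
    have h2 := hl.2
    rw [hsn] at h2
    rw [← hevn, ← h.parity _ _ h2, parity_argMap hj]
    exact (haway _ hl v (by simp)).cases
  · intro l hl ho
    have hl0 : l ≠ [] := by rintro rfl; simp at ho
    obtain ⟨s, hs, hu⟩ := h.player _ hl.2 (hodd l ho)
    have hex : ∃ v, l ++ [v] ∈ argLang Γ L p y j := by
      rcases Struct.snoc_iff.1 (h.struct _ hs) with ⟨h3, _⟩ | ⟨_, _, h3, h4, h5⟩
      · simp [hl0] at h3
      · rcases List.mem_append.1 h5 with h5 | h5
        -- A reply justified before the graft is the head of a hypothesis; over the argument, it is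
        -- justified by the new opening move instead.
        · obtain ⟨x, rfl⟩ := hcl l s hl ho hs h5
          refine ⟨hypV x (headV (Γ x)), .snoc hl.1 (mv_hypV.2 (mv_headV _)) ?_ ?_, ?_⟩
          · rw [headV_imps]; exact hypV_ne_conV x.2 _ _
          · rw [par_hypV, if_pos rfl, ← headV_imps Γ]; exact hl.1.head_mem hl0
          · rw [hsn, argMap_hypV]; exact hs
        · obtain ⟨u, hu1, hu2⟩ := List.mem_map.1 h5
          obtain ⟨v, hv1, hv2, hv3, rfl⟩ := child_lift hj (hl.1.mv hu1) h3 h4 hu2.symm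
          exact ⟨v, .snoc hl.1 hv1 hv2 (by rwa [hv3]), by rwa [hsn]⟩
    obtain ⟨v, hv⟩ := hex
    refine ⟨v, hv, fun v' hv' => ?_⟩
    have e1 := hv.2
    have e2 := hv'.2
    rw [hsn] at e1 e2
    have := hinj _ hv' _ hv (by rw [List.map_append, List.map_append, List.map_singleton,
      List.map_singleton, hu _ e1, hu _ e2])
    simpa using this
  · intro l u v hl he
    have h2 := hl.2
    rw [hsn2] at h2
    have h3 := h.lab _ _ _ h2 ((hevn l).2 he)
    have hu := (hl.1.mv (v := u) (by simp)).isVertex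
    have hv := (hl.1.mv (v := v) (by simp)).isVertex
    rw [label_argMap hj hu, label_argMap hj hv, addr_argMap hj hu, addr_argMap hj hv,
      List.length_map, List.length_map] at h3
    exact h3
  · intro l hl u w huw
    refine link_pullback (Z := Away y) ?_ (fun a b ha hb e => ha.argMap_inj hb e)
      (fun a ha => (parity_argMap hj ha.cases).2) (h.link _ hl.2) huw
    rintro a b ⟨l', o, q, h1, ⟨r, rfl⟩, h3⟩
    have ho : o ∈ l' ++ [o, q] ++ r := by simp
    have hq : q ∈ l' ++ [o, q] ++ r := by simp
    have hao := haway _ hl o ho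
    have haq := haway _ hl q hq
    have hvo := (hl.1.mv ho).isVertex
    have hvq := (hl.1.mv hq).isVertex
    have haddr : ∀ v b, Away y v → ∀ i : ℕ, (addr (imps Γ (argF (Γ y) j)) v)[i]? = some b →
        Away y b := by
      rintro v b (⟨w, rfl⟩ | ⟨x, w, rfl, hx⟩) i hi
      · rw [addr_conV, List.getElem?_map, Option.map_eq_some_iff] at hi
        obtain ⟨b, _, rfl⟩ := hi
        exact .inl ⟨b, rfl⟩
      · rw [addr_hypV, List.getElem?_map, Option.map_eq_some_iff] at hi
        obtain ⟨b, _, rfl⟩ := hi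
        exact .inr ⟨x, b, rfl, hx⟩
    refine ⟨.rel _ _ ⟨p ++ l'.map (argMap n y j), argMap n y j o, argMap n y j q,
      (hevn l').2 h1, ?_, ?_⟩, ?_⟩
    · rw [← hsn2, List.map_append (l₂ := r), ← List.append_assoc]
      exact List.prefix_append _ _
    · rcases h3 with ⟨rfl, rfl⟩ | ⟨i, h4, h5⟩
      · exact .inl ⟨rfl, rfl⟩
      · refine .inr ⟨i, ?_, ?_⟩
        · rw [addr_argMap hj hvo, List.getElem?_map, h4]; rfl
        · rw [addr_argMap hj hvq, List.getElem?_map, h5]; rfl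
    · rcases h3 with ⟨rfl, rfl⟩ | ⟨i, h4, h5⟩
      · exact ⟨hao, haq⟩
      · exact ⟨haddr _ _ hao i h4, haddr _ _ haq i h5⟩

/-- Once the argument is opened the play stays in it: opponent moves are justified by the previous
move and lift by `child_lift`, and the player's reply is the one that already exists in the language
of the argument. -/
theorem LW.arg_surj (h : LW (imps Γ C) L) (hev : Even p.length)
    (hj : j < ar (Γ y))
    (hA : LW (imps Γ (argF (Γ y) j)) (argLang Γ L p y j)) {m : List Vertex} (hm : p ++ m ∈ L)
    (hhead : m.head? = some (hypV y (hypV j (headV (argF (Γ y) j))))) :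
    ∃ l ∈ argLang Γ L p y j, m = l.map (argMap n y j) := by
  induction m using List.reverseRecOn with
  | nil => simp at hhead
  | append_singleton m v ih =>
    rcases List.eq_nil_or_concat' m with rfl | ⟨m', u', rfl⟩
    · refine ⟨_, hA.init, ?_⟩
      rw [List.map_singleton, headV_argMap]
      simpa using hhead
    · rw [← List.append_assoc] at hm
      obtain ⟨l, hl, e⟩ := ih (h.pre _ _ hm) (by simpa using hhead)
      rw [e] at hm ⊢
      have hlen : l.length = m'.length + 1 := by
        have := congrArg List.length e; simpa using this.symm
      rcases Nat.even_or_odd l.length with hl2 | hl2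
      · obtain ⟨l', u, rfl⟩ : ∃ l' u, l = l' ++ [u] := by
          rcases List.eq_nil_or_concat' l with rfl | h1
          · simp at hlen
          · exact h1
        simp only [List.length_append, List.length_singleton] at hl2
        rw [Nat.even_add_one, Nat.not_even_iff_odd] at hl2
        have hm' : (p ++ l'.map (argMap n y j)) ++ [argMap n y j u, v] ∈ L := by simpa using hm
        have h1 := h.oppar _ _ _ hm' (by
          rw [List.length_append, List.length_map]; exact hev.add_odd hl2)
        rcases Struct.snoc_iff.1 (h.struct _ hm) with ⟨h3, _⟩ | ⟨_, _, h3, h4, h5⟩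
        · simp at h3
        · obtain ⟨v', hv1, hv2, hv3, rfl⟩ := child_lift hj (hl.1.mv (by simp)) h3 h4 h1
          exact ⟨_, hA.opp l' u v' hl hl2 hv1 hv2 hv3, by simp⟩
      · obtain ⟨v', hv, _⟩ := hA.player l hl hl2
        have h2 := hv.2
        rw [List.map_append, ← List.append_assoc] at h2
        have := (h.player _ hl.2 (by
          rw [List.length_append, List.length_map]; exact hev.add_odd hl2)).unique hm h2
        exact ⟨_, hv, by rw [List.map_append, List.map_singleton, this]⟩

/-- Prefixing by `p` embeds the language of the argument into `L`, and misses the empty view. -/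
theorem LW.ncard_arg_lt (h : LW (imps Γ C) L)
    (hlast : p.getLast? = some (hypV y (headV (Γ y)))) :
    (argLang Γ L p y j).ncard < L.ncard := by
  have hmem : hypV y (headV (Γ y)) ∈ p := List.mem_of_getLast? hlast
  have : (argLang Γ L p y j).ncard =
      ((fun l => p ++ l.map (argMap n y j)) '' argLang Γ L p y j).ncard := by
    rw [Set.InjOn.ncard_image]
    intro l hl l' hl' e
    exact map_argMap_inj hmem (h.nodup _ hl.2) hl.1 hl'.1 (List.append_cancel_left e)
  rw [this]
  refine Set.ncard_lt_ncard ⟨?_, fun hsub => ?_⟩ h.fin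
  · rintro _ ⟨l, hl, rfl⟩; exact hl.2
  · obtain ⟨l, _, e⟩ := hsub h.nil
    have := (List.append_eq_nil_iff.1 e).1
    rw [this] at hmem; simp at hmem

end

/-! ## Languages over sequents whose conclusion is an atom -/

theorem par_eq_headV_cases {H : Formula} {w : Vertex} (hw : Mv H w) (h0 : w ≠ headV H)
    (h : par H w = headV H) : (∃ j < ar H, w = hypV j (headV (argF H j))) ∨
      ∃ u, w = conV (ar H) u ∧ Mv (tgt H) u ∧ u ≠ headV (tgt H) := by
  rcases vertex_cases_formula hw.isVertex with ⟨a, rfl⟩ | ⟨j, hj, a, rfl⟩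
  · right
    refine ⟨a, rfl, ?_, ?_⟩
    · obtain ⟨b, hb⟩ := hw; exact ⟨b, by rw [← label_tgt, hb]⟩
    · rintro rfl; exact h0 (headV_tgt H).symm
  · left
    rw [par_arg hj] at h
    split at h
    · next e => exact ⟨j, hj, by rw [e]⟩
    · rw [headV_tgt] at h
      exact absurd h (hypV_ne_conV hj _ _)

theorem mv_atom {c : ℕ} {w : Vertex} (h : Mv (.atom c) w) : w = [] := by
  cases w with
  | nil => rfl
  | cons => simp [Mv, label] at h

/-- Right after the opening move, only heads of hypotheses are justified. The reply must have the
label `c` and, like the opening move, an empty address; so the target of the hypothesis cannot be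
boxed. -/
theorem LW.neut {n : ℕ} {Γ : Fin n → Formula} {c : ℕ} {L : Set (List Vertex)}
    (h : LW (imps Γ (.atom c)) L) :
    ∃ y : Fin n, tgt (Γ y) = .atom c ∧ [conV n [], hypV y (headV (Γ y))] ∈ L := by
  have hh : headV (imps Γ (.atom c)) = conV n [] := headV_imps _ _
  have h0 := h.init
  rw [hh] at h0
  obtain ⟨s, hs, _⟩ := h.player _ h0 (by simp)
  have hlab := h.lab [] _ _ hs (by simp)
  rcases Struct.snoc_iff.1 (h.struct _ hs) with ⟨h1, _⟩ | ⟨_, _, h3, h4, h5⟩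
  · simp at h1
  rw [hh] at h4
  rcases h3.cases with ⟨w, rfl, hw⟩ | ⟨y, w, rfl, hw⟩
  · rw [mv_atom hw] at h4
    exact absurd rfl h4
  · rw [par_hypV] at h5
    split at h5
    · next e =>
      subst e
      refine ⟨y, ?_, hs⟩
      rw [label_hypV, label_conV, addr_hypV, addr_conV, headV_tgt (Γ y), label_tgt,
        addr_tgt] at hlab
      rcases tgt_cases (Γ y) with ⟨c', hc⟩ | ⟨B, hB⟩
      · rw [hc] at hlab ⊢
        have := hlab.1
        simp only [headV, label, Option.some.injEq, Label.atom.injEq] at this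
        rw [this]
      · rw [hB] at hlab
        simp [headV, addr] at hlab
    · exact absurd (List.mem_singleton.1 h5) (hypV_ne_conV y.2 _ _)

section
variable {n : ℕ} {Γ : Fin n → Formula} {c : ℕ} {L : Set (List Vertex)} {y : Fin n}

/-- A move justified by the opening move is a head, because an atomic conclusion has no other move.
A move justified by the head of `y` has even depth, so it is not a player move. -/
theorem closed_neut {j : ℕ} (h : LW (imps Γ (.atom c)) L) :
    Closed Γ (.atom c) L [conV n [], hypV y (headV (Γ y))] y j := by
  intro l v hl ho hv hp
  have hn : ∀ u, u ∈ [conV n [], hypV y (headV (Γ y))] ++ l.map (argMap n y j) ++ [v] →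
      u ∈ [conV n [], hypV y (headV (Γ y))] ∨ u ∈ l.map (argMap n y j) ++ [v] := fun u hu => by
    rwa [List.append_assoc, List.mem_append] at hu
  have hd := (h.parity _ _ hv)
  have hmv := (h.struct _ hv).mv (v := v) (by simp)
  have hdv : Odd (depth (imps Γ (.atom c)) v) := by
    rw [← Nat.not_even_iff_odd, hd, Nat.not_even_iff_odd, List.length_append, List.length_map]
    exact Even.add_odd (by simp) ho
  have hv0 : v ≠ headV (imps Γ (.atom c)) := by
    rintro rfl
    rw [depth_headV] at hdv
    simp at hdv
  rcases List.mem_pair.1 hp with e | e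
  · rcases hmv.cases with ⟨w, rfl, hw⟩ | ⟨x, w, rfl, hw⟩
    · exfalso
      apply hv0
      rw [mv_atom hw, headV_imps]; rfl
    · rw [par_hypV] at e
      split at e
      · next e' => exact ⟨x, by rw [e']⟩
      · exact absurd e (hypV_ne_conV x.2 _ _)
  · exfalso
    rw [depth_par hmv hv0, e, depth_hypV, depth_headV] at hdv
    exact absurd hdv (by decide)

theorem LW.neut_arg (h : LW (imps Γ (.atom c)) L)
    (hb : [conV n [], hypV y (headV (Γ y))] ∈ L) {j : ℕ} (hj : j < ar (Γ y)) :
    LW (imps Γ (argF (Γ y) j)) (argLang Γ L [conV n [], hypV y (headV (Γ y))] y j) :=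
  h.arg hb (by simp) rfl hj (closed_neut h)

/-- The third move is justified by the head of `y`; as the target of `y` is atomic, it opens one of
the arguments. -/
theorem LW.eq_neutLang (hy : tgt (Γ y) = .atom c) (h : LW (imps Γ (.atom c)) L)
    (hb : [conV n [], hypV y (headV (Γ y))] ∈ L) :
    L = neutLang Γ y (argLang Γ L [conV n [], hypV y (headV (Γ y))] y) := by
  have hh : headV (imps Γ (.atom c)) = conV n [] := headV_imps _ _
  ext l
  constructor
  · intro hl
    match l, hl with
    | [], _ => exact .inl (.inl rfl)
    | [a], hl =>
      have := (h.struct _ hl).head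
      rw [hh] at this
      exact .inl (.inr (.inl (by rw [this])))
    | a :: b :: m, hl =>
      have h1 := (h.struct _ hl).head
      rw [hh] at h1
      subst h1
      have h2 : [conV n [], b] ∈ L := h.prefix (m := m) hl
      have h3 := (h.player [conV n []] (h.prefix (m := [b]) h2) (by simp)).unique h2 hb
      subst h3
      cases m with
      | nil => exact .inl (.inr (.inr rfl))
      | cons v m =>
        right
        have h4 : [conV n []] ++ [hypV y (headV (Γ y)), v] ∈ L := h.prefix (m := m) hl
        have h5 := h.oppar _ _ _ h4 (by simp)
        have hmv := (h.struct _ h4).mv (v := v) (by simp)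
        rcases hmv.cases with ⟨w, rfl, hw⟩ | ⟨x, w, rfl, hw⟩
        · rw [par_conV] at h5
          exact absurd h5.symm (hypV_ne_conV y.2 _ _)
        · rw [par_hypV] at h5
          split at h5
          · exact absurd h5.symm (hypV_ne_conV y.2 _ _)
          · next hne =>
            rw [hypV_inj] at h5
            obtain ⟨h6, h7⟩ := h5
            obtain rfl := Fin.ext h6
            rcases par_eq_headV_cases hw hne h7 with ⟨j, hj, rfl⟩ | ⟨u, _, hu, hu0⟩
            · obtain ⟨l, hl1, hl2⟩ := h.arg_surj (by simp) hj (h.neut_arg hb hj) hl rfl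
              refine ⟨j, hj, l, hl1, ?_⟩
              rw [← hl2]; rfl
            · rw [hy] at hu hu0
              exact absurd (mv_atom hu) hu0
  · rintro (hl | ⟨j, hj, m, hm, rfl⟩)
    · rcases hl with rfl | rfl | rfl
      · exact h.nil
      · rw [← hh]; exact h.init
      · exact hb
    · exact hm.2

end

/-! ## Languages over sequents whose conclusion is boxed -/

/-- Vertices in the scope of the outermost box of the conclusion, or of the target of a
hypothesis. -/
def Inside {n : ℕ} (Γ : Fin n → Formula) (v : Vertex) : Prop :=
  (∃ w, v = conV n (true :: w)) ∨ ∃ (x : Fin n) (w : Vertex) (B : Formula),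
    tgt (Γ x) = .box B ∧ v = hypV x (conV (ar (Γ x)) (true :: w))

section
variable {n : ℕ} {Γ : Fin n → Formula} {C : Formula} {L : Set (List Vertex)}

theorem inside_hyp_head {x : Fin n} {B : Formula} (h : tgt (Γ x) = .box B) :
    Inside Γ (hypV x (headV (Γ x))) :=
  .inr ⟨x, headV B, B, h, by rw [headV_tgt (Γ x), h]; rfl⟩

theorem inside_bodyMap {k : ℕ} {y : Fin k → Fin n} {B : Fin k → Formula}
    (hy : ∀ i, tgt (Γ (y i)) = .box (B i)) {v : Vertex} (hv : Mv (imps B C) v) :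
    Inside Γ (bodyMap Γ y v) := by
  rcases hv.cases with ⟨w, rfl, _⟩ | ⟨i, w, rfl, _⟩
  · exact .inl ⟨w, bodyMap_conV _ _ _⟩
  · exact .inr ⟨y i, w, B i, hy i, bodyMap_hypV _ _ _ _⟩

theorem Inside.first {v : Vertex} (h : Inside Γ v) :
    ∃ b, (addr (imps Γ (.box C)) v)[0]? = some b := by
  rcases h with ⟨w, rfl⟩ | ⟨x, w, B, hB, rfl⟩
  · rw [addr_conV]; exact ⟨_, rfl⟩
  · rw [addr_hypV, addr_tgt, hB]; exact ⟨_, rfl⟩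

/-- Edges stay in the scope of an outermost box, apart from the two exclusions `h1` and `h2`: a head
of a hypothesis changes to the box of another formula, and a move justified by such a head may lie
in an argument. -/
theorem Inside.child {v : Vertex} (hv : Mv (imps Γ (.box C)) v)
    (hu : Inside Γ (par (imps Γ (.box C)) v)) (h0 : v ≠ headV (imps Γ (.box C)))
    (h1 : ∀ x : Fin n, v ≠ hypV x (headV (Γ x)))
    (h2 : ∀ x : Fin n, par (imps Γ (.box C)) v ≠ hypV x (headV (Γ x))) :
    Inside Γ v ∧ (addr (imps Γ (.box C)) v)[0]? =
      (addr (imps Γ (.box C)) (par (imps Γ (.box C)) v))[0]? := by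
  have hcon : ∀ w, Mv (.box C) w → ∃ w', w = true :: w' := by
    intro w hw
    match w, hw with
    | [], hw => simp [Mv, label] at hw
    | [false], hw => simp [Mv, label] at hw
    | false :: _ :: _, hw => simp [Mv, label] at hw
    | true :: w, _ => exact ⟨w, rfl⟩
  rcases hv.cases with ⟨w, rfl, hw⟩ | ⟨x, w, rfl, hw⟩
  · obtain ⟨w', rfl⟩ := hcon w hw
    refine ⟨.inl ⟨w', rfl⟩, ?_⟩
    rw [par_conV, addr_conV, addr_conV]; rfl
  · have hne : w ≠ headV (Γ x) := fun e => h1 x (by rw [e])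
    rw [par_hypV, if_neg hne] at hu h2 ⊢
    rcases hu with ⟨w', e⟩ | ⟨x', w', B, hB, e⟩
    · exact absurd e (hypV_ne_conV x.2 _ _)
    · obtain ⟨e1, e2⟩ := hypV_inj.1 e
      obtain rfl := Fin.ext e1
      rcases vertex_cases_formula hw.isVertex with ⟨a, rfl⟩ | ⟨j, hj, a, rfl⟩
      · rw [par_tgt, conV_inj, hB] at e2
        match a, e2 with
        | [], e2 => simp [par] at e2
        | false :: _, e2 => simp [par] at e2
        | true :: a, _ =>
          refine ⟨.inr ⟨x, a, B, hB, rfl⟩, ?_⟩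
          rw [addr_hypV, addr_hypV, par_tgt, addr_tgt, addr_tgt, hB]; rfl
      · rw [par_arg hj] at e2
        split at e2
        · next e3 => exact absurd (by rw [par_arg hj, if_pos e3]) (h2 x)
        · exact absurd e2 (hypV_ne_conV hj _ _)

theorem LW.depth_hyp_head_odd {n : ℕ} {Γ : Fin n → Formula} {D : Formula} (x : Fin n) :
    ¬ Even (depth (imps Γ D) (hypV x (headV (Γ x)))) := by
  rw [depth_hypV, depth_headV]; decide

/-- Inside a box, the first box of each move is linked to that box. -/
theorem LW.first_box (h : LW (imps Γ (.box C)) L) {l : List Vertex} (hl : l ∈ L)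
    (hin : ∀ v ∈ l, Inside Γ v) : ∀ v ∈ l, ∃ b, (addr (imps Γ (.box C)) v)[0]? = some b ∧
      Relation.EqvGen (Lk (imps Γ (.box C)) l) b (conV n [false]) := by
  induction l using List.reverseRecOn with
  | nil => simp
  | append_singleton l v ih =>
    have ih := ih (h.pre _ _ hl) fun v hv => hin v (List.mem_append_left _ hv)
    have old : ∀ u ∈ l, ∃ b, (addr (imps Γ (.box C)) u)[0]? = some b ∧
        Relation.EqvGen (Lk (imps Γ (.box C)) (l ++ [v])) b (conV n [false]) := by
      intro u hu
      obtain ⟨b, h1, h2⟩ := ih u hu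
      exact ⟨b, h1, h2.mono fun a b hab => hab.mono (List.prefix_append _ _)⟩
    intro u hu
    rcases List.mem_append.1 hu with hu | hu
    · exact old u hu
    obtain rfl := List.mem_singleton.1 hu
    have hpar := h.parity _ _ hl
    rcases List.eq_nil_or_concat' l with rfl | ⟨l', o, rfl⟩
    · have := (h.struct _ hl).head
      rw [headV_imps] at this
      subst this
      refine ⟨conV n [false], ?_, .refl _⟩
      rw [addr_conV]; rfl
    rcases Nat.even_or_odd (l' ++ [o]).length with hev | hodd
    · rcases Struct.snoc_iff.1 (h.struct _ hl) with ⟨h1, _⟩ | ⟨_, _, h3, h4, h5⟩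
      · simp at h1
      have hl' : l' ++ [o, u] ∈ L := by simpa using hl
      have hpo := h.oppar _ _ _ hl' (by simpa [Nat.even_add_one] using hev)
      obtain ⟨b, h6, h7⟩ := old _ h5
      refine ⟨b, ?_, h7⟩
      -- The opponent's move has the same first box as its justifier. If the latter is the head of a
      -- hypothesis, this uses that the move is inside, thus in the target and not in an argument.
      by_cases hx : ∃ x : Fin n, par (imps Γ (.box C)) u = hypV x (headV (Γ x))
      · obtain ⟨x, hx⟩ := hx
        have hu := hin u (by simp)
        rcases hu with ⟨w, rfl⟩ | ⟨x', w, B, hB, rfl⟩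
        · rw [par_conV] at hx
          exact absurd hx.symm (hypV_ne_conV x.2 _ _)
        · rw [par_hypV] at hx h6
          split at hx
          · exact absurd hx.symm (hypV_ne_conV x.2 _ _)
          · next hne =>
            rw [if_neg hne, addr_hypV, par_tgt, addr_tgt, hB] at h6
            rw [addr_hypV, addr_tgt, hB, ← h6]; rfl
      · push Not at hx
        rw [(Inside.child h3 (hin _ (List.mem_append_left _ h5)) h4 ?_ hx).2, h6]
        rintro x rfl
        exact LW.depth_hyp_head_odd x (hpar.2 hev)
    -- The first box of a player move is linked to that of the opponent move before it.
    · obtain ⟨b, h6, h7⟩ := old o (by simp)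
      obtain ⟨b', h8⟩ := (hin u (by simp)).first (C := C)
      refine ⟨b', h8, .trans _ _ _ (.symm _ _ (.rel _ _ ?_)) h7⟩
      refine ⟨l', o, u, ?_, by simp, .inr ⟨0, h6, h8⟩⟩
      simpa [Nat.odd_add_one] using hodd

/-- The player does not leave the scope of a box. -/
theorem LW.inside_player (h : LW (imps Γ (.box C)) L) {l : List Vertex} {s : Vertex}
    (hl : l ++ [s] ∈ L) (hodd : Odd l.length) (hin : ∀ v ∈ l, Inside Γ v) : Inside Γ s := by
  rcases List.eq_nil_or_concat' l with rfl | ⟨l', o, rfl⟩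
  · simp at hodd
  have hl' : l' ++ [o, s] ∈ L := by simpa using hl
  have hlen := (h.lab _ _ _ hl' (by simpa [Nat.odd_add_one] using hodd)).2
  obtain ⟨b, hb⟩ := (hin o (by simp)).first (C := C)
  have hb' := (List.getElem?_eq_some_iff.1 hb).1
  rw [← hlen] at hb'
  rcases Struct.snoc_iff.1 (h.struct _ hl) with ⟨h1, _⟩ | ⟨_, _, h3, h4, h5⟩
  · simp at h1
  have hds : ¬ Even (depth (imps Γ (.box C)) s) := by
    rw [h.parity _ _ hl, Nat.not_even_iff_odd]; exact hodd
  by_cases hx : ∃ x : Fin n, s = hypV x (headV (Γ x))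
  · obtain ⟨x, rfl⟩ := hx
    -- The address of the reply is as long as that of an inside move, so it is not empty and the
    -- target is boxed.
    rcases tgt_cases (Γ x) with ⟨c, hc⟩ | ⟨B, hB⟩
    · rw [addr_hypV, headV_tgt (Γ x), addr_tgt, hc] at hb'
      simp [addr] at hb'
    · exact inside_hyp_head hB
  · push Not at hx
    -- By parity the justifier of a player move is not the head of a hypothesis.
    refine (Inside.child h3 (hin _ h5) h4 hx ?_).1
    intro x hp
    rw [depth_par h3 h4, hp, Nat.even_add_one, not_not] at hds
    exact LW.depth_hyp_head_odd x hds

/-- Suppose that, in an argument, the player replies with a move justified in `q` that is not the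
head of a hypothesis. Its first box is that of its justifier, hence is linked to the box of the
conclusion by `LW.first_box`. It is also linked to the first box of the preceding move, which is in
the argument. But going back in the argument from a first box linked to the conclusion, one would
find a second box of even depth in that class. -/
theorem closed_box (h : LW (imps Γ (.box C)) L) {q : List Vertex} (hq : q ∈ L)
    (hev : Even q.length) {y : Fin n} {j : ℕ}
    (hj : j < ar (Γ y)) (hin : ∀ v ∈ q, Inside Γ v) : Closed Γ (.box C) L q y j := by
  have hlast : ∀ (N : List Vertex), N ∈ L → ∀ l ∈ argLang Γ L q y j,
      q ++ l.map (argMap n y j) <+: N → ∀ u ∈ l,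
      ¬ ∃ b, (addr (imps Γ (.box C)) (argMap n y j u))[0]? = some b ∧
        Relation.EqvGen (Lk (imps Γ (.box C)) N) b (conV n [false]) := by
    intro N hN l hl hlN
    have hbox : Even (depth (imps Γ (.box C)) (conV n [false])) := by
      rw [depth_conV]; simp [depth]
    induction l using List.reverseRecOn with
    | nil => simp
    | append_singleton l u ih =>
      have hl2 : q ++ l.map (argMap n y j) ++ [argMap n y j u] ∈ L := by simpa using hl.2
      have hlN' : q ++ l.map (argMap n y j) ++ [argMap n y j u] <+: N := by simpa using hlN
      have ih := ih ⟨hl.1.pre, h.pre _ _ hl2⟩ ((List.prefix_append _ _).trans hlN')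
      intro u' hu'
      rcases List.mem_append.1 hu' with hu' | hu'
      · exact ih u' hu'
      obtain rfl := List.mem_singleton.1 hu'
      rintro ⟨b, hb, hbC⟩
      have hmu : Mv (imps Γ (argF (Γ y) j)) u' := hl.1.mv (by simp)
      have hpar := h.parity _ _ hl2
      have hnc : ∀ w, b ≠ conV n w := by
        rintro w rfl
        rcases hmu.cases with ⟨a, rfl, _⟩ | ⟨x, a, rfl, _⟩
        · rw [argMap_conV, addr_hypV, List.getElem?_map, Option.map_eq_some_iff] at hb
          obtain ⟨b, _, e⟩ := hb
          exact hypV_ne_conV y.2 _ _ e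
        · rw [argMap_hypV, addr_hypV, List.getElem?_map, Option.map_eq_some_iff] at hb
          obtain ⟨b, _, e⟩ := hb
          exact hypV_ne_conV x.2 _ _ e
      -- The only vertex of even depth in the class is the box of the conclusion, whereas `b` is in
      -- a hypothesis.
      have heven : ¬ Even (depth (imps Γ (.box C)) b) := fun he =>
        hnc _ (h.link N hN _ _ hbC he hbox)
      -- The boxes around the opening move of the argument have depth `2`, so none of them is `b`.
      rcases List.eq_nil_or_concat' l with rfl | ⟨l', o, rfl⟩
      · have := hl.1.head
        subst this
        rw [headV_argMap, addr_hypV, addr_arg hj, List.map_map, List.getElem?_map,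
          Option.map_eq_some_iff] at hb
        obtain ⟨b, hb, rfl⟩ := hb
        apply heven
        rw [Function.comp_apply, depth_hypV, depth_arg hj,
          depth_of_mem_addr_headV (List.mem_of_getElem? hb)]
        decide
      · have hl3 : (q ++ l'.map (argMap n y j)) ++ [argMap n y j o, argMap n y j u'] ∈ L := by
          simpa using hl2
        have hlen : (q ++ (l' ++ [o]).map (argMap n y j)).length =
            (q ++ l'.map (argMap n y j)).length + 1 := by simp; omega
        rcases Nat.even_or_odd (q ++ (l' ++ [o]).map (argMap n y j)).length with he | ho
        -- For an opponent move, a first box of odd depth also surrounds its justifier, which is the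
        -- previous move; for a player move, the first box is linked to that of the previous move.
        · rcases addr_par (argMap_mv (C := .box C) hj hmu) hb with h1 | ⟨_, h1⟩
          · exact heven (h1.2 (hpar.2 he))
          · rw [h.oppar _ _ _ hl3 (by rw [hlen, Nat.even_add_one] at he; simpa using he)] at h1
            exact ih o (by simp) ⟨b, h1, hbC⟩
        · have he : Even (q ++ l'.map (argMap n y j)).length := by
            rw [hlen, Nat.odd_add_one] at ho; simpa using ho
          have hlen := (h.lab _ _ _ hl3 he).2
          have hb' := (List.getElem?_eq_some_iff.1 hb).1
          rw [hlen] at hb'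
          have hbo := List.getElem?_eq_getElem hb'
          refine ih o (by simp) ⟨_, hbo, .trans _ _ _ (.rel _ _ ?_) hbC⟩
          exact ⟨_, _, _, he, by simpa using hlN', .inr ⟨0, hbo, hb⟩⟩
  intro l v hl ho hv hp
  by_contra hx
  push Not at hx
  rcases Struct.snoc_iff.1 (h.struct _ hv) with ⟨h1, _⟩ | ⟨_, _, h3, h4, _⟩
  · simp at h1
    rw [h1.2] at ho; simp at ho
  have hodd : Odd (q ++ l.map (argMap n y j)).length := by
    rw [List.length_append, List.length_map]; exact hev.add_odd ho
  have hds : ¬ Even (depth (imps Γ (.box C)) v) := by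
    rw [h.parity _ _ hv, Nat.not_even_iff_odd]; exact hodd
  obtain ⟨_, h6⟩ := Inside.child h3 (hin _ hp) h4 hx (by
    intro x hp
    rw [depth_par h3 h4, hp, Nat.even_add_one, not_not] at hds
    exact LW.depth_hyp_head_odd x hds)
  obtain ⟨b, h7, h8⟩ := h.first_box hq hin _ hp
  rw [h7] at h6
  obtain ⟨l', o, rfl⟩ : ∃ l' o, l = l' ++ [o] := by
    rcases List.eq_nil_or_concat' l with rfl | h1
    · simp at ho
    · exact h1
  have he : Even (q ++ l'.map (argMap n y j)).length := by
    rw [List.map_append, List.map_singleton, ← List.append_assoc, List.length_append,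
      List.length_singleton, Nat.odd_add_one] at hodd
    simpa using hodd
  have hv' : (q ++ l'.map (argMap n y j)) ++ [argMap n y j o, v] ∈ L := by simpa using hv
  have hlen := (h.lab _ _ _ hv' he).2
  have hb' := (List.getElem?_eq_some_iff.1 h6).1
  rw [hlen] at hb'
  have hbo := List.getElem?_eq_getElem hb'
  refine hlast _ hv _ hl (List.prefix_append _ _) o (by simp) ⟨_, hbo, ?_⟩
  refine .trans _ _ _ (.rel _ _ ⟨_, _, _, he, by simp, .inr ⟨0, hbo, h6⟩⟩) ?_
  exact h8.mono fun a b hab => hab.mono (by simp)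

theorem LW.box_arg (h : LW (imps Γ (.box C)) L) {q : List Vertex} (hq : q ∈ L)
    (hin : ∀ v ∈ q, Inside Γ v) {y : Fin n} (hlast : q.getLast? = some (hypV y (headV (Γ y))))
    {j : ℕ} (hj : j < ar (Γ y)) :
    LW (imps Γ (argF (Γ y) j)) (argLang Γ L q y j) ∧ Even q.length := by
  have hev : Even q.length := by
    obtain ⟨q', rfl⟩ := List.getLast?_eq_some_iff.1 hlast
    have h1 := h.parity _ _ hq
    have : ¬ Even q'.length := fun he => LW.depth_hyp_head_odd y (h1.2 he)
    rw [List.length_append, List.length_singleton, Nat.even_add_one]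
    exact this
  exact ⟨h.arg hq hev hlast hj (closed_box h hq hev hj hin), hev⟩

end

/-! ## The language of the body of an explicit substitution -/

/-- The language of the body of an explicit substitution with language `L`: sequences in which each
hypothesis `i` is played with the languages `LU i` of its arguments. -/
def bodyLang {n k : ℕ} (Γ : Fin n → Formula) (y : Fin k → Fin n) (B : Fin k → Formula)
    (C : Formula) (L : Set (List Vertex)) (LU : Fin k → ℕ → Set (List Vertex)) :
    Set (List Vertex) :=
  {l | Struct (imps B C) l ∧ l.map (bodyMap Γ y) ∈ L ∧
    ∀ (l' : List Vertex) (i : Fin k), l' ++ [hypV i (headV (B i))] <+: l →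
      ∀ j < ar (Γ (y i)),
        argLang Γ L ((l' ++ [hypV i (headV (B i))]).map (bodyMap Γ y)) (y i) j = LU i j}

section
variable {n k : ℕ} {Γ : Fin n → Formula} {y : Fin k → Fin n} {B : Fin k → Formula} {C : Formula}
  {L : Set (List Vertex)} {LU : Fin k → ℕ → Set (List Vertex)}

/-- Different arguments have different heads or different languages. -/
def KeyInj {n k : ℕ} (Γ : Fin n → Formula) (y : Fin k → Fin n)
    (LU : Fin k → ℕ → Set (List Vertex)) : Prop :=
  ∀ i i', y i = y i' → (∀ j < ar (Γ (y i)), LU i j = LU i' j) → i = i'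

theorem bodyMap_eq_hypV {v : Vertex}
    (hv : Mv (imps B C) v) {x : Fin n} {a : Vertex} (h : bodyMap Γ y v = hypV x a) :
    ∃ (i : Fin k) (w : Vertex), v = hypV i w ∧ y i = x ∧ a = conV (ar (Γ (y i))) (true :: w) := by
  rcases hv.cases with ⟨w, rfl, _⟩ | ⟨i, w, rfl, _⟩
  · rw [bodyMap_conV] at h
    exact absurd h.symm (hypV_ne_conV x.2 _ _)
  · rw [bodyMap_hypV] at h
    obtain ⟨h1, h2⟩ := hypV_inj.1 h
    exact ⟨i, w, rfl, Fin.ext h1, h2.symm⟩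

theorem bodyMap_eq_head (hy : ∀ i, tgt (Γ (y i)) = .box (B i)) {v : Vertex}
    (hv : Mv (imps B C) v) {x : Fin n} (h : bodyMap Γ y v = hypV x (headV (Γ x))) :
    ∃ i : Fin k, v = hypV i (headV (B i)) ∧ y i = x := by
  obtain ⟨i, w, rfl, rfl, e⟩ := bodyMap_eq_hypV hv h
  rw [headV_tgt (Γ (y i)), hy, conV_inj] at e
  refine ⟨i, ?_, rfl⟩
  simp only [headV, List.cons.injEq, true_and] at e
  rw [e]

theorem hyp_eq_of_nodup (hy : ∀ i, tgt (Γ (y i)) = .box (B i)) {l : List Vertex}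
    (hn : (l.map (bodyMap Γ y)).Nodup) {i i' : Fin k} (h : hypV i (headV (B i)) ∈ l)
    (h' : hypV i' (headV (B i')) ∈ l) (e : y i = y i') : i = i' := by
  have := List.inj_on_of_nodup_map hn h h' (by rw [bodyMap_head hy, bodyMap_head hy, e])
  exact Fin.ext (hypV_inj.1 this).1

/-- `bodyMap` is injective on languages in which the next hypothesis played is determined. -/
theorem bodyMap_map_inj (hy : ∀ i, tgt (Γ (y i)) = .box (B i)) {P : Set (List Vertex)}
    (hpre : ∀ l v, l ++ [v] ∈ P → l ∈ P) (hst : ∀ l ∈ P, Struct (imps B C) l)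
    (hnd : ∀ l ∈ P, (l.map (bodyMap Γ y)).Nodup)
    (hdet : ∀ (l : List Vertex) (i i' : Fin k), l ++ [hypV i (headV (B i))] ∈ P →
      l ++ [hypV i' (headV (B i'))] ∈ P → y i = y i' → i = i')
    {l l' : List Vertex} (hl : l ∈ P) (hl' : l' ∈ P)
    (h : l.map (bodyMap Γ y) = l'.map (bodyMap Γ y)) : l = l' := by
  induction l using List.reverseRecOn generalizing l' with
  | nil => simpa [eq_comm] using h
  | append_singleton l v ih =>
    rcases List.eq_nil_or_concat' l' with rfl | ⟨l', v', rfl⟩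
    · simp at h
    rw [List.map_append, List.map_append] at h
    obtain ⟨h3, h4⟩ := List.append_inj' h rfl
    obtain rfl := ih (hpre _ _ hl) (hpre _ _ hl') h3
    simp only [List.map_cons, List.map_nil, List.cons.injEq, and_true] at h4
    have hs := hst _ hl
    have hs' := hst _ hl'
    have hmv : Mv (imps B C) v := hs.mv (by simp)
    have hmv' : Mv (imps B C) v' := hs'.mv (by simp)
    suffices v = v' by rw [this]
    rcases hmv.cases with ⟨w, rfl, _⟩ | ⟨i, w, rfl, _⟩
    · rcases hmv'.cases with ⟨w', rfl, _⟩ | ⟨i', w', rfl, _⟩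
      · rw [bodyMap_conV, bodyMap_conV, conV_inj] at h4
        rw [(List.cons.inj h4).2]
      · rw [bodyMap_conV, bodyMap_hypV] at h4
        exact absurd h4.symm (hypV_ne_conV (y i').2 _ _)
    · rw [bodyMap_hypV] at h4
      obtain ⟨i', w', rfl, e1, e2⟩ := bodyMap_eq_hypV hmv' h4.symm
      rw [e1, conV_inj] at e2
      obtain rfl := (List.cons.inj e2).2
      have hB : B i = B i' := by
        have := hy i
        rw [← e1, hy i'] at this
        simpa using this.symm
      suffices i = i' by rw [this]
      have h1 := hs.hyp_head (x := i) (w := w) (by simp)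
      have h1' := hs'.hyp_head (x := i') (w := w) (by simp)
      -- If `v` is the head of its hypothesis, `hdet` decides which hypothesis it is. Otherwise that
      -- head was played in the common prefix, and two hypotheses standing for the same one of `Γ`
      -- cannot both be played in a view without repetitions.
      by_cases hw : w = headV (B i)
      · subst hw
        exact hdet l i i' hl (by rwa [← hB]) e1.symm
      · have k1 : hypV i (headV (B i)) ∈ l := by
          rcases List.mem_append.1 h1 with h1 | h1
          · exact h1
          · exact absurd (hypV_inj.1 (List.mem_singleton.1 h1)).2.symm hw
        have k2 : hypV i' (headV (B i')) ∈ l := by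
          rcases List.mem_append.1 h1' with h1 | h1
          · exact h1
          · rw [← hB] at h1
            exact absurd (hypV_inj.1 (List.mem_singleton.1 h1)).2.symm hw
        exact hyp_eq_of_nodup hy (hnd _ (hpre _ _ hl)) k1 k2 e1.symm

/-- Two bound hypotheses that stand for the same hypothesis of `Γ` after the same view have the same
argument languages, namely those found in `L`; `KeyInj` makes them equal. -/
theorem bodyLang_inj (h : LW (imps Γ (.box C)) L) (hy : ∀ i, tgt (Γ (y i)) = .box (B i))
    (hkey : KeyInj Γ y LU) {l l' : List Vertex} (hl : l ∈ bodyLang Γ y B C L LU)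
    (hl' : l' ∈ bodyLang Γ y B C L LU) (e : l.map (bodyMap Γ y) = l'.map (bodyMap Γ y)) :
    l = l' := by
  refine bodyMap_map_inj hy ?_ (fun l hl => hl.1) (fun l hl => h.nodup _ hl.2.1) ?_ hl hl' e
  · rintro l v ⟨h1, h2, h3⟩
    rw [List.map_append] at h2
    exact ⟨h1.pre, h.pre _ _ h2, fun m i hp => h3 m i (hp.trans (List.prefix_append _ _))⟩
  · intro l i i' hi hi' e
    refine hkey i i' e fun j hj => ?_
    rw [← hi.2.2 l i List.prefix_rfl j hj, ← hi'.2.2 l i' List.prefix_rfl j (by rwa [← e]),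
      List.map_append, List.map_append, List.map_singleton, List.map_singleton, bodyMap_head hy,
      bodyMap_head hy, e]

/-- The new outermost box shifts indices in addresses by one, uniformly for all moves; thus equality
of lengths and links between inner boxes are unaffected. -/
theorem addr_bodyMap (hy : ∀ i, tgt (Γ (y i)) = .box (B i)) {v : Vertex}
    (hv : Mv (imps B C) v) : ∃ b,
      (b = conV n [false] ∨ ∃ i, b = hypV (y i) (conV (ar (Γ (y i))) [false])) ∧
      addr (imps Γ (.box C)) (bodyMap Γ y v) = b :: (addr (imps B C) v).map (bodyMap Γ y) := by
  rcases hv.cases with ⟨w, rfl, _⟩ | ⟨i, w, rfl, _⟩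
  · refine ⟨conV n [false], .inl rfl, ?_⟩
    rw [bodyMap_conV, addr_conV, addr_conV, addr, List.map_cons, List.map_map, List.map_map]
    congr 1
    exact List.map_congr_left fun b _ => (bodyMap_conV _ _ _).symm
  · refine ⟨hypV (y i) (conV (ar (Γ (y i))) [false]), .inr ⟨i, rfl⟩, ?_⟩
    rw [bodyMap_hypV, addr_hypV, addr_hypV, addr_tgt, hy, addr, List.map_cons, List.map_cons,
      List.map_map, List.map_map, List.map_map]
    congr 1
    exact List.map_congr_left fun b _ => (bodyMap_hypV _ _ _ _).symm

theorem depth_bodyMap (hy : ∀ i, tgt (Γ (y i)) = .box (B i)) {v : Vertex}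
    (hv : (∃ w, v = conV k w) ∨ ∃ (i : Fin k) (w : Vertex), v = hypV i w) :
    depth (imps Γ (.box C)) (bodyMap Γ y v) = depth (imps B C) v := by
  rcases hv with ⟨w, rfl⟩ | ⟨i, w, rfl⟩
  · rw [bodyMap_conV, depth_conV, depth_conV]; rfl
  · rw [bodyMap_hypV, depth_hypV, depth_hypV, depth_tgt, hy]; rfl

theorem body_lift (hy : ∀ i, tgt (Γ (y i)) = .box (B i)) {u s : Vertex} (hu : Mv (imps B C) u)
    (hs : Mv (imps Γ (.box C)) s) (hin : Inside Γ s) (hs0 : s ≠ headV (imps Γ (.box C)))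
    (hsh : ∀ x : Fin n, s ≠ hypV x (headV (Γ x)))
    (hp : par (imps Γ (.box C)) s = bodyMap Γ y u) :
    ∃ v, Mv (imps B C) v ∧ v ≠ headV (imps B C) ∧ par (imps B C) v = u ∧ s = bodyMap Γ y v ∧
      ∀ i : Fin k, v ≠ hypV i (headV (B i)) := by
  rw [headV_imps] at hs0
  rcases hin with ⟨w, rfl⟩ | ⟨x, w, B', hB', rfl⟩
  · rw [par_conV] at hp
    rcases hu.cases with ⟨a, rfl, _⟩ | ⟨i, a, rfl, _⟩
    · rw [bodyMap_conV, conV_inj] at hp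
      have hp' : par C w = a := (List.cons.inj hp).2
      refine ⟨conV k w, mv_conV.2 ?_, ?_, ?_, (bodyMap_conV _ _ _).symm, ?_⟩
      · simpa [Mv, label] using mv_conV.1 hs
      · rw [headV_imps, Ne, conV_inj]
        rintro rfl; exact hs0 rfl
      · rw [par_conV, hp']
      · intro i e; exact hypV_ne_conV i.2 _ _ e.symm
    · rw [bodyMap_hypV] at hp
      exact absurd hp.symm (hypV_ne_conV (y i).2 _ _)
  · have hne : conV (ar (Γ x)) (true :: w) ≠ headV (Γ x) := fun e => hsh x (by rw [e])
    rw [par_hypV, if_neg hne, par_tgt, hB'] at hp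
    obtain ⟨i, a, rfl, rfl, e⟩ := bodyMap_eq_hypV hu hp.symm
    have hBB : B' = B i := by
      have := hy i; rw [hB'] at this; simpa using this
    subst hBB
    rw [conV_inj] at e
    have e' : par (B i) w = a := (List.cons.inj e).2
    have hw : w ≠ headV (B i) := by
      rintro rfl
      apply hne
      rw [headV_tgt (Γ (y i)), hB']; rfl
    refine ⟨hypV i w, mv_hypV.2 ?_, ?_, ?_, (bodyMap_hypV _ _ _ _).symm, ?_⟩
    · have := mv_hypV.1 hs
      obtain ⟨c, hc⟩ := this
      rw [label_tgt, hB'] at hc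
      exact ⟨c, hc⟩
    · rw [headV_imps]; exact hypV_ne_conV i.2 _ _
    · rw [par_hypV, if_neg hw, e']
    · intro i' e
      obtain ⟨h1, h2⟩ := hypV_inj.1 e
      obtain rfl := Fin.ext h1
      exact hw h2

/-- Each hypothesis played in the scope of the box, with the languages of its arguments, is among
the given ones. -/
def Covers {n k : ℕ} (Γ : Fin n → Formula) (y : Fin k → Fin n) (L : Set (List Vertex))
    (LU : Fin k → ℕ → Set (List Vertex)) : Prop :=
  ∀ q ∈ L, (∀ v ∈ q, Inside Γ v) → ∀ x : Fin n, q.getLast? = some (hypV x (headV (Γ x))) →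
    ∃ i, y i = x ∧ ∀ j < ar (Γ x), argLang Γ L q x j = LU i j

theorem bodyLang_snoc {l : List Vertex} {v : Vertex} (hl : l ∈ bodyLang Γ y B C L LU)
    (hs : Struct (imps B C) (l ++ [v])) (hL : (l ++ [v]).map (bodyMap Γ y) ∈ L)
    (hk : ∀ i : Fin k, v = hypV i (headV (B i)) → ∀ j < ar (Γ (y i)),
      argLang Γ L ((l ++ [v]).map (bodyMap Γ y)) (y i) j = LU i j) :
    l ++ [v] ∈ bodyLang Γ y B C L LU := by
  refine ⟨hs, hL, fun m i hp j hj => ?_⟩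
  rcases List.prefix_concat_iff.1 hp with h1 | h1
  · obtain ⟨rfl, h2⟩ := List.append_inj' h1 rfl
    simp only [List.cons.injEq, and_true] at h2
    rw [h2]; exact hk i h2.symm j hj
  · exact hl.2.2 m i h1 j hj

/-- A move that is not the head of a hypothesis belongs to the same formula as its justifier and
lifts along with it. For a head, `Covers` gives the bound hypothesis, selected by the languages of
the arguments after this very view. -/
theorem LW.body_next (h : LW (imps Γ (.box C)) L) (hy : ∀ i, tgt (Γ (y i)) = .box (B i))
    (hcov : Covers Γ y L LU) {l : List Vertex} {s : Vertex} (hl : l ∈ bodyLang Γ y B C L LU)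
    (hl0 : l ≠ []) (hs : l.map (bodyMap Γ y) ++ [s] ∈ L) (hin : Inside Γ s) :
    ∃ v, l ++ [v] ∈ bodyLang Γ y B C L LU ∧ s = bodyMap Γ y v := by
  have hinl : ∀ v ∈ l.map (bodyMap Γ y), Inside Γ v := by
    intro v hv
    obtain ⟨u, hu, rfl⟩ := List.mem_map.1 hv
    exact inside_bodyMap hy (hl.1.mv hu)
  rcases Struct.snoc_iff.1 (h.struct _ hs) with ⟨h1, _⟩ | ⟨_, _, h3, h4, h5⟩
  · simp [hl0] at h1
  by_cases hx : ∃ x : Fin n, s = hypV x (headV (Γ x))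
  · obtain ⟨x, rfl⟩ := hx
    obtain ⟨i, rfl, hi⟩ := hcov _ hs (by
      intro v hv
      rcases List.mem_append.1 hv with hv | hv
      · exact hinl v hv
      · rw [List.mem_singleton.1 hv]; exact hin) x (by simp)
    refine ⟨hypV i (headV (B i)), ?_, (bodyMap_head hy i).symm⟩
    have hmap : (l ++ [hypV i (headV (B i))]).map (bodyMap Γ y) =
        l.map (bodyMap Γ y) ++ [hypV (y i) (headV (Γ (y i)))] := by
      rw [List.map_append, List.map_singleton, bodyMap_head hy]
    refine bodyLang_snoc hl (.snoc hl.1 (mv_hypV.2 (mv_headV _)) ?_ ?_) (by rwa [hmap]) ?_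
    · rw [headV_imps]; exact hypV_ne_conV i.2 _ _
    · rw [par_hypV, if_pos rfl, ← headV_imps B]; exact hl.1.head_mem hl0
    · intro i' e j hj
      obtain rfl := Fin.ext (hypV_inj.1 e).1
      rw [hmap]; exact hi j hj
  · push Not at hx
    obtain ⟨u, hu, hup⟩ := List.mem_map.1 h5
    obtain ⟨v, hv1, hv2, hv3, rfl, hv4⟩ := body_lift hy (hl.1.mv hu) h3 hin h4 hx hup.symm
    refine ⟨v, bodyLang_snoc hl (.snoc hl.1 hv1 hv2 (by rwa [hv3])) (by simpa using hs) ?_, rfl⟩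
    intro i e
    exact absurd e (hv4 i)

/-- Replies exist because the player stays inside (`LW.inside_player`) and inside moves lift
(`LW.body_next`); they are unique and finitely many views arise because `KeyInj` makes `bodyMap`
injective on the language. -/
theorem LW.body (h : LW (imps Γ (.box C)) L) (hy : ∀ i, tgt (Γ (y i)) = .box (B i))
    (hkey : KeyInj Γ y LU) (hcov : Covers Γ y L LU) :
    LW (imps B C) (bodyLang Γ y B C L LU) := by
  have emb := emb_bodyMap (Γ := Γ) C hy
  have hpre : ∀ l v, l ++ [v] ∈ bodyLang Γ y B C L LU → l ∈ bodyLang Γ y B C L LU :=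
    fun l v hl => ⟨hl.1.pre, h.pre _ (bodyMap Γ y v) (by simpa using hl.2.1),
      fun m i hp => hl.2.2 m i (hp.trans (List.prefix_append _ _))⟩
  have hnil : [] ∈ bodyLang Γ y B C L LU :=
    ⟨.nil, h.nil, fun m i hp => by simp at hp⟩
  have hneh : ∀ (i : Fin k) (w : Vertex), headV (imps B C) ≠ hypV i w := fun i w => by
    rw [headV_imps]; exact (hypV_ne_conV i.2 _ _).symm
  refine
    { fin := ?_
      nil := hnil
      pre := hpre
      struct := fun l hl => hl.1
      nodup := fun l hl => (h.nodup _ hl.2.1).of_map _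
      init := ?_
      opp := ?_
      oppar := ?_
      parity := ?_
      player := ?_
      lab := ?_
      link := ?_ }
  · refine Set.Finite.of_finite_image (f := List.map (bodyMap Γ y)) ?_ ?_
    · exact h.fin.subset (by rintro _ ⟨l, hl, rfl⟩; exact hl.2.1)
    · intro l hl l' hl' e
      exact bodyLang_inj h hy hkey hl hl' e
  · refine bodyLang_snoc hnil .init ?_ ?_
    · simp only [List.nil_append, List.map_singleton]
      rw [emb.head]; exact h.init
    · intro i e; exact absurd e (hneh i _)
  · intro l u v hl ho hv hv0 hpv
    have hl0 : l ≠ [] := by rintro rfl; simp at ho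
    have hu0 : u ≠ headV (imps B C) := by
      rcases Struct.snoc_iff.1 hl.1 with ⟨h3, _⟩ | ⟨_, _, _, h4, _⟩
      · exact absurd h3 hl0
      · exact h4
    have hs : Struct (imps B C) (l ++ [u] ++ [v]) := .snoc hl.1 hv hv0 (by rw [hpv]; simp)
    have := bodyLang_snoc hl hs ?_ ?_
    · simpa using this
    · have h2 := hl.2.1
      rw [List.map_append] at h2
      have h6 := emb.par v hv hv0
      have := h.opp _ _ (bodyMap Γ y v) h2 (by simpa using ho) (emb.mv hv) h6.1
        (by rw [h6.2, hpv])
      simpa using this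
    · rintro i rfl
      rw [par_hypV, if_pos rfl, ← headV_imps B] at hpv
      exact absurd hpv.symm hu0
  · intro l u v hl ho
    have h2 := hl.2.1
    rw [List.map_append] at h2
    have hs : Struct (imps B C) ((l ++ [u]) ++ [v]) := by simpa using hl.1
    rcases Struct.snoc_iff.1 hs with ⟨h3, _⟩ | ⟨_, _, h3, h4, h5⟩
    · simp at h3
    have h6 := h.oppar _ _ _ h2 (by simpa using ho)
    rw [(emb.par v h3 h4).2] at h6
    exact List.inj_on_of_nodup_map (h.nodup _ hl.2.1) (hl.1.par_mem (by simp)) (by simp) h6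
  · intro l v hl
    have h2 := hl.2.1
    rw [List.map_append] at h2
    rw [← emb.parity v (hl.1.mv (by simp)), h.parity _ _ h2, List.length_map]
  · intro l hl ho
    have hl0 : l ≠ [] := by rintro rfl; simp at ho
    obtain ⟨s, hs, hu⟩ := h.player _ hl.2.1 (by simpa using ho)
    have hin : Inside Γ s := h.inside_player hs (by simpa using ho) (by
      intro v hv
      obtain ⟨u, hu, rfl⟩ := List.mem_map.1 hv
      exact inside_bodyMap hy (hl.1.mv hu))
    obtain ⟨v, hv, rfl⟩ := h.body_next hy hcov hl hl0 hs hin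
    refine ⟨v, hv, fun v' hv' => ?_⟩
    have e2 := hv'.2.1
    rw [List.map_append] at e2
    have := bodyLang_inj h hy hkey hv' hv (by
      rw [List.map_append, List.map_append, List.map_singleton, List.map_singleton, hu _ e2])
    simpa using this
  · intro l u v hl he
    have h2 := hl.2.1
    rw [List.map_append] at h2
    have h3 := h.lab _ _ _ h2 (by simpa using he)
    have hu := hl.1.mv (v := u) (by simp)
    have hv := hl.1.mv (v := v) (by simp)
    obtain ⟨b, -, hb⟩ := addr_bodyMap (C := C) hy hu
    obtain ⟨b', -, hb'⟩ := addr_bodyMap (C := C) hy hv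
    rw [emb.label u hu, emb.label v hv, hb, hb'] at h3
    simpa using h3
  · intro l hl u w huw
    -- Links of `l` involve only the conclusion and the hypotheses played in `l`. On these `bodyMap`
    -- is injective, because the heads of two hypotheses with the same image would repeat a move.
    refine link_pullback (l' := l.map (bodyMap Γ y)) (g := bodyMap Γ y)
      (Z := fun v => (∃ w, v = conV k w) ∨
        ∃ (i : Fin k) (w : Vertex), v = hypV i w ∧ hypV i (headV (B i)) ∈ l) ?_ ?_ ?_
      (h.link _ hl.2.1) huw
    · have hZ : ∀ v ∈ l, (∃ w, v = conV k w) ∨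
          ∃ (i : Fin k) (w : Vertex), v = hypV i w ∧ hypV i (headV (B i)) ∈ l := by
        intro v hv
        rcases (hl.1.mv hv).cases with ⟨w, rfl, _⟩ | ⟨i, w, rfl, _⟩
        · exact .inl ⟨w, rfl⟩
        · exact .inr ⟨i, w, rfl, hl.1.hyp_head hv⟩
      have hZa : ∀ v ∈ l, ∀ (b : Vertex) (i : ℕ), (addr (imps B C) v)[i]? = some b →
          (∃ w, b = conV k w) ∨
          ∃ (i : Fin k) (w : Vertex), b = hypV i w ∧ hypV i (headV (B i)) ∈ l := by
        intro v hv b i hi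
        rcases hZ v hv with ⟨w, rfl⟩ | ⟨x, w, rfl, hx⟩
        · rw [addr_conV, List.getElem?_map, Option.map_eq_some_iff] at hi
          obtain ⟨b, _, rfl⟩ := hi
          exact .inl ⟨b, rfl⟩
        · rw [addr_hypV, List.getElem?_map, Option.map_eq_some_iff] at hi
          obtain ⟨b, _, rfl⟩ := hi
          exact .inr ⟨x, b, rfl, hx⟩
      rintro a b ⟨l', o, q, h1, ⟨r, rfl⟩, h3⟩
      have ho : o ∈ l' ++ [o, q] ++ r := by simp
      have hq : q ∈ l' ++ [o, q] ++ r := by simp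
      refine ⟨.rel _ _ ⟨l'.map (bodyMap Γ y), bodyMap Γ y o, bodyMap Γ y q, by simpa using h1,
        by simp, ?_⟩, ?_⟩
      · rcases h3 with ⟨rfl, rfl⟩ | ⟨i, h4, h5⟩
        · exact .inl ⟨rfl, rfl⟩
        · obtain ⟨b, -, hb⟩ := addr_bodyMap (C := C) hy (hl.1.mv ho)
          obtain ⟨b', -, hb'⟩ := addr_bodyMap (C := C) hy (hl.1.mv hq)
          refine .inr ⟨i + 1, ?_, ?_⟩
          · rw [hb, List.getElem?_cons_succ, List.getElem?_map, h4]; rfl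
          · rw [hb', List.getElem?_cons_succ, List.getElem?_map, h5]; rfl
      · rcases h3 with ⟨rfl, rfl⟩ | ⟨i, h4, h5⟩
        · exact ⟨hZ _ ho, hZ _ hq⟩
        · exact ⟨hZa _ ho _ i h4, hZa _ hq _ i h5⟩
    · rintro a b (⟨w, rfl⟩ | ⟨i, w, rfl, hi⟩) (⟨w', rfl⟩ | ⟨i', w', rfl, hi'⟩) e
      · rw [bodyMap_conV, bodyMap_conV, conV_inj] at e
        rw [(List.cons.inj e).2]
      · rw [bodyMap_conV, bodyMap_hypV] at e
        exact absurd e.symm (hypV_ne_conV (y i').2 _ _)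
      · rw [bodyMap_conV, bodyMap_hypV] at e
        exact absurd e (hypV_ne_conV (y i).2 _ _)
      · rw [bodyMap_hypV, bodyMap_hypV] at e
        obtain ⟨e1, e2⟩ := hypV_inj.1 e
        have e1 := Fin.ext e1
        obtain rfl := hyp_eq_of_nodup hy (h.nodup _ hl.2.1) hi hi' e1
        rw [conV_inj] at e2
        rw [(List.cons.inj e2).2]
    · intro a ha
      rw [depth_bodyMap hy (ha.imp id fun ⟨i, w, e, _⟩ => ⟨i, w, e⟩)]
      exact id

theorem LW.body_surj (h : LW (imps Γ (.box C)) L) (hy : ∀ i, tgt (Γ (y i)) = .box (B i))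
    (hcov : Covers Γ y L LU) {m : List Vertex} (hm : m ∈ L) (hin : ∀ v ∈ m, Inside Γ v) :
    ∃ l ∈ bodyLang Γ y B C L LU, m = l.map (bodyMap Γ y) := by
  have hnil : [] ∈ bodyLang Γ y B C L LU :=
    ⟨.nil, h.nil, fun m i hp => by simp at hp⟩
  induction m using List.reverseRecOn with
  | nil => exact ⟨[], hnil, rfl⟩
  | append_singleton m s ih =>
    obtain ⟨l, hl, rfl⟩ := ih (h.pre _ _ hm) fun v hv => hin v (List.mem_append_left _ hv)
    rcases eq_or_ne l [] with rfl | hl0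
    · have hs := (h.struct _ hm).head
      rw [← (emb_bodyMap (Γ := Γ) C hy).head] at hs
      refine ⟨[headV (imps B C)], ?_, by rw [hs]; rfl⟩
      refine bodyLang_snoc hnil .init (by simpa [hs] using hm) ?_
      intro i e
      rw [headV_imps] at e
      exact absurd e.symm (hypV_ne_conV i.2 _ _)
    · obtain ⟨v, hv, rfl⟩ := h.body_next hy hcov hl hl0 hm (hin _ (by simp))
      exact ⟨_, hv, by simp⟩

theorem exists_inside_split (l : List Vertex) : (∀ v ∈ l, Inside Γ v) ∨
    ∃ q v m, l = q ++ v :: m ∧ (∀ u ∈ q, Inside Γ u) ∧ ¬ Inside Γ v := by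
  induction l with
  | nil => left; simp
  | cons a l ih =>
    by_cases ha : Inside Γ a
    · rcases ih with h | ⟨q, v, m, rfl, h1, h2⟩
      · left; simpa [ha] using h
      · right; exact ⟨a :: q, v, m, rfl, by simpa [ha] using h1, h2⟩
    · right; exact ⟨[], a, l, rfl, by simp, ha⟩

/-- The opponent leaves the scope of a box only by playing an argument of a hypothesis. -/
theorem LW.opponent_leaves (h : LW (imps Γ (.box C)) L) {q : List Vertex} {v : Vertex}
    (hv : q ++ [v] ∈ L) (hin : ∀ u ∈ q, Inside Γ u) (hout : ¬ Inside Γ v) :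
    ∃ (x : Fin n) (j : ℕ), j < ar (Γ x) ∧ q.getLast? = some (hypV x (headV (Γ x))) ∧
      v = hypV x (hypV j (headV (argF (Γ x) j))) := by
  rcases Nat.even_or_odd q.length with he | ho
  swap
  · exact absurd (h.inside_player hv ho hin) hout
  have hpar := h.parity _ _ hv
  rcases Struct.snoc_iff.1 (h.struct _ hv) with ⟨_, rfl⟩ | ⟨h1, _, h3, h4, h5⟩
  · exact absurd (.inl ⟨headV C, headV_imps _ _⟩) hout
  obtain ⟨q', u, rfl⟩ := (List.eq_nil_or_concat' q).resolve_left h1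
  have hv' : q' ++ [u, v] ∈ L := by simpa using hv
  have hpo := h.oppar _ _ _ hv' (by simpa [Nat.even_add_one] using he)
  have hvh : ∀ x : Fin n, v ≠ hypV x (headV (Γ x)) := by
    rintro x rfl
    exact LW.depth_hyp_head_odd x (hpar.2 he)
  by_cases hx : ∃ x : Fin n, u = hypV x (headV (Γ x))
  · obtain ⟨x, rfl⟩ := hx
    rcases h3.cases with ⟨w, rfl, _⟩ | ⟨x', w, rfl, hw⟩
    · rw [par_conV] at hpo
      exact absurd hpo.symm (hypV_ne_conV x.2 _ _)
    · rw [par_hypV] at hpo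
      split at hpo
      · exact absurd hpo.symm (hypV_ne_conV x.2 _ _)
      · next hne =>
        obtain ⟨e1, e2⟩ := hypV_inj.1 hpo
        obtain rfl := Fin.ext e1
        rcases par_eq_headV_cases hw hne e2 with ⟨j, hj, rfl⟩ | ⟨a, rfl, ha, _⟩
        · exact ⟨x', j, hj, by simp, rfl⟩
        · exfalso
          apply hout
          rcases hin (hypV x' (headV (Γ x'))) (by simp) with ⟨w, e⟩ | ⟨x, w, B, hB, e⟩
          · exact absurd e (hypV_ne_conV x'.2 _ _)
          · obtain rfl := Fin.ext (hypV_inj.1 e).1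
            rw [hB] at ha
            match a, ha with
            | [], ha => simp [Mv, label] at ha
            | [false], ha => simp [Mv, label] at ha
            | false :: _ :: _, ha => simp [Mv, label] at ha
            | true :: a, _ => exact .inr ⟨x', a, B, hB, rfl⟩
  · push Not at hx
    exact absurd (Inside.child h3 (hin _ h5) h4 hvh (by rw [hpo]; exact hx)).1 hout

/-- Each view is cut at its first move that is not inside. That move is the opponent opening an
argument, so the first part is a view of the body ending with a head, and the rest is a view of the
argument. -/
theorem LW.eq_boxLang (h : LW (imps Γ (.box C)) L) (hy : ∀ i, tgt (Γ (y i)) = .box (B i))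
    (hcov : Covers Γ y L LU) : L = boxLang Γ y B (bodyLang Γ y B C L LU) LU := by
  ext l
  constructor
  · intro hl
    rcases exists_inside_split (Γ := Γ) l with hin | ⟨q, v, m, rfl, hin, hout⟩
    · obtain ⟨l', hl', rfl⟩ := h.body_surj hy hcov hl hin
      exact .inl ⟨l', hl', rfl⟩
    · right
      have hv : q ++ [v] ∈ L := h.prefix (m := m) (by simpa using hl)
      have hq : q ∈ L := h.pre _ _ hv
      obtain ⟨x, j, hj, hlast, rfl⟩ := h.opponent_leaves hv hin hout
      obtain ⟨hA, hev⟩ := h.box_arg hq hin hlast hj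
      obtain ⟨m', hm', e⟩ := h.arg_surj hev hj hA hl rfl
      obtain ⟨q', hq', rfl⟩ := h.body_surj hy hcov hq hin
      rw [List.getLast?_map, Option.map_eq_some_iff] at hlast
      obtain ⟨a, ha, hax⟩ := hlast
      obtain ⟨i, rfl, rfl⟩ := bodyMap_eq_head hy (hq'.1.mv (List.mem_of_getLast? ha)) hax
      refine ⟨i, j, hj, q', hq', ha, m', ?_, by rw [e]⟩
      obtain ⟨q'', rfl⟩ := List.getLast?_eq_some_iff.1 ha
      rwa [← hq'.2.2 q'' i List.prefix_rfl j hj]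
  · rintro (⟨l', hl', rfl⟩ | ⟨i, j, hj, q, hq, hlast, m, hm, rfl⟩)
    · exact hl'.2.1
    · obtain ⟨q'', rfl⟩ := List.getLast?_eq_some_iff.1 hlast
      rw [← hq.2.2 q'' i List.prefix_rfl j hj] at hm
      exact hm.2

/-- Equality is possible, when no hypothesis played inside has arguments; the induction then relies
on the shorter conclusion. -/
theorem LW.ncard_body_le (h : LW (imps Γ (.box C)) L) (hy : ∀ i, tgt (Γ (y i)) = .box (B i))
    (hkey : KeyInj Γ y LU) : (bodyLang Γ y B C L LU).ncard ≤ L.ncard := by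
  refine Set.ncard_le_ncard_of_injOn (List.map (bodyMap Γ y)) (fun l hl => hl.2.1) ?_ h.fin
  intro l hl l' hl' e
  exact bodyLang_inj h hy hkey hl hl' e

end

/-! ## The shape of derivations -/

theorem imps_not_notImp {k : ℕ} (hk : 0 < k) (A : Fin k → Formula) (C : Formula) :
    ¬ (imps A C).NotImp := by
  obtain ⟨k, rfl⟩ := Nat.exists_eq_succ_of_ne_zero hk.ne'
  rw [imps_succ]
  exact fun h => h _ _ rfl

theorem atom_notImp (c : ℕ) : (Formula.atom c).NotImp := fun _ _ h => by simp at h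

theorem box_notImp (C : Formula) : (Formula.box C).NotImp := fun _ _ h => by simp at h

theorem imps_inj {k k' : ℕ} {A : Fin k → Formula} {A' : Fin k' → Formula} {C C' : Formula}
    (hC : C.NotImp) (hC' : C'.NotImp) (h : imps A C = imps A' C') :
    ∃ e : k = k', C = C' ∧ A = fun i => A' (Fin.cast e i) := by
  obtain ⟨h1, h2, h3⟩ := imps_spec A hC
  obtain ⟨h1', h2', h3'⟩ := imps_spec A' hC'
  rw [h] at h1 h2
  obtain rfl : k = k' := h1.symm.trans h1'
  refine ⟨rfl, h2.symm.trans h2', funext fun i => ?_⟩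
  rw [← h3, h, h3']; rfl

theorem Der.inv_atom {n : ℕ} {Γ : Fin n → Formula} {t : Tm n} {c : ℕ} {L : Set (List Vertex)}
    (d : Der Γ t (.atom c) L) : ∃ (y : Fin n) (U : ℕ → Tm n) (LU : ℕ → Set (List Vertex)),
      tgt (Γ y) = .atom c ∧ t = apps (.var y) (fun j : Fin (ar (Γ y)) => U j) ∧
      L = neutLang Γ y LU ∧ ∀ j < ar (Γ y), Der Γ (U j) (argF (Γ y) j) (LU j) := by
  cases d with
  | neut y c' U LU hy hT hD hL d => exact ⟨y, U, LU, by rw [hy, hD], hT, hL, d⟩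
  | lams k hk A M C hC hT hD d => exact absurd (atom_notImp c) (hD ▸ imps_not_notImp hk A C)
  | box => simp_all

theorem Der.inv_imps {n k : ℕ} {Γ : Fin n → Formula} {t : Tm n} {A : Fin k → Formula}
    {C : Formula} {L : Set (List Vertex)} (hk : 0 < k) (hC : C.NotImp)
    (d : Der Γ t (imps A C) L) : ∃ M, t = CKGame.lams k M ∧ Der (Fin.append Γ A) M C L := by
  cases d with
  | neut y c U LU hy hT hD hL d => exact absurd (atom_notImp c) (hD ▸ imps_not_notImp hk A C)
  | lams k' hk' A' M C' hC' hT hD d =>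
    obtain ⟨rfl, rfl, rfl⟩ := imps_inj hC hC' hD
    exact ⟨M, hT, d⟩
  | box k' M y B C' U LM LU hy hinj hM hT hD hL dM dU =>
    exact absurd (box_notImp C') (hD ▸ imps_not_notImp hk A C)

theorem Der.inv_box {n : ℕ} {Γ : Fin n → Formula} {t : Tm n} {C : Formula}
    {L : Set (List Vertex)} (d : Der Γ t (.box C) L) :
    ∃ (k : ℕ) (M : Tm k) (y : Fin k → Fin n) (B : Fin k → Formula) (U : Fin k → ℕ → Tm n)
      (LM : Set (List Vertex)) (LU : Fin k → ℕ → Set (List Vertex)),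
      (∀ i, tgt (Γ (y i)) = .box (B i)) ∧ (∀ i i', ar (Γ (y i)) = 0 → y i = y i' → i = i') ∧
      (∀ x, Occurs M x) ∧
      t = .esub M (fun i => apps (.var (y i)) (fun j : Fin (ar (Γ (y i))) => U i j)) ∧
      L = boxLang Γ y B LM LU ∧ Der B M C LM ∧
      ∀ i, ∀ j < ar (Γ (y i)), Der Γ (U i j) (argF (Γ (y i)) j) (LU i j) := by
  cases d with
  | neut => simp_all
  | lams k hk A M C' hC hT hD d => exact absurd (box_notImp C) (hD ▸ imps_not_notImp hk A C')
  | box k M y B C' U LM LU hy hinj hM hT hD hL dM dU =>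
    obtain rfl := Formula.box.inj hD
    exact ⟨k, M, y, B, U, LM, LU, hy, hinj, hM, hT, hL, dM, dU⟩

theorem neutLang_congr {n : ℕ} {Γ : Fin n → Formula} {y : Fin n} {LU LU' : ℕ → Set (List Vertex)}
    (h : ∀ j < ar (Γ y), LU j = LU' j) : neutLang Γ y LU = neutLang Γ y LU' := by
  have : ∀ {LU LU' : ℕ → Set (List Vertex)}, (∀ j < ar (Γ y), LU j = LU' j) →
      neutLang Γ y LU ⊆ neutLang Γ y LU' := by
    rintro LU LU' h l (hl | ⟨j, hj, m, hm, rfl⟩)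
    · exact .inl hl
    · exact .inr ⟨j, hj, m, h j hj ▸ hm, rfl⟩
  exact (this h).antisymm (this fun j hj => (h j hj).symm)

theorem boxLang_congr {n k : ℕ} {Γ : Fin n → Formula} {y : Fin k → Fin n} {B : Fin k → Formula}
    {LM : Set (List Vertex)} {LU LU' : Fin k → ℕ → Set (List Vertex)}
    (h : ∀ i, ∀ j < ar (Γ (y i)), LU i j = LU' i j) :
    boxLang Γ y B LM LU = boxLang Γ y B LM LU' := by
  have : ∀ {LU LU' : Fin k → ℕ → Set (List Vertex)},
      (∀ i, ∀ j < ar (Γ (y i)), LU i j = LU' i j) →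
      boxLang Γ y B LM LU ⊆ boxLang Γ y B LM LU' := by
    rintro LU LU' h l (hl | ⟨i, j, hj, q, hq, hlast, m, hm, rfl⟩)
    · exact .inl hl
    · exact .inr ⟨i, j, hj, q, hq, hlast, m, h i j hj ▸ hm, rfl⟩
  exact (this h).antisymm (this fun i j hj => (h i j hj).symm)

theorem bodyLang_congr {n k : ℕ} {Γ : Fin n → Formula} {y : Fin k → Fin n} {B : Fin k → Formula}
    {C : Formula} {L : Set (List Vertex)} {LU LU' : Fin k → ℕ → Set (List Vertex)}
    (h : ∀ i, ∀ j < ar (Γ (y i)), LU i j = LU' i j) :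
    bodyLang Γ y B C L LU = bodyLang Γ y B C L LU' := by
  ext l
  constructor
  · rintro ⟨h1, h2, h3⟩
    exact ⟨h1, h2, fun l' i hp j hj => (h3 l' i hp j hj).trans (h i j hj)⟩
  · rintro ⟨h1, h2, h3⟩
    exact ⟨h1, h2, fun l' i hp j hj => (h3 l' i hp j hj).trans (h i j hj).symm⟩

/-- The language is determined by the typed term. -/
theorem Der.lang_unique {n : ℕ} {Γ : Fin n → Formula} {t : Tm n} {C : Formula}
    {L L' : Set (List Vertex)} (d : Der Γ t C L) (d' : Der Γ t C L') : L = L' := by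
  induction d generalizing L' with
  | neut y c U LU hy hT hD hL d ih =>
    subst hD hT hL
    obtain ⟨y', U', LU', hy', hT', rfl, d''⟩ := d'.inv_atom
    obtain ⟨rfl, _, h⟩ := apps_var_inj hT'
    refine neutLang_congr fun j hj => ih j hj ?_
    rw [show U j = U' j from h ⟨j, hj⟩]
    exact d'' j hj
  | lams k hk A M C hC hT hD d ih =>
    subst hD hT
    obtain ⟨M', hT', d'⟩ := d'.inv_imps hk hC
    rw [← lams_inj hT'] at d'
    exact ih d'
  | box k M y B C U LM LU hy hinj hM hT hD hL dM dU ihM ihU =>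
    subst hD hT hL
    obtain ⟨k', M', y', B', U', LM', LU', hy', hinj', hM', hT', rfl, dM', dU'⟩ := d'.inv_box
    injection hT' with _ hk h1 h2
    subst hk
    obtain rfl := eq_of_heq h1
    have h3 := fun i => apps_var_inj (congrFun (eq_of_heq h2) i)
    obtain rfl : y = y' := funext fun i => (h3 i).1
    obtain rfl : B = B' := funext fun i => by simpa using (hy i).symm.trans (hy' i)
    rw [ihM dM']
    refine boxLang_congr fun i j hj => ihU i j hj ?_
    rw [show U i j = U' i j from (h3 i).2.2 ⟨j, hj⟩]
    exact dU' i j hj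

theorem Der.pre {n : ℕ} {Γ : Fin n → Formula} {t : Tm n} {C : Formula} {L : Set (List Vertex)}
    (d : Der Γ t C L) : ∀ l v, l ++ [v] ∈ L → l ∈ L := by
  induction d with
  | neut y c U LU hy hT hD hL d ih =>
    subst hL
    rintro l v (hl | ⟨j, hj, m, hm, e⟩)
    · rcases hl with hl | hl | hl
      · simp at hl
      · obtain ⟨rfl, _⟩ := List.append_inj' (s₁ := l) (s₂ := []) hl rfl
        exact .inl (.inl rfl)
      · obtain ⟨rfl, _⟩ := List.append_inj' (s₁ := l) (s₂ := [_]) hl rfl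
        exact .inl (.inr (.inl rfl))
    · rcases List.eq_nil_or_concat' m with rfl | ⟨m, u, rfl⟩
      · obtain ⟨rfl, _⟩ := List.append_inj' (s₁ := l) (s₂ := [_]) e rfl
        exact .inl (.inr (.inl rfl))
      · rw [List.map_append, ← List.append_assoc] at e
        obtain ⟨rfl, _⟩ := List.append_inj' e rfl
        exact .inr ⟨j, hj, m, ih j hj m u hm, rfl⟩
  | lams k hk A M C hC hT hD d ih => exact ih
  | @box n Γ T D L k M y B C U LM LU hy hinj hM hT hD hL dM dU ihM ihU =>
    subst hL
    have himg : ∀ l v q, q ∈ LM → l ++ [v] = q.map (bodyMap Γ y) →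
        l ∈ boxLang Γ y B LM LU := by
      intro l v q hq e
      rcases List.eq_nil_or_concat' q with rfl | ⟨q, u, rfl⟩
      · simp at e
      · rw [List.map_append] at e
        obtain ⟨rfl, _⟩ := List.append_inj' e rfl
        exact .inl ⟨q, ihM q u hq, rfl⟩
    rintro l v (⟨q, hq, e⟩ | ⟨i, j, hj, q, hq, hlast, m, hm, e⟩)
    · exact himg l v q hq e.symm
    · rcases List.eq_nil_or_concat' m with rfl | ⟨m, u, rfl⟩
      · exact himg l v q hq (by simpa using e)
      · rw [List.map_append, ← List.append_assoc] at e
        obtain ⟨rfl, _⟩ := List.append_inj' e rfl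
        exact .inr ⟨i, j, hj, q, hq, hlast, m, ihU i j hj m u hm, rfl⟩

/-! ## Sequences in the language of an explicit substitution -/

theorem not_inside_arg {n : ℕ} {Γ : Fin n → Formula} {y : Fin n} {j : ℕ} (hj : j < ar (Γ y))
    (w : Vertex) : ¬ Inside Γ (hypV y (hypV j w)) := by
  rintro (⟨w, e⟩ | ⟨x, w, B, _, e⟩)
  · exact hypV_ne_conV y.2 _ _ e
  · obtain ⟨e1, e2⟩ := hypV_inj.1 e
    obtain rfl := Fin.ext e1
    exact hypV_ne_conV hj _ _ e2

theorem map_argMap_head {n : ℕ} {Γ : Fin n → Formula} {y : Fin n} {j : ℕ} {m : List Vertex}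
    (hm : Struct (imps Γ (argF (Γ y) j)) m) : m = [] ∨
      ∃ m', m.map (argMap n y j) = hypV y (hypV j (headV (argF (Γ y) j))) :: m' := by
  rcases m with _ | ⟨v, m⟩
  · exact .inl rfl
  · right
    rw [hm.head, List.map_cons, headV_argMap]
    exact ⟨_, rfl⟩

theorem inside_split_unique {n : ℕ} {Γ : Fin n → Formula} {q q' m m' : List Vertex}
    {v v' : Vertex} (h : q ++ v :: m = q' ++ v' :: m') (hq : ∀ u ∈ q, Inside Γ u)
    (hq' : ∀ u ∈ q', Inside Γ u) (hv : ¬ Inside Γ v) (hv' : ¬ Inside Γ v') :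
    q = q' ∧ v :: m = v' :: m' := by
  induction q generalizing q' with
  | nil =>
    cases q' with
    | nil => exact ⟨rfl, h⟩
    | cons a q' =>
      obtain ⟨rfl, _⟩ := List.cons.inj h
      exact absurd (hq' _ (by simp)) hv
  | cons a q ih =>
    cases q' with
    | nil =>
      obtain ⟨rfl, _⟩ := List.cons.inj h
      exact absurd (hq _ (by simp)) hv'
    | cons a' q' =>
      obtain ⟨rfl, h1⟩ := List.cons.inj h
      obtain ⟨rfl, h2⟩ := ih h1 (fun u hu => hq u (by simp [hu])) fun u hu => hq' u (by simp [hu])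
      exact ⟨rfl, h2⟩

section
variable {n k : ℕ} {Γ : Fin n → Formula} {y : Fin k → Fin n} {B : Fin k → Formula} {C : Formula}
  {LM : Set (List Vertex)} {LU : Fin k → ℕ → Set (List Vertex)}

theorem map_bodyMap_inside (hy : ∀ i, tgt (Γ (y i)) = .box (B i)) {q : List Vertex}
    (hq : Struct (imps B C) q) : ∀ v ∈ q.map (bodyMap Γ y), Inside Γ v := by
  intro v hv
  obtain ⟨u, hu, rfl⟩ := List.mem_map.1 hv
  exact inside_bodyMap hy (hq.mv hu)

theorem boxLang_inside (hLU : ∀ i, ∀ j < ar (Γ (y i)), ∀ m ∈ LU i j,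
      Struct (imps Γ (argF (Γ (y i)) j)) m) {l : List Vertex} (hl : l ∈ boxLang Γ y B LM LU)
    (hin : ∀ v ∈ l, Inside Γ v) : ∃ q ∈ LM, l = q.map (bodyMap Γ y) := by
  rcases hl with ⟨q, hq, rfl⟩ | ⟨i, j, hj, q, hq, hlast, m, hm, rfl⟩
  · exact ⟨q, hq, rfl⟩
  · rcases map_argMap_head (hLU i j hj m hm) with rfl | ⟨m', e⟩
    · exact ⟨q, hq, by simp⟩
    · exact absurd (hin (hypV (y i) (hypV j (headV (argF (Γ (y i)) j)))) (by simp [e]))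
        (not_inside_arg hj _)

/-- Views of the body are entirely inside and the opening move of an argument is not, so the first
move that is not inside marks the place of the graft. -/
theorem boxLang_outside (hy : ∀ i, tgt (Γ (y i)) = .box (B i))
    (hLM : ∀ l ∈ LM, Struct (imps B C) l)
    (hLU : ∀ i, ∀ j < ar (Γ (y i)), ∀ m ∈ LU i j, Struct (imps Γ (argF (Γ (y i)) j)) m)
    {q m : List Vertex} {v : Vertex} (hl : q ++ v :: m ∈ boxLang Γ y B LM LU)
    (hin : ∀ v ∈ q, Inside Γ v) (hv : ¬ Inside Γ v) :
    ∃ (i : Fin k) (j : ℕ), j < ar (Γ (y i)) ∧ v = hypV (y i) (hypV j (headV (argF (Γ (y i)) j))) ∧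
      ∃ q' ∈ LM, q'.getLast? = some (hypV i (headV (B i))) ∧ q = q'.map (bodyMap Γ y) ∧
      ∃ m' ∈ LU i j, v :: m = m'.map (argMap n (y i) j) := by
  rcases hl with ⟨q', hq', e⟩ | ⟨i, j, hj, q', hq', hlast, m', hm', e⟩
  · exact absurd (map_bodyMap_inside hy (hLM q' hq') v (by rw [e]; simp)) hv
  · rcases map_argMap_head (hLU i j hj m' hm') with rfl | ⟨m'', e'⟩
    · rw [List.map_nil, List.append_nil] at e
      exact absurd (map_bodyMap_inside hy (hLM q' hq') v (by rw [← e]; simp)) hv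
    · rw [e'] at e
      obtain ⟨h1, h2⟩ := inside_split_unique e hin (map_bodyMap_inside hy (hLM q' hq')) hv
        (not_inside_arg hj _)
      exact ⟨i, j, hj, (List.cons.inj h2).1, q', hq', hlast, h1, m', hm', by rw [e', h2]⟩

end

theorem argMap_eq_hyp_head {n : ℕ} {Γ : Fin n → Formula} {y : Fin n} {j : ℕ}
    (hj : j < ar (Γ y)) {v : Vertex} (hv : Mv (imps Γ (argF (Γ y) j)) v) {x : Fin n}
    (h : argMap n y j v = hypV x (headV (Γ x))) : v = hypV x (headV (Γ x)) := by
  rcases hv.cases with ⟨w, rfl, _⟩ | ⟨i, w, rfl, _⟩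
  · rw [argMap_conV] at h
    obtain ⟨e1, e2⟩ := hypV_inj.1 h
    obtain rfl := Fin.ext e1
    rw [headV_tgt] at e2
    exact absurd e2 (hypV_ne_conV hj _ _)
  · rwa [argMap_hypV] at h

/-- If moves are not repeated, the next hypothesis played is determined. -/
theorem Der.next_hyp {n : ℕ} {Γ : Fin n → Formula} {t : Tm n} {C : Formula}
    {L : Set (List Vertex)} (d : Der Γ t C L) (hnd : ∀ l ∈ L, l.Nodup) :
    ∀ (l : List Vertex) (x x' : Fin n), l ++ [hypV x (headV (Γ x))] ∈ L →
      l ++ [hypV x' (headV (Γ x'))] ∈ L → x = x' := by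
  have harg : ∀ {n : ℕ} {Γ : Fin n → Formula} {y : Fin n} {j : ℕ} {m l : List Vertex} {x : Fin n},
      j < ar (Γ y) → Struct (imps Γ (argF (Γ y) j)) m →
      m.map (argMap n y j) = l ++ [hypV x (headV (Γ x))] →
      ∃ m₀, m = m₀ ++ [hypV x (headV (Γ x))] ∧ l = m₀.map (argMap n y j) := by
    intro n Γ y j m l x hj hm e
    rcases List.eq_nil_or_concat' m with rfl | ⟨m, u, rfl⟩
    · simp at e
    · rw [List.map_append] at e
      obtain ⟨rfl, e2⟩ := List.append_inj' e rfl
      rw [argMap_eq_hyp_head hj (hm.mv (by simp)) (List.cons.inj e2).1]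
      exact ⟨m, rfl, rfl⟩
  induction d with
  | @neut n Γ T D L y c U LU hy hT hD hL d ih =>
    subst hD hL
    have hs := fun j hj => (d j hj).struct
    have key : ∀ (l : List Vertex) (x : Fin n), l ++ [hypV x (headV (Γ x))] ∈ neutLang Γ y LU →
        (l = [conV n []] ∧ x = y) ∨ ∃ j < ar (Γ y), ∃ m, m ++ [hypV x (headV (Γ x))] ∈ LU j ∧
          l = [conV n [], hypV y (headV (Γ y))] ++ m.map (argMap n y j) := by
      rintro l x ((hl | hl | hl) | ⟨j, hj, m, hm, e⟩)
      · simp at hl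
      · obtain ⟨rfl, h⟩ := List.append_inj' (s₁ := l) (s₂ := []) hl rfl
        exact absurd (List.cons.inj h).1 (hypV_ne_conV x.2 _ _)
      · obtain ⟨rfl, h⟩ := List.append_inj' (s₁ := l) (s₂ := [_]) hl rfl
        exact .inl ⟨rfl, Fin.ext (hypV_inj.1 (List.cons.inj h).1).1⟩
      · rcases List.eq_nil_or_concat' m with rfl | ⟨m, u, rfl⟩
        · obtain ⟨rfl, h⟩ := List.append_inj' (s₁ := l) (s₂ := [_]) e rfl
          exact .inl ⟨rfl, Fin.ext (hypV_inj.1 (List.cons.inj h).1).1⟩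
        · rw [List.map_append, ← List.append_assoc] at e
          obtain ⟨rfl, e2⟩ := List.append_inj' e rfl
          have := argMap_eq_hyp_head hj ((hs j hj _ hm).mv (by simp)) (List.cons.inj e2).1.symm
          exact .inr ⟨j, hj, m, this ▸ hm, rfl⟩
    intro l x x' hx hx'
    have hne : ∀ {j : ℕ} {m : List Vertex} {x : Fin n}, j < ar (Γ y) →
        m ++ [hypV x (headV (Γ x))] ∈ LU j → m ≠ [] := by
      rintro j m x hj hm rfl
      have := (hs j hj _ hm).head
      rw [headV_imps] at this
      exact hypV_ne_conV x.2 _ _ this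
    rcases key l x hx with ⟨rfl, rfl⟩ | ⟨j, hj, m, hm, rfl⟩
    · rcases key _ x' hx' with ⟨_, rfl⟩ | ⟨j, hj, m, hm, e⟩
      · rfl
      · simp at e
    · rcases key _ x' hx' with ⟨e, _⟩ | ⟨j', hj', m', hm', e⟩
      · simp at e
      · have e := List.append_cancel_left e
        have hn := hnd _ (.inr ⟨j, hj, _, hm, rfl⟩)
        have hs1 := (hs j hj _ hm).pre
        have hs2 := (hs j' hj' _ hm').pre
        obtain ⟨m1, h1⟩ := (map_argMap_head hs1).resolve_left (hne hj hm)
        obtain ⟨m2, h2⟩ := (map_argMap_head hs2).resolve_left (hne hj' hm')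
        have e3 := e
        rw [h1, h2] at e3
        obtain rfl := (hypV_inj.1 (hypV_inj.1 (List.cons.inj e3).1).2).1
        obtain rfl := map_argMap_inj (p := [conV n [], hypV y (headV (Γ y))]) (by simp) (by
          rw [List.map_append, ← List.append_assoc] at hn
          exact (List.nodup_append.1 hn).1) hs1 hs2 e
        exact ih j hj (fun m hm => (List.Nodup.of_map _
          (List.nodup_append.1 (hnd _ (.inr ⟨j, hj, m, hm, rfl⟩))).2.1)) m x x' hm hm'
  | @lams n Γ T D L k hk A M C hC hT hD d ih =>
    intro l x x' hx hx'
    have := ih hnd l (Fin.castAdd k x) (Fin.castAdd k x') (by simpa using hx) (by simpa using hx')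
    simpa using this
  | @box n Γ T D L k M y B C U LM LU hy hinj hM hT hD hL dM dU ihM ihU =>
    subst hL
    have hLM := dM.struct
    have hLU : ∀ i, ∀ j < ar (Γ (y i)), ∀ m ∈ LU i j, Struct (imps Γ (argF (Γ (y i)) j)) m :=
      fun i j hj => (dU i j hj).struct
    have ihM := ihM fun l hl => List.Nodup.of_map _ (hnd _ (.inl ⟨l, hl, rfl⟩))
    -- Nothing is assumed here about the strategy of the body; the induction hypothesis for the body
    -- already says which of its hypotheses comes next, and this is enough for `bodyMap` to be
    -- injective.
    have minj : ∀ {q q' : List Vertex}, q ∈ LM → q' ∈ LM →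
        q.map (bodyMap Γ y) = q'.map (bodyMap Γ y) → q = q' := fun hq hq' e =>
      bodyMap_map_inj hy dM.pre hLM (fun l hl => hnd _ (.inl ⟨l, hl, rfl⟩))
        (fun l i i' h h' _ => ihM l i i' h h') hq hq' e
    have key : ∀ (l : List Vertex) (x : Fin n), (∀ v ∈ l, Inside Γ v) →
        l ++ [hypV x (headV (Γ x))] ∈ boxLang Γ y B LM LU →
        ∃ (q : List Vertex) (i : Fin k), q ++ [hypV i (headV (B i))] ∈ LM ∧
          l = q.map (bodyMap Γ y) ∧ y i = x := by
      intro l x hin hx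
      by_cases hh : Inside Γ (hypV x (headV (Γ x)))
      · obtain ⟨q, hq, e⟩ := boxLang_inside hLU hx (by
          intro v hv
          rcases List.mem_append.1 hv with hv | hv
          · exact hin v hv
          · rwa [List.mem_singleton.1 hv])
        rcases List.eq_nil_or_concat' q with rfl | ⟨q, u, rfl⟩
        · simp at e
        · rw [List.map_append] at e
          obtain ⟨rfl, e2⟩ := List.append_inj' e rfl
          obtain ⟨i, rfl, rfl⟩ := bodyMap_eq_head hy ((hLM _ hq).mv (by simp))
            (List.cons.inj e2).1.symm
          exact ⟨q, i, hq, rfl, rfl⟩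
      · obtain ⟨i, j, hj, e, _⟩ := boxLang_outside hy hLM hLU hx hin hh
        obtain ⟨e1, e2⟩ := hypV_inj.1 e
        obtain rfl := Fin.ext e1
        rw [headV_tgt] at e2
        exact absurd e2.symm (hypV_ne_conV hj _ _)
    intro l x x' hx hx'
    rcases exists_inside_split (Γ := Γ) l with hin | ⟨q, v, m, rfl, hin, hv⟩
    · obtain ⟨q, i, hq, rfl, rfl⟩ := key l x hin hx
      obtain ⟨q', i', hq', e, rfl⟩ := key _ x' hin hx'
      obtain rfl := minj (dM.pre _ _ hq) (dM.pre _ _ hq') e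
      rw [ihM _ _ _ hq hq']
    · rw [List.append_assoc, List.cons_append] at hx hx'
      obtain ⟨i, j, hj, ev, q₁, hq₁, hlast, rfl, m₁, hm₁, e₁⟩ :=
        boxLang_outside hy hLM hLU hx hin hv
      obtain ⟨i', j', hj', ev', q₂, hq₂, hlast', e, m₂, hm₂, e₂⟩ :=
        boxLang_outside hy hLM hLU hx' hin hv
      obtain rfl := minj hq₁ hq₂ e
      rw [hlast, Option.some_inj] at hlast'
      obtain rfl := Fin.ext (hypV_inj.1 hlast').1
      rw [ev] at ev'
      obtain rfl := (hypV_inj.1 (hypV_inj.1 ev').2).1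
      rw [← List.cons_append] at e₁ e₂
      obtain ⟨m₁, rfl, h₁⟩ := harg hj (hLU i j hj _ hm₁) e₁.symm
      obtain ⟨m₂, rfl, h₂⟩ := harg hj (hLU i j hj _ hm₂) e₂.symm
      have hn := hnd _ (.inr ⟨i, j, hj, q₁, hq₁, hlast, _, hm₁, rfl⟩)
      obtain rfl := map_argMap_inj (p := q₁.map (bodyMap Γ y)) (by
          rw [← bodyMap_head hy]
          exact List.mem_map_of_mem (List.mem_of_getLast? hlast)) (by
          rw [List.map_append, ← List.append_assoc] at hn
          exact (List.nodup_append.1 hn).1) (hLU i j hj _ hm₁).pre (hLU i j hj _ hm₂).pre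
          (h₁.symm.trans h₂)
      exact ihU i j hj (fun m hm => (List.Nodup.of_map _
        (List.nodup_append.1 (hnd _ (.inr ⟨i, j, hj, q₁, hq₁, hlast, m, hm, rfl⟩))).2.1))
        m₁ x x' hm₁ hm₂

/-! ## Canonicity -/

section
variable {n k : ℕ} {Γ : Fin n → Formula} {y : Fin k → Fin n} {B : Fin k → Formula} {C : Formula}
  {M : Tm k} {U : Fin k → ℕ → Tm n} {L LM : Set (List Vertex)}
  {LU : Fin k → ℕ → Set (List Vertex)}

/-- The graft point and the view of the body before it are determined by the sequence, so the
continuations found in `L` come from the `i`-th argument and from no other. The languages `LU` are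
thus intrinsic to `L`. -/
theorem boxLang_argLang (hy : ∀ i, tgt (Γ (y i)) = .box (B i)) (dM : Der B M C LM)
    (dU : ∀ i, ∀ j < ar (Γ (y i)), Der Γ (U i j) (argF (Γ (y i)) j) (LU i j))
    (hL : L = boxLang Γ y B LM LU) (hnd : ∀ l ∈ L, l.Nodup) {q : List Vertex} {i : Fin k}
    (hq : q ∈ LM) (hlast : q.getLast? = some (hypV i (headV (B i)))) {j : ℕ}
    (hj : j < ar (Γ (y i))) : argLang Γ L (q.map (bodyMap Γ y)) (y i) j = LU i j := by
  subst hL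
  have hLM := dM.struct
  have hLU : ∀ i, ∀ j < ar (Γ (y i)), ∀ m ∈ LU i j, Struct (imps Γ (argF (Γ (y i)) j)) m :=
    fun i j hj => (dU i j hj).struct
  have hdet := dM.next_hyp fun l hl => List.Nodup.of_map _ (hnd _ (.inl ⟨l, hl, rfl⟩))
  ext l
  constructor
  · rintro ⟨hs, hl⟩
    rcases map_argMap_head hs with rfl | ⟨l', e⟩
    · exact (dU i j hj).nil_mem_and_init_mem.1
    · have hl2 := hl
      rw [e] at hl2
      obtain ⟨i', j', hj', ev, q', hq', hlast', eq, m, hm, em⟩ := boxLang_outside hy hLM hLU hl2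
        (map_bodyMap_inside hy (hLM q hq)) (not_inside_arg hj _)
      obtain rfl := bodyMap_map_inj hy dM.pre hLM (fun l hl => hnd _ (.inl ⟨l, hl, rfl⟩))
        (fun l i i' h h' _ => hdet l i i' h h') hq hq' eq
      rw [hlast, Option.some_inj] at hlast'
      obtain rfl := Fin.ext (hypV_inj.1 hlast').1
      obtain rfl := (hypV_inj.1 (hypV_inj.1 ev).2).1
      rw [← e] at em
      obtain rfl := map_argMap_inj (p := q.map (bodyMap Γ y)) (by
        rw [← bodyMap_head hy]
        exact List.mem_map_of_mem (List.mem_of_getLast? hlast)) (hnd _ hl) hs (hLU i j hj m hm) em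
      exact hm
  · intro hl
    exact ⟨hLU i j hj l hl, .inr ⟨i, j, hj, q, hq, hlast, l, hl, rfl⟩⟩

theorem boxLang_covers (hy : ∀ i, tgt (Γ (y i)) = .box (B i)) (dM : Der B M C LM)
    (dU : ∀ i, ∀ j < ar (Γ (y i)), Der Γ (U i j) (argF (Γ (y i)) j) (LU i j))
    (hL : L = boxLang Γ y B LM LU) (hnd : ∀ l ∈ L, l.Nodup) : Covers Γ y L LU := by
  intro q hq hin x hlast
  have hq' := hq
  rw [hL] at hq'
  obtain ⟨q, hqM, rfl⟩ := boxLang_inside (fun i j hj => (dU i j hj).struct) hq' hin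
  rw [List.getLast?_map, Option.map_eq_some_iff] at hlast
  obtain ⟨a, ha, e⟩ := hlast
  obtain ⟨i, rfl, rfl⟩ := bodyMap_eq_head hy ((dM.struct q hqM).mv (List.mem_of_getLast? ha)) e
  exact ⟨i, rfl, fun j hj => boxLang_argLang hy dM dU hL hnd hqM ha hj⟩

/-- A view of `bodyLang` has an inside image in `L`, which is also the image of a view of `LM`. The
two agree by injectivity on `bodyLang`, so `LM` depends only on `L` and on the languages of the
arguments. -/
theorem boxLang_body (hy : ∀ i, tgt (Γ (y i)) = .box (B i)) (dM : Der B M C LM)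
    (dU : ∀ i, ∀ j < ar (Γ (y i)), Der Γ (U i j) (argF (Γ (y i)) j) (LU i j))
    (hL : L = boxLang Γ y B LM LU) (h : LW (imps Γ (.box C)) L) (hkey : KeyInj Γ y LU) :
    LM = bodyLang Γ y B C L LU := by
  have hpre : ∀ q m, q ++ m ∈ LM → q ∈ LM := by
    intro q m
    induction m using List.reverseRecOn with
    | nil => simp
    | append_singleton m v ih => intro hm; exact ih (dM.pre _ v (by simpa using hm))
  have hsub : LM ⊆ bodyLang Γ y B C L LU := by
    intro l hl
    refine ⟨dM.struct l hl, hL ▸ .inl ⟨l, hl, rfl⟩, ?_⟩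
    rintro l' i ⟨r, rfl⟩ j hj
    exact boxLang_argLang hy dM dU hL h.nodup (hpre _ _ hl) (by simp) hj
  refine hsub.antisymm fun l hl => ?_
  have hl' := hl.2.1
  rw [hL] at hl'
  obtain ⟨q, hq, e⟩ := boxLang_inside (fun i j hj => (dU i j hj).struct) hl'
    (map_bodyMap_inside hy hl.1)
  rwa [bodyLang_inj h hy hkey hl (hsub hq) e]

/-- The hypotheses and the languages of the arguments of an explicit substitution come from views
that stay in the scope of the box. -/
theorem boxLang_key (hy : ∀ i, tgt (Γ (y i)) = .box (B i)) (dM : Der B M C LM)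
    (dU : ∀ i, ∀ j < ar (Γ (y i)), Der Γ (U i j) (argF (Γ (y i)) j) (LU i j))
    (hL : L = boxLang Γ y B LM LU) (hnd : ∀ l ∈ L, l.Nodup) (hM : ∀ x, Occurs M x) (i : Fin k) :
    ∃ q ∈ L, (∀ v ∈ q, Inside Γ v) ∧ q.getLast? = some (hypV (y i) (headV (Γ (y i)))) ∧
      ∀ j < ar (Γ (y i)), argLang Γ L q (y i) j = LU i j := by
  obtain ⟨q, hq, hlast⟩ := dM.exists_last (hM i)
  refine ⟨q.map (bodyMap Γ y), hL ▸ .inl ⟨q, hq, rfl⟩, map_bodyMap_inside hy (dM.struct q hq), ?_,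
    fun j hj => boxLang_argLang hy dM dU hL hnd hq hlast hj⟩
  rw [List.getLast?_map, hlast, Option.map_some, bodyMap_head hy]

theorem boxLang_arg_lw (hy : ∀ i, tgt (Γ (y i)) = .box (B i)) (dM : Der B M C LM)
    (dU : ∀ i, ∀ j < ar (Γ (y i)), Der Γ (U i j) (argF (Γ (y i)) j) (LU i j))
    (hL : L = boxLang Γ y B LM LU) (h : LW (imps Γ (.box C)) L) (hM : ∀ x, Occurs M x)
    (i : Fin k) {j : ℕ} (hj : j < ar (Γ (y i))) :
    LW (imps Γ (argF (Γ (y i)) j)) (LU i j) ∧ (LU i j).ncard < L.ncard := by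
  obtain ⟨q, hq, hin, hlast, e⟩ := boxLang_key hy dM dU hL h.nodup hM i
  rw [← e j hj]
  exact ⟨(h.box_arg hq hin hlast hj).1, h.ncard_arg_lt hlast⟩

end

/-- The opening move of a continuation names the argument that it belongs to, so no other argument
contributes. -/
theorem neutLang_argLang {n : ℕ} {Γ : Fin n → Formula} {y : Fin n} {c : ℕ} {U : ℕ → Tm n}
    {L : Set (List Vertex)} {LU : ℕ → Set (List Vertex)}
    (dU : ∀ j < ar (Γ y), Der Γ (U j) (argF (Γ y) j) (LU j)) (hL : L = neutLang Γ y LU)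
    (h : LW (imps Γ (.atom c)) L) {j : ℕ} (hj : j < ar (Γ y)) :
    argLang Γ L [conV n [], hypV y (headV (Γ y))] y j = LU j := by
  subst hL
  have hLU := fun j hj => (dU j hj).struct
  ext l
  constructor
  · rintro ⟨hs, hl⟩
    rcases map_argMap_head hs with rfl | ⟨l', e⟩
    · exact (dU j hj).nil_mem_and_init_mem.1
    · rcases hl with (hl | hl | hl) | ⟨j', hj', m, hm, em⟩
      · simp at hl
      · simp at hl
      · simp [e] at hl
      · have em := List.append_cancel_left em
        rcases map_argMap_head (hLU j' hj' m hm) with rfl | ⟨m', e'⟩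
        · rw [e] at em; simp at em
        · rw [e, e'] at em
          obtain rfl := (hypV_inj.1 (hypV_inj.1 (List.cons.inj em).1).2).1
          rw [← e, ← e'] at em
          obtain rfl := map_argMap_inj (p := [conV n [], hypV y (headV (Γ y))]) (by simp)
            (h.nodup _ (.inr ⟨j, hj', m, hm, by rw [em]⟩)) hs (hLU j hj m hm) em
          exact hm
  · intro hl
    exact ⟨hLU j hj l hl, .inr ⟨j, hj, l, hl, rfl⟩⟩

theorem Sim.apps_var {n : ℕ} {Γ : Fin n → Formula} {y y' : Fin n} {U U' : ℕ → Tm n} (e : y = y')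
    (h : ∀ j < ar (Γ y), Sim (U j) (U' j)) :
    Sim (CKGame.apps (.var y) (fun j : Fin (ar (Γ y)) => U j))
      (CKGame.apps (.var y') (fun j : Fin (ar (Γ y')) => U' j)) := by
  subst e
  exact Sim.apps fun j => h j j.2

/-- A term in normal form is determined by its language. -/
theorem Der.canonical {n : ℕ} {Γ : Fin n → Formula} {t t' : Tm n} {C : Formula}
    {L : Set (List Vertex)} (d : Der Γ t C L) (d' : Der Γ t' C L) (h : LW (imps Γ C) L)
    (ht : Dst t) (ht' : Dst t') : Sim t t' := by
  induction d with
  | @neut n Γ T D L y c U LU hy hT hD hL d ih =>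
    subst hD hT
    obtain ⟨y', U', LU', hy', rfl, hL', d'⟩ := d'.inv_atom
    have e : y = y' := by
      have h1 : [conV n [], hypV y (headV (Γ y))] ∈ L := hL ▸ .inl (.inr (.inr rfl))
      have h2 : [conV n [], hypV y' (headV (Γ y'))] ∈ L := hL' ▸ .inl (.inr (.inr rfl))
      have h0 : [conV n []] ∈ L := h.pre [_] _ h1
      have := (h.player _ h0 (by simp)).unique h1 h2
      exact Fin.ext (hypV_inj.1 this).1
    subst e
    rw [dst_apps] at ht ht'
    refine Sim.apps_var rfl fun j hj => ?_
    have e1 := neutLang_argLang d hL h hj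
    have e2 := neutLang_argLang d' hL' h hj
    refine ih j hj (by rw [← e1, e2]; exact d' j hj) ?_ (ht ⟨j, hj⟩) (ht' ⟨j, hj⟩)
    rw [← e1]
    exact h.neut_arg (hL ▸ .inl (.inr (.inr rfl))) hj
  | lams k hk A M C hC hT hD d ih =>
    subst hD hT
    obtain ⟨M', rfl, d₂⟩ := d'.inv_imps hk hC
    rw [dst_lams] at ht ht'
    exact (ih d₂ (by rwa [imps_append]) ht ht').lams
  | @box n Γ T D L k M y B C U LM LU hy hinj hM hT hD hL dM dU ihM ihU =>
    subst hD hT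
    obtain ⟨k', M', y', B', U', LM', LU', hy', hinj', hM', rfl, hL', dM', dU'⟩ := d'.inv_box
    obtain ⟨htM, htN, htU⟩ := ht
    obtain ⟨htM', htN', htU'⟩ := ht'
    have hsim : ∀ {t' : Tm n} {L' : Set (List Vertex)} (i : Fin k) (j : ℕ), j < ar (Γ (y i)) →
        Der Γ t' (argF (Γ (y i)) j) L' → LU i j = L' → Dst t' → Sim (U i j) t' := by
      rintro t' L' i j hj d' rfl ht'
      exact ihU i j hj d' (boxLang_arg_lw hy dM dU hL h hM i hj).1 (dst_apps.1 (htN i) ⟨j, hj⟩) ht'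
    -- By induction, equal languages would give congruent arguments, against the distinctness in
    -- `t`.
    have hkey : KeyInj Γ y LU := by
      intro i i' e hU
      refine htU i i' (Sim.apps_var e fun j hj => ?_)
      exact hsim i j hj (e ▸ dU i' j (e ▸ hj)) (hU j hj) (dst_apps.1 (htN i') ⟨j, e ▸ hj⟩)
    have hcov := boxLang_covers hy dM dU hL h.nodup
    have hcov' := boxLang_covers hy' dM' dU' hL' h.nodup
    -- Both terms see the same heads, with the same argument languages, in the inside views of `L`;
    -- this matches the positions of the two substitutions.
    have hσ : ∀ i', ∃ i, y i = y' i' ∧ ∀ j < ar (Γ (y' i')), LU i j = LU' i' j := by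
      intro i'
      obtain ⟨q, hq, hin, hlast, e⟩ := boxLang_key hy' dM' dU' hL' h.nodup hM' i'
      obtain ⟨i, hi, hj⟩ := hcov q hq hin _ hlast
      exact ⟨i, hi, fun j hj' => by rw [← hj j hj', e j hj']⟩
    have hτ : ∀ i, ∃ i', y' i' = y i ∧ ∀ j < ar (Γ (y i)), LU' i' j = LU i j := by
      intro i
      obtain ⟨q, hq, hin, hlast, e⟩ := boxLang_key hy dM dU hL h.nodup hM i
      obtain ⟨i', hi, hj⟩ := hcov' q hq hin _ hlast
      exact ⟨i', hi, fun j hj' => by rw [← hj j hj', e j hj']⟩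
    choose σ hσy hσU using hσ
    choose τ hτy hτU using hτ
    have hsσ : ∀ i' j, j < ar (Γ (y' i')) → Sim (U (σ i') j) (U' i' j) := by
      intro i' j hj
      refine hsim (σ i') j (by rwa [hσy]) ?_ (hσU i' j hj) (dst_apps.1 (htN' i') ⟨j, hj⟩)
      rw [hσy]
      exact dU' i' j hj
    have hστ : ∀ i, σ (τ i) = i := by
      intro i
      refine hkey _ _ (by rw [hσy, hτy]) fun j hj => ?_
      rw [hσy] at hj
      rw [hσU _ j hj, hτU _ j (by rwa [← hτy])]
    -- The induction hypotheses concern only the arguments in `t`, so two arguments in `t'` are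
    -- compared through the one in `t` that corresponds to both.
    have hτσ : ∀ i', τ (σ i') = i' := by
      intro i'
      refine htU' _ _ (Sim.apps_var (by rw [hτy, hσy]) fun j hj => ?_)
      have := hsσ (τ (σ i')) j hj
      rw [hστ] at this
      exact this.symm.trans (hsσ i' j (by rwa [hτy, hσy] at hj))
    obtain rfl : k = k' := by
      simpa using Fintype.card_congr (⟨τ, σ, hστ, hτσ⟩ : Fin k ≃ Fin k')
    obtain ⟨π, hπ⟩ : ∃ π : Equiv.Perm (Fin k), ∀ i, π i = σ i := ⟨⟨σ, τ, hτσ, hστ⟩, fun _ => rfl⟩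
    refine .esub π ?_ fun i => ?_
    · obtain rfl : y = fun i => y' (π.symm i) := by
        funext i
        rw [← hσy, ← hπ, Equiv.apply_symm_apply]
      obtain rfl : B = fun i => B' (π.symm i) := by
        funext i
        simpa using (hy i).symm.trans (hy' (π.symm i))
      have dM'' := dM'.rename (Γ' := fun i => B' (π.symm i)) π.injective (by simp)
      have hL'' := boxLang_perm Γ y' B' LM' LU' π.symm
      rw [← hL', Equiv.symm_symm] at hL''
      have hUU : ∀ i, ∀ j < ar (Γ (y' (π.symm i))), LU i j = LU' (π.symm i) j := by
        intro i j hj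
        rw [← hσU _ _ hj, ← hπ, Equiv.apply_symm_apply]
      -- After renumbering by `π`, both bodies have the language computed from `L` and the common
      -- argument languages.
      have e1 := boxLang_body hy dM dU hL h hkey
      have e2 := boxLang_body hy dM'' (fun i j hj => dU' (π.symm i) j hj) hL''.symm h
        fun i i' e hj => hkey i i' e fun j hj' => by
          rw [hUU i j hj', hj j hj', hUU i' j (by rwa [← e])]
      rw [← bodyLang_congr hUU, ← e1] at e2
      rw [e2] at dM''
      have hlw : LW (imps (fun i => B' (π.symm i)) C) LM := by
        rw [e1]
        exact h.body hy hkey hcov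
      have := ihM dM'' hlw htM (htM'.rename (θ := π.symm) (by funext i; simp))
      have := this.rename π.symm
      rwa [rename_rename_of_inv (by funext i; simp)] at this
    · rw [hπ]
      exact Sim.apps_var (hσy i) fun j hj => hsσ i j (by rwa [← hσy])

/-! ## Existence -/

/-- A key is the head of a hypothesis played in an inside view, together with the languages of its
arguments after that view. Since `L` is finite there are finitely many keys, and numbering them
without repetitions gives `KeyInj` and `Covers`. -/
theorem exists_box_keys {n : ℕ} {Γ : Fin n → Formula} {C : Formula} {L : Set (List Vertex)}
    (h : LW (imps Γ (.box C)) L) :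
    ∃ (k : ℕ) (y : Fin k → Fin n) (B : Fin k → Formula) (LU : Fin k → ℕ → Set (List Vertex)),
      (∀ i, tgt (Γ (y i)) = .box (B i)) ∧ KeyInj Γ y LU ∧ Covers Γ y L LU ∧
      ∀ i, ∃ q ∈ L, (∀ v ∈ q, Inside Γ v) ∧ q.getLast? = some (hypV (y i) (headV (Γ (y i)))) ∧
        ∀ j < ar (Γ (y i)), argLang Γ L q (y i) j = LU i j := by
  classical
  -- The value `∅` beyond the arity makes two keys equal as soon as the languages of the actual
  -- arguments agree.
  let key : Fin n × List Vertex → Fin n × (ℕ → Set (List Vertex)) := fun a =>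
    (a.1, fun j => if j < ar (Γ a.1) then argLang Γ L a.2 a.1 j else ∅)
  let P : Set (Fin n × List Vertex) := {a | a.2 ∈ L ∧ (∀ v ∈ a.2, Inside Γ v) ∧
    a.2.getLast? = some (hypV a.1 (headV (Γ a.1)))}
  have hP : P.Finite :=
    (Set.finite_univ.prod h.fin).subset fun a ha => ⟨Set.mem_univ _, ha.1⟩
  have : Finite (key '' P) := hP.image key
  obtain ⟨k, ⟨e'⟩⟩ := Finite.exists_equiv_fin (key '' P)
  obtain ⟨e, -⟩ : ∃ e : Fin k ≃ key '' P, e = e'.symm := ⟨_, rfl⟩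
  have hk : ∀ i, ∃ q, ((e i).1.1, q) ∈ P ∧
      (e i).1.2 = fun j => if j < ar (Γ (e i).1.1) then argLang Γ L q (e i).1.1 j else ∅ := by
    intro i
    obtain ⟨a, ha, e1⟩ := (e i).2
    rw [← e1]
    exact ⟨a.2, ha, rfl⟩
  have hB : ∀ i, ∃ B, tgt (Γ (e i).1.1) = .box B := by
    intro i
    obtain ⟨q, ⟨hq, hin, hlast⟩, _⟩ := hk i
    rcases hin _ (List.mem_of_getLast? hlast) with ⟨w, e1⟩ | ⟨x, w, B, hB, e1⟩
    · exact absurd e1 (hypV_ne_conV (Fin.is_lt _) _ _)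
    · rw [Fin.ext (hypV_inj.1 e1).1]
      exact ⟨B, hB⟩
  choose B hB using hB
  refine ⟨k, fun i => (e i).1.1, B, fun i => (e i).1.2, hB, ?_, ?_, ?_⟩
  · intro i i' e1 e2
    refine e.injective (Subtype.ext (Prod.ext e1 (funext fun j => ?_)))
    by_cases hj : j < ar (Γ (e i).1.1)
    · exact e2 j hj
    · obtain ⟨q, _, h1⟩ := hk i
      obtain ⟨q', _, h2⟩ := hk i'
      rw [h1, h2]
      dsimp only at e1 ⊢
      rw [if_neg hj, if_neg (by rwa [← e1])]
  · intro q hq hin x hlast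
    obtain ⟨i, hi⟩ := e.surjective ⟨key (x, q), (x, q), ⟨hq, hin, hlast⟩, rfl⟩
    refine ⟨i, congrArg (fun a => a.1.1) hi, fun j hj => ?_⟩
    dsimp only
    rw [hi]
    exact (if_pos hj).symm
  · intro i
    obtain ⟨q, ⟨hq, hin, hlast⟩, e1⟩ := hk i
    refine ⟨q, hq, hin, hlast, fun j hj => ?_⟩
    dsimp only
    rw [e1]
    exact (if_pos hj).symm

/-- Each language of a strategy is the language of a term in normal form. -/
theorem exists_der {n : ℕ} {Γ : Fin n → Formula} {C : Formula} {L : Set (List Vertex)}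
    (h : LW (imps Γ C) L) : ∃ t, Dst t ∧ Der Γ t C L := by
  -- Lexicographic induction on the number of views and the size of the conclusion.
  suffices H : ∀ (N s : ℕ) {n : ℕ} {Γ : Fin n → Formula} {C : Formula} {L : Set (List Vertex)},
      LW (imps Γ C) L → L.ncard = N → C.size = s → ∃ t, Dst t ∧ Der Γ t C L from
    H _ _ h rfl rfl
  clear h
  intro N
  induction N using Nat.strong_induction_on with
  | _ N ihN =>
  intro s
  induction s using Nat.strong_induction_on with
  | _ s ihs =>
  intro n Γ C L h hN hs
  subst hN hs
  match C, h with
  | .atom c, h =>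
    obtain ⟨y, hy, hb⟩ := h.neut
    have : ∀ j, ∃ U, j < ar (Γ y) → Dst U ∧ Der Γ U (argF (Γ y) j)
        (argLang Γ L [conV n [], hypV y (headV (Γ y))] y j) := by
      intro j
      by_cases hj : j < ar (Γ y)
      · obtain ⟨U, hU⟩ := ihN _ (h.ncard_arg_lt rfl) _ (h.neut_arg hb hj) rfl rfl
        exact ⟨U, fun _ => hU⟩
      · exact ⟨.var y, fun hj' => absurd hj' hj⟩
    choose U hU using this
    exact ⟨_, dst_apps.2 fun j => (hU j j.2).1,
      .neut y c U _ hy rfl rfl (h.eq_neutLang hy hb) fun j hj => (hU j hj).2⟩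
  | .imp A B, h =>
    have hk : 0 < ar (Formula.imp A B) := Nat.succ_pos _
    have e := imps_tgt (.imp A B)
    rw [← e, ← imps_append] at h
    have hs := size_imps hk (fun j : Fin (ar (Formula.imp A B)) => argF (.imp A B) j)
      (tgt (.imp A B))
    rw [e] at hs
    obtain ⟨M, hM, d⟩ := ihs _ hs h rfl rfl
    exact ⟨lams _ M, dst_lams.2 hM, .lams _ hk _ M _ (tgt_notImp _) rfl e.symm d⟩
  | .box C, h =>
    obtain ⟨k, y, B, LU, hy, hkey, hcov, hq⟩ := exists_box_keys h
    have : ∀ i j, ∃ U, j < ar (Γ (y i)) → Dst U ∧ Der Γ U (argF (Γ (y i)) j) (LU i j) := by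
      intro i j
      by_cases hj : j < ar (Γ (y i))
      · obtain ⟨q, hq, hin, hlast, e⟩ := hq i
        obtain ⟨U, hU⟩ := ihN _ (h.ncard_arg_lt hlast) _ (h.box_arg hq hin hlast hj).1 rfl rfl
        rw [e j hj] at hU
        exact ⟨U, fun _ => hU⟩
      · exact ⟨.var (y i), fun hj' => absurd hj' hj⟩
    choose U hU using this
    have hb := h.body hy hkey hcov
    obtain ⟨M, hM, dM⟩ : ∃ M, Dst M ∧ Der B M C (bodyLang Γ y B C L LU) := by
      -- The body may have as many views as `L`, but then its conclusion is shorter.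
      rcases (h.ncard_body_le hy hkey).lt_or_eq with hlt | heq
      · exact ihN _ hlt _ hb rfl rfl
      · exact ihs C.size (Nat.lt_succ_self _) hb heq rfl
    refine ⟨.esub M fun i => apps (.var (y i)) fun j : Fin (ar (Γ (y i))) => U i j,
      ⟨hM, fun i => dst_apps.2 fun j => (hU i j j.2).1, fun i i' hii => ?_⟩,
      .box k M y B C U _ LU hy (fun i i' h0 e => hkey i i' e fun j hj => by omega) ?_ rfl rfl
        (h.eq_boxLang hy hcov) dM fun i j hj => (hU i j hj).2⟩
    -- Congruent arguments have the same head and the same languages, hence the same key.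
    · obtain ⟨N, e1, e2⟩ := hii.of_apps
      obtain ⟨e3, e4, e5⟩ := apps_var_inj e1
      refine hkey i i' e3.symm fun j hj => ?_
      have hj' : j < ar (Γ (y i')) := by rwa [e3]
      have := e2 ⟨j, hj⟩
      rw [← show U i' j = N ⟨j, hj⟩ from e5 ⟨j, hj'⟩] at this
      have d1 := (hU i j hj).2.sim this
      have d2 := (hU i' j hj').2
      rw [e3] at d2
      exact d1.lang_unique d2
    -- The key `i` comes from an inside view, which lifts to a view of the body ending with a bound
    -- hypothesis of the same key, that is, with `i`.
    · intro i
      obtain ⟨q, hq, hin, hlast, e⟩ := hq i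
      obtain ⟨l, hl, rfl⟩ := h.body_surj hy hcov hq hin
      rw [List.getLast?_map, Option.map_eq_some_iff] at hlast
      obtain ⟨a, ha, hax⟩ := hlast
      obtain ⟨i', rfl, e'⟩ := bodyMap_eq_head hy (hl.1.mv (List.mem_of_getLast? ha)) hax
      obtain ⟨l', rfl⟩ := List.getLast?_eq_some_iff.1 ha
      obtain rfl : i' = i := hkey _ _ e' fun j hj => by
        rw [← hl.2.2 l' i' List.prefix_rfl j hj, ← e j (by rwa [← e']), e']
      exact dM.occurs hl (List.mem_of_getLast? ha)

/-! ## Pointers of grafted sequences -/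

theorem hypV_append (y : ℕ) (v w : Vertex) : hypV y v ++ w = hypV y (v ++ w) := by
  simp [hypV]

theorem vs_mapMoves (g : Vertex → Vertex) (p : PSeq) : vs (mapMoves g p) = (vs p).map g := by
  simp [vs, mapMoves]

theorem mapMoves_mapMoves (g g' : Vertex → Vertex) (p : PSeq) :
    mapMoves g (mapMoves g' p) = mapMoves (g ∘ g') p := by
  simp [mapMoves]

theorem vs_graft (n y j b : ℕ) (p : PSeq) :
    vs (graft n (hypV y (hypV j [])) b p) = (vs p).map (argMap n y j) := by
  refine List.ext_getElem? fun t => ?_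
  rw [vs_getElem?, graft, List.getElem?_mapIdx, List.getElem?_map, vs_getElem?, Option.map_map,
    Option.map_map]
  congr 1
  funext s
  simp only [Function.comp_apply, argMap]
  cases splitV n s.1 with
  | inl a => rfl
  | inr v => simp [hypV_append]

theorem idxOf_map_of_nodup {g : Vertex → Vertex} {l : List Vertex} (h : (l.map g).Nodup)
    {u : Vertex} (hu : u ∈ l) : (l.map g).idxOf (g u) = l.idxOf u := by
  have hm := List.idxOf_lt_length_of_mem hu
  have := h.idxOf_getElem _ (by rwa [List.length_map])
  rwa [List.getElem_map, List.getElem_idxOf] at this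

theorem ptr_injective (F : Formula) : Function.Injective (ptr F) :=
  Function.LeftInverse.injective (vs_ptr F)

theorem ncard_ptr (F : Formula) (L : Set (List Vertex)) : (ptr F '' L).ncard = L.ncard :=
  Set.ncard_image_of_injective _ (ptr_injective F)

/-- The pointers prescribed by `graft` are the positions of the justifiers. Positions in `m` are
shifted by the length of `q`, except for the two justifiers that change in a graft: that of the
opening move, and those of the heads of hypotheses. -/
theorem ptr_graft {n : ℕ} {Γ : Fin n → Formula} {C : Formula} {y : Fin n} {j : ℕ}
    (hj : j < ar (Γ y)) {q m : List Vertex} (hq : Struct (imps Γ C) q)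
    (hlast : q.getLast? = some (hypV y (headV (Γ y))))
    (hm : Struct (imps Γ (argF (Γ y) j)) m) (hn : (q ++ m.map (argMap n y j)).Nodup) :
    ptr (imps Γ C) (q ++ m.map (argMap n y j)) = ptr (imps Γ C) q ++
      graft n (hypV y (hypV j [])) q.length (ptr (imps Γ (argF (Γ y) j)) m) := by
  obtain ⟨hnq, hnm, hdis⟩ := List.nodup_append.1 hn
  obtain ⟨q', rfl⟩ := List.getLast?_eq_some_iff.1 hlast
  have hq0 : (q' ++ [hypV y (headV (Γ y))]) ≠ [] := by simp
  have hqh : (q' ++ [hypV y (headV (Γ y))]).idxOf (headV (imps Γ C)) = 0 := by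
    cases h : q' ++ [hypV y (headV (Γ y))] with
    | nil => exact absurd h hq0
    | cons a l => rw [h] at hq; simp [hq.head]
  rw [ptr, List.map_append]
  congr 1
  · refine List.map_congr_left fun v hv => ?_
    rw [List.idxOf_append_of_mem (hq.par_mem hv)]
  · refine List.ext_getElem? fun t => ?_
    rw [graft, List.getElem?_mapIdx, getElem?_ptr, List.getElem?_map, List.getElem?_map]
    cases hv : m[t]? with
    | none => rfl
    | some v =>
      have hvm := List.mem_of_getElem? hv
      have hmv := hm.mv hvm
      have h0 : ∀ s, m[s]? = some (headV (imps Γ (argF (Γ y) j))) ↔ s = 0 := by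
        intro s
        have h00 : m[0]? = some (headV (imps Γ (argF (Γ y) j))) := by
          cases m with
          | nil => simp at hvm
          | cons a m => simp [hm.head]
        refine ⟨fun h => ?_, fun h => h ▸ h00⟩
        have hs : s < m.length := (List.getElem?_eq_some_iff.1 h).1
        exact (List.getElem?_inj hs (List.Nodup.of_map _ hnm)).1 (h.trans h00.symm)
      have hshift : ∀ {u}, u ∈ m →
          (q' ++ [hypV y (headV (Γ y))] ++ m.map (argMap n y j)).idxOf (argMap n y j u) =
          m.idxOf u + (q' ++ [hypV y (headV (Γ y))]).length := by
        intro u hu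
        rw [List.idxOf_append_of_notMem, idxOf_map_of_nodup hnm hu, Nat.add_comm]
        intro h
        exact hdis _ h _ (List.mem_map_of_mem hu) rfl
      simp only [Option.map_some, Option.some_inj]
      rcases hmv.cases with ⟨w, rfl, _⟩ | ⟨x, w, rfl, _⟩
      · simp only [splitV_conV]
        rw [argMap_conV, hypV_append, hypV_append, List.nil_append]
        -- The opening move of the argument points to the head of `y`, at position `q.length - 1`.
        by_cases ht : t = 0
        · rw [if_pos ht]
          have e := (h0 t).2 ht
          rw [hv, Option.some_inj] at e
          rw [← argMap_conV, e, par_argMap_head hj, List.idxOf_append_of_mem (by simp),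
            List.idxOf_append_of_notMem (fun h => by
              exact (List.nodup_append.1 hnq).2.2 _ h _ (by simp) rfl)]
          simp
        · rw [if_neg ht]
          have e : conV n w ≠ headV (imps Γ (argF (Γ y) j)) := fun e => ht ((h0 t).1 (e ▸ hv))
          rcases par_argMap (C := C) hj hmv e with ⟨⟨x, hx⟩, _⟩ | ⟨_, h2⟩
          · exact absurd hx.symm (hypV_ne_conV x.2 _ _)
          · rw [← argMap_conV, h2, hshift (hm.par_mem hvm)]
      · simp only [splitV_hypV]
        rw [argMap_hypV]
        have e : hypV x w ≠ headV (imps Γ (argF (Γ y) j)) := by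
          rw [headV_imps]; exact hypV_ne_conV x.2 _ _
        have hi := List.getElem?_idxOf (hm.par_mem hvm)
        -- A move in `Γ` had pointer `0` in `m` exactly when it is the head of a hypothesis; it is
        -- then redirected to position `0` of the whole sequence.
        rcases par_argMap (C := C) hj hmv e with ⟨_, h2, h3⟩ | ⟨h1, h2⟩
        · rw [argMap_hypV] at h2
          rw [h3] at hi ⊢
          rw [h2, if_pos ((h0 _).1 hi), List.idxOf_append_of_mem (hq.head_mem hq0), hqh]
        · rw [argMap_hypV] at h2
          rw [h2, hshift (hm.par_mem hvm), if_neg]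
          intro h
          rw [h, (h0 0).2 rfl, Option.some_inj, par_hypV, if_neg, headV_imps] at hi
          · exact hypV_ne_conV x.2 _ _ hi.symm
          · rintro rfl
            exact h1 ⟨x, rfl⟩

/-! ## Formulas without premises -/

theorem tgt_of_ar_zero {F : Formula} (h : ar F = 0) : tgt F = F := by
  cases F <;> simp_all [ar, tgt]

theorem apps_of_zero {n r : ℕ} (h : r = 0) (M : Tm n) (N : Fin r → Tm n) : apps M N = M := by
  subst h
  exact apps_zero M N

/-! ## `FCK`-derivations and their languages -/

theorem arity_of_eq {n k : ℕ} {Γ : Fin n → Formula} {y : Fin n} {A : Fin k → Formula}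
    {D : Formula} (hD : D.NotImp) (h : Γ y = imps A D) :
    ar (Γ y) = k ∧ tgt (Γ y) = D ∧ ∀ j : Fin k, argF (Γ y) j = A j := by
  rw [h]
  exact imps_spec A hD

theorem exists_args {n k : ℕ} {Γ : Fin n → Formula} {y : Fin n} {A : Fin k → Formula}
    {D : Formula} {N : Fin k → Tm n} {LN : Fin k → Set (List Vertex)} (hD : D.NotImp)
    (h : Γ y = imps A D) (d : ∀ i, Der Γ (N i) (A i) (LN i)) :
    ∃ (U : ℕ → Tm n) (LU : ℕ → Set (List Vertex)),
      apps (.var y) N = apps (.var y) (fun j : Fin (ar (Γ y)) => U j) ∧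
      (∀ j < ar (Γ y), Der Γ (U j) (argF (Γ y) j) (LU j)) ∧ ∀ i : Fin k, LU i = LN i := by
  obtain ⟨rfl, _, hA⟩ := arity_of_eq hD h
  have : Nonempty (Tm n) := ⟨.var y⟩
  obtain ⟨U, hU⟩ := exists_extend N
  obtain ⟨LU, hLU⟩ := exists_extend LN
  refine ⟨U, LU, by simp only [hU], fun j hj => ?_, hLU⟩
  rw [hU ⟨j, hj⟩, hLU ⟨j, hj⟩, hA ⟨j, hj⟩]
  exact d _

theorem headV_of_tgt_atom {n : ℕ} {Γ : Fin n → Formula} {y : Fin n} {c k : ℕ}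
    (h : tgt (Γ y) = .atom c) (hk : ar (Γ y) = k) : headV (Γ y) = conV k [] := by
  rw [headV_atom_tgt h, hk]

theorem headMap_castAdd {n m : ℕ} (f : Fin m → Fin n) (r : Fin m → ℕ) (x : Fin n) (w : Vertex) :
    headMap n f r (hypV (Fin.castAdd m x) w) = hypV x w := by
  rw [headMap, splitV_hypV]
  simp

theorem headMap_natAdd {n m : ℕ} (f : Fin m → Fin n) (r : Fin m → ℕ) (i : Fin m) (w : Vertex) :
    headMap n f r (hypV (Fin.natAdd n i) w) = hypV (f i) (conV (r i) w) := by
  rw [headMap, splitV_hypV]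
  simp [conV]

theorem headMap_conV {n m : ℕ} (f : Fin m → Fin n) (r : Fin m → ℕ) (w : Vertex) :
    headMap n f r (conV (n + m) w) = conV n w := by
  rw [headMap, splitV_conV]

theorem boxMap_eq_bodyMap {n k : ℕ} {Γ : Fin n → Formula} {y : Fin k → Fin n}
    (h : ∀ i, ar (Γ (y i)) = 0) : boxMap n y = bodyMap Γ y := by
  funext v
  rw [boxMap, bodyMap]
  cases splitV k v with
  | inl a => simp [h, conV]
  | inr w => rfl

theorem boxLang_of_ar_zero {n k : ℕ} {Γ : Fin n → Formula} {y : Fin k → Fin n}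
    {B : Fin k → Formula} {LM : Set (List Vertex)} {LU : Fin k → ℕ → Set (List Vertex)}
    (h : ∀ i, ar (Γ (y i)) = 0) : boxLang Γ y B LM LU = List.map (bodyMap Γ y) '' LM := by
  refine Set.Subset.antisymm ?_ fun l hl => .inl hl
  rintro l (hl | ⟨i, j, hj, _⟩)
  · exact hl
  · rw [h] at hj; omega

theorem vs_image_mapMoves (g : Vertex → Vertex) (S : Set PSeq) :
    vs '' (mapMoves g '' S) = List.map g '' (vs '' S) := by
  rw [Set.image_image, Set.image_image]
  simp [vs_mapMoves]

theorem vs_getLast? (p : PSeq) : (vs p).getLast? = p.getLast?.map Prod.fst := List.getLast?_map ..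

/-- An `impLK` step is absorbed by inverting its main premise. There all arguments of the
substitution are variables, and substituting the applications back for the fresh variables gives one
instance of the rule `box`. -/
theorem FCK.der {n : ℕ} {Γ : Fin n → Formula} {t : Tm n} {C : Formula} (d : FCK Γ t C) :
    Der Γ t C (vs '' strategyOf d) := by
  induction d with
  | @ax n Γ T D x c hx hT hD =>
    have h0 : ar (Γ x) = 0 := by rw [hx]; rfl
    refine .neut x c (fun _ => .var x) (fun _ => ∅) (by rw [hx]; rfl)
      (by rw [apps_of_zero h0, hT]) hD ?_ fun j hj => by omega
    rw [strategyOf, neutLang, Set.image_insert_eq, Set.image_insert_eq, Set.image_singleton, hx]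
    simp [vs, headV]
  | @impR n Γ T D k hk A M C hC hT hD d ih => exact .lams k hk A M C hC hT hD ih
  | @impLax n Γ T D y k hk A N c hy hT hD d ih =>
    obtain ⟨har, ht, _⟩ := arity_of_eq (atom_notImp c) hy
    obtain ⟨U, LU, e, hU, hLU⟩ := exists_args (atom_notImp c) hy ih
    refine .neut y c U LU ht (by rw [hT, e]) hD ?_ hU
    rw [strategyOf, neutLang, Set.image_union, Set.image_insert_eq, Set.image_insert_eq,
      Set.image_singleton, headV_of_tgt_atom ht har]
    ext l
    constructor
    · rintro (hl | ⟨_, ⟨i, q, hq, _, rfl⟩, rfl⟩)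
      · exact .inl (by simpa [vs] using hl)
      · refine .inr ⟨i, by rw [har]; exact i.2, vs q, by rw [hLU]; exact ⟨q, hq, rfl⟩, ?_⟩
        rw [vs_append, vs_graft]; rfl
    · rintro (hl | ⟨j, hj, m, hm, rfl⟩)
      · exact .inl (by simpa [vs] using hl)
      · rw [har] at hj
        obtain ⟨q, hq, rfl⟩ : m ∈ vs '' strategyOf (d ⟨j, hj⟩) := by rwa [← hLU]
        rcases eq_or_ne q [] with rfl | h0
        · exact .inl (by simp [vs])
        · refine .inr ⟨_, ⟨⟨j, hj⟩, q, hq, h0, rfl⟩, ?_⟩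
          rw [vs_append, vs_graft]; rfl
  | @boxK n Γ T D k M y A C hy hΓ hM hT hD d ih =>
    have h0 : ∀ i, ar (Γ (y i)) = 0 := fun i => by rw [hΓ]; rfl
    refine .box k M y A C (fun i _ => .var (y i)) _ (fun _ _ => ∅) (fun i => by rw [hΓ]; rfl)
      (fun i i' _ e => hy e) hM ?_ hD ?_ ih fun i j hj => by rw [h0] at hj; omega
    · rw [hT]
      congr 1
      funext i
      rw [apps_of_zero (h0 i)]
    · rw [boxLang_of_ar_zero h0, strategyOf, vs_image_mapMoves, boxMap_eq_bodyMap h0]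
  | @impLK n Γ T D k m hm M N N' e f r A U B C he hr hf hN hz hT hD d d₀ ih ih₀ =>
    obtain ⟨k', M', y', B', U', LM, LU', hy', hinj', hM', hT', hL', dM, dU'⟩ := ih₀.inv_box
    injection hT' with _ hk h1 h2
    subst hk
    obtain rfl := eq_of_heq h1
    have h2 := fun i => congrFun (eq_of_heq h2) i
    have hvar : ∀ i z, N' i = .var z →
        y' i = z ∧ ar (Fin.append Γ (fun i => .box (B i)) (y' i)) = 0 := by
      intro i z hz
      have h3 := (h2 i).symm.trans (hz.trans (apps_zero _ (fun i : Fin 0 => i.elim0)).symm)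
      obtain ⟨h4, h5, _⟩ := apps_var_inj h3
      exact ⟨h4, h5⟩
    have h0 : ∀ i, ar (Fin.append Γ (fun i => .box (B i)) (y' i)) = 0 := by
      intro i
      by_cases hi : i ∈ Set.range e
      · obtain ⟨a, rfl⟩ := hi
        exact (hvar _ _ (hN a).2).2
      · obtain ⟨z, _, hz⟩ := hz i hi
        exact (hvar _ _ hz).2
    -- Each argument of the substitution, whether a variable of `Γ` or one of the named
    -- applications, is presented as a head with its arguments. The last clauses say how it is seen
    -- from the main premise.
    have key : ∀ i, ∃ (y : Fin n) (V : ℕ → Tm n) (LV : ℕ → Set (List Vertex)),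
        N i = apps (.var y) (fun j : Fin (ar (Γ y)) => V j) ∧ tgt (Γ y) = .box (B' i) ∧
        (∀ j < ar (Γ y), Der Γ (V j) (argF (Γ y) j) (LV j)) ∧
        (ar (Γ y) = 0 → y' i = Fin.castAdd m y) ∧
        (∀ w, headMap n f r (hypV (y' i) w) = hypV y (conV (ar (Γ y)) w)) ∧
        (0 < ar (Γ y) → ∃ a, e a = i) ∧
        ∀ a, e a = i → y' i = Fin.natAdd n a ∧ y = f a ∧ ar (Γ y) = r a ∧
          ∀ j : Fin (r a), LV j = vs '' strategyOf (d a j) := by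
      intro i
      by_cases hi : i ∈ Set.range e
      · obtain ⟨a, rfl⟩ := hi
        obtain ⟨har, ht, _⟩ := arity_of_eq (box_notImp _) (hf a)
        obtain ⟨V, LV, h3, hV, hLV⟩ := exists_args (box_notImp _) (hf a) (ih a)
        have hya := (hvar _ _ (hN a).2).1
        have hB := hy' (e a)
        rw [hya, Fin.append_right] at hB
        refine ⟨f a, V, LV, by rw [(hN a).1, h3], by rw [ht]; exact hB, hV, ?_, ?_,
          fun _ => ⟨a, rfl⟩,
          ?_⟩
        · intro h; have := hr a; omega
        · intro w; rw [hya, headMap_natAdd, har]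
        · intro a' ha
          obtain rfl := he.injective ha
          exact ⟨hya, rfl, har, hLV⟩
      · obtain ⟨z, hz1, hz2⟩ := hz i hi
        obtain ⟨hyz, _⟩ := hvar _ _ hz2
        have hB := hy' i
        have har := h0 i
        rw [hyz, Fin.append_left] at hB har
        refine ⟨z, fun _ => .var z, fun _ => ∅, by rw [hz1, apps_of_zero har], hB,
          fun j hj => by omega, fun _ => hyz, ?_, fun h => by omega, fun a ha => absurd ⟨a, ha⟩ hi⟩
        intro w
        rw [hyz, headMap_castAdd, har]; rfl
    choose y V LV hNV hyB hV hyz hhd hex hea using key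
    refine .box k M y B' C V LM LV hyB ?_ hM' ?_ hD ?_ dM hV
    · intro i i' h h'
      refine hinj' i i' (h0 i) ?_
      rw [hyz i h, hyz i' (by rwa [← h']), h']
    · rw [hT]
      congr 1
      funext i
      exact hNV i
    · rw [boxLang_of_ar_zero h0] at hL'
      have hmap : headMap n f r ∘ bodyMap (Fin.append Γ (fun i => .box (B i))) y' =
          bodyMap Γ y := by
        funext v
        rw [Function.comp_apply, bodyMap, bodyMap]
        cases splitV k v with
        | inl a => simp only [h0, conV_zero, hhd]
        | inr w => simp only [headMap_conV]
      rw [strategyOf, boxLang, Set.image_union, vs_image_mapMoves, hL', Set.image_image]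
      simp only [List.map_map, hmap]
      ext l
      constructor
      · rintro (hl | ⟨_, ⟨a, j, q, hq, q', hq', _, hlast, rfl⟩, rfl⟩)
        · exact .inl hl
        obtain ⟨hya, hyf, har, hLV⟩ := hea (e a) a rfl
        obtain ⟨q₀, hq₀, eq⟩ : vs q ∈ List.map
            (bodyMap (Fin.append Γ (fun i => .box (B i))) y') '' LM := by
          rw [← hL']; exact ⟨q, hq, rfl⟩
        refine .inr ⟨e a, j, by rw [har]; exact j.2, q₀, hq₀, ?_, vs q', ?_, ?_⟩
        · rw [← vs_getLast?, ← eq, List.getLast?_map, Option.map_eq_some_iff] at hlast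
          obtain ⟨u, hu, hu'⟩ := hlast
          obtain ⟨i', rfl, hi'⟩ := bodyMap_eq_head hy' (x := Fin.natAdd n a)
            ((dM.struct _ hq₀).mv (List.mem_of_getLast? hu)) (by rw [hu', Fin.append_right]; rfl)
          obtain rfl : i' = e a := hinj' _ _ (h0 i') (by rw [hi', hya])
          exact hu
        · rw [hLV]; exact ⟨q', hq', rfl⟩
        · rw [vs_append, vs_graft, vs_mapMoves, ← eq, List.map_map, hmap, hyf]
      · rintro (hl | ⟨i, j, hj, q₀, hq₀, hlast, m', hm', rfl⟩)
        · exact .inl hl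
        obtain ⟨a, rfl⟩ := hex i (by omega)
        obtain ⟨hya, hyf, har, hLV⟩ := hea (e a) a rfl
        obtain ⟨q, hq, eq⟩ : q₀.map (bodyMap (Fin.append Γ (fun i => .box (B i))) y') ∈
            vs '' strategyOf d₀ := by
          rw [hL']; exact ⟨q₀, hq₀, rfl⟩
        rw [har] at hj
        obtain ⟨q', hq', rfl⟩ : m' ∈ vs '' strategyOf (d a ⟨j, hj⟩) := by
          rw [← hLV]; exact hm'
        rcases eq_or_ne q' [] with rfl | hne
        · exact .inl ⟨q₀, hq₀, by simp [vs]⟩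
        · refine .inr ⟨_, ⟨a, ⟨j, hj⟩, q, hq, q', hq', hne, ?_, rfl⟩, ?_⟩
          · rw [← vs_getLast?, eq, List.getLast?_map, hlast, Option.map_some, bodyMap_head hy',
              hya, Fin.append_right]; rfl
          · rw [vs_append, vs_graft, vs_mapMoves, eq, List.map_map, hmap, hyf]

/-! ## Uniqueness of derivations -/

/-- The type separates `impR`, the rules for atoms and the rules for boxes. Within the last two
groups, the presence of an application in the spine or in the substitution selects the rule, and the
premises are then read off the term and the context. -/
theorem FCK.unique {n : ℕ} {Γ : Fin n → Formula} {t : Tm n} {C : Formula} (d d' : FCK Γ t C) :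
    d = d' := by
  have var_apps : ∀ {n k : ℕ} {x y : Fin n} {N : Fin k → Tm n},
      Tm.var x = apps (.var y) N → k = 0 ∧ x = y := by
    intro n k x y N h
    rw [← apps_zero (.var x) (fun i : Fin 0 => i.elim0)] at h
    obtain ⟨h1, h2, _⟩ := apps_var_inj h
    exact ⟨h2.symm, h1⟩
  have atom_box : ∀ {D C : Formula} {c : ℕ}, D = .atom c → D = .box C → False := by
    rintro _ _ _ rfl h
    cases h
  have imps_ne : ∀ {D D' : Formula} {k : ℕ} {A : Fin k → Formula} {C : Formula}, 0 < k →
      D = imps A C → D = D' → D'.NotImp → False := by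
    rintro _ _ _ _ _ hk rfl rfl h
    exact imps_not_notImp hk _ _ h
  induction d with
  | ax x c hx hT hD =>
    cases d' with
    | ax x' c' hx' hT' hD' =>
      obtain rfl := Tm.var.inj (hT.symm.trans hT')
      obtain rfl := Formula.atom.inj (hD.symm.trans hD')
      rfl
    | impR _ hk' _ _ _ _ _ hD' _ => exact (imps_ne hk' hD' hD (atom_notImp c)).elim
    | impLax y k hk A N c' hy hT' hD' _ =>
      exact absurd (var_apps (hT.symm.trans hT')).1 hk.ne'
    | boxK _ _ _ _ _ _ _ _ _ hD' _ => exact (atom_box hD hD').elim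
    | impLK _ _ _ _ _ _ _ _ _ _ _ _ _ _ _ _ _ _ _ hD' _ _ => exact (atom_box hD hD').elim
  | impR k hk A M C hC hT hD d ih =>
    cases d' with
    | ax _ _ _ _ hD' => exact (imps_ne hk hD hD' (atom_notImp _)).elim
    | impR k' hk' A' M' C' hC' hT' hD' d' =>
      obtain ⟨rfl, rfl, rfl⟩ := imps_inj hC hC' (hD.symm.trans hD')
      obtain rfl := lams_inj (hT.symm.trans hT')
      rw [ih d']; rfl
    | impLax _ _ _ _ _ _ _ _ hD' _ => exact (imps_ne hk hD hD' (atom_notImp _)).elim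
    | boxK _ _ _ _ _ _ _ _ _ hD' _ => exact (imps_ne hk hD hD' (box_notImp _)).elim
    | impLK _ _ _ _ _ _ _ _ _ _ _ _ _ _ _ _ _ _ _ hD' _ _ =>
      exact (imps_ne hk hD hD' (box_notImp _)).elim
  | impLax y k hk A N c hy hT hD d ih =>
    cases d' with
    | ax x' c' hx' hT' hD' => exact absurd (var_apps (hT'.symm.trans hT)).1 hk.ne'
    | impR _ hk' _ _ _ _ _ hD' _ => exact (imps_ne hk' hD' hD (atom_notImp c)).elim
    | impLax y' k' hk' A' N' c' hy' hT' hD' d' =>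
      obtain ⟨rfl, rfl, h⟩ := apps_var_inj (hT.symm.trans hT')
      obtain rfl : N = N' := funext h
      obtain rfl := Formula.atom.inj (hD.symm.trans hD')
      obtain ⟨_, _, rfl⟩ := imps_inj (atom_notImp c) (atom_notImp c) (hy.symm.trans hy')
      obtain rfl : d = d' := funext fun i => ih i (d' i)
      rfl
    | boxK _ _ _ _ _ _ _ _ _ hD' _ => exact (atom_box hD hD').elim
    | impLK _ _ _ _ _ _ _ _ _ _ _ _ _ _ _ _ _ _ _ hD' _ _ => exact (atom_box hD hD').elim
  | boxK k M y A C hy hΓ hM hT hD d ih =>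
    cases d' with
    | ax _ _ _ _ hD' => exact (atom_box hD' hD).elim
    | impR _ hk' _ _ _ _ _ hD' _ => exact (imps_ne hk' hD' hD (box_notImp C)).elim
    | impLax _ _ _ _ _ _ _ _ hD' _ => exact (atom_box hD' hD).elim
    | boxK k' M' y' A' C' hy' hΓ' hM' hT' hD' d' =>
      have e := hT.symm.trans hT'
      injection e with _ e1 e2 e3
      subst e1
      obtain rfl := eq_of_heq e2
      obtain rfl : y = y' := funext fun i => Tm.var.inj (congrFun (eq_of_heq e3) i)
      obtain rfl := Formula.box.inj (hD.symm.trans hD')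
      obtain rfl : A = A' := funext fun i => Formula.box.inj ((hΓ i).symm.trans (hΓ' i))
      rw [ih d']
    | impLK k' m hm M' N N' e f r A' U B C' he hr hf hN hz hT' hD' d' d₀ =>
      have e0 := hT.symm.trans hT'
      injection e0 with _ e1 e2 e3
      subst e1
      have h := (congrFun (eq_of_heq e3) (e ⟨0, hm⟩)).trans (hN ⟨0, hm⟩).1
      exact absurd (var_apps h).1 (hr _).ne'
  | @impLK n Γ T D k m hm M N N' e f r A U B C he hr hf hN hz hT hD d d₀ ih ih₀ =>
    cases d' with
    | ax _ _ _ _ hD' => exact (atom_box hD' hD).elim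
    | impR _ hk' _ _ _ _ _ hD' _ => exact (imps_ne hk' hD' hD (box_notImp C)).elim
    | impLax _ _ _ _ _ _ _ _ hD' _ => exact (atom_box hD' hD).elim
    | boxK k' M' y' A' C' hy' hΓ' hM' hT' hD' d' =>
      have e0 := hT'.symm.trans hT
      injection e0 with _ e1 e2 e3
      subst e1
      have h := (congrFun (eq_of_heq e3) (e ⟨0, hm⟩)).trans (hN ⟨0, hm⟩).1
      exact absurd (var_apps h).1 (hr _).ne'
    | impLK k' m' hm' M' N₂ N₂' e' f' r' A' U' B' C' he' hr' hf' hN' hz' hT' hD' d' d₀' =>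
      have e0 := hT.symm.trans hT'
      injection e0 with _ e1 e2 e3
      subst e1
      obtain rfl := eq_of_heq e2
      obtain rfl := eq_of_heq e3
      obtain rfl := Formula.box.inj (hD.symm.trans hD')
      -- The positions `e` are exactly those of the applications, and a strictly increasing
      -- enumeration of a set is unique.
      have hsub : ∀ {m m' : ℕ} {e : Fin m → Fin k} {e' : Fin m' → Fin k} {f : Fin m → Fin n}
          {r : Fin m → ℕ} {U : ∀ i, Fin (r i) → Tm n}, (∀ i, 0 < r i) →
          (∀ i, N (e i) = apps (.var (f i)) (U i)) →
          (∀ j, j ∉ Set.range e' → ∃ z : Fin n, N j = .var z) → Set.range e ⊆ Set.range e' := by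
        rintro m m' e e' f r U hr hN hz _ ⟨i, rfl⟩
        by_contra hi
        obtain ⟨z, hz⟩ := hz _ hi
        exact (hr i).ne' (var_apps (hz.symm.trans (hN i))).1
      have hrange : Set.range e = Set.range e' :=
        (hsub hr (fun i => (hN i).1) fun j hj => ⟨_, (hz' j hj).choose_spec.1⟩).antisymm
          (hsub hr' (fun i => (hN' i).1) fun j hj => ⟨_, (hz j hj).choose_spec.1⟩)
      obtain rfl : m = m' := by
        have h1 := Set.ncard_range_of_injective he.injective
        have h2 := Set.ncard_range_of_injective he'.injective
        rw [hrange, h2] at h1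
        simpa using h1.symm
      obtain rfl : e = e' := (he.range_inj he').1 hrange
      have h := fun i => apps_var_inj ((hN i).1.symm.trans (hN' i).1)
      obtain rfl : f = f' := funext fun i => (h i).1
      obtain rfl : r = r' := funext fun i => (h i).2.1
      obtain rfl : U = U' := funext fun i => funext (h i).2.2
      have h2 := fun i => imps_inj (box_notImp _) (box_notImp _) ((hf i).symm.trans (hf' i))
      obtain rfl : A = A' := funext fun i => (h2 i).2.2
      obtain rfl : B = B' := funext fun i => Formula.box.inj (h2 i).2.1
      obtain rfl : N' = N₂' := by
        funext j
        by_cases hj : j ∈ Set.range e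
        · obtain ⟨i, rfl⟩ := hj
          rw [(hN i).2, (hN' i).2]
        · obtain ⟨z, h1, h2⟩ := hz j hj
          obtain ⟨z', h1', h2'⟩ := hz' j hj
          rw [h2, h2', Tm.var.inj (h1.symm.trans h1')]
      rw [ih₀ d₀']
      obtain rfl : d = d' := funext fun i => funext fun j => ih i j (d' i j)
      rfl

/-! ## The language of an explicit substitution of variables -/

section
variable {n k : ℕ} {Γ : Fin n → Formula} {y : Fin k → Fin n} {B : Fin k → Formula} {C : Formula}
  {LM : Set (List Vertex)}

theorem bodyMap_inj (hinj : Function.Injective y) {a b : Vertex}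
    (ha : (∃ w, a = conV k w) ∨ ∃ (i : Fin k) (w : Vertex), a = hypV i w)
    (hb : (∃ w, b = conV k w) ∨ ∃ (i : Fin k) (w : Vertex), b = hypV i w)
    (e : bodyMap Γ y a = bodyMap Γ y b) : a = b := by
  rcases ha with ⟨w, rfl⟩ | ⟨i, w, rfl⟩ <;> rcases hb with ⟨w', rfl⟩ | ⟨i', w', rfl⟩
  · rw [bodyMap_conV, bodyMap_conV, conV_inj] at e
    rw [(List.cons.inj e).2]
  · rw [bodyMap_conV, bodyMap_hypV] at e
    exact absurd e.symm (hypV_ne_conV (y i').2 _ _)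
  · rw [bodyMap_conV, bodyMap_hypV] at e
    exact absurd e (hypV_ne_conV (y i).2 _ _)
  · rw [bodyMap_hypV, bodyMap_hypV] at e
    obtain ⟨e1, e2⟩ := hypV_inj.1 e
    obtain rfl := hinj (Fin.ext e1)
    rw [conV_inj] at e2
    rw [(List.cons.inj e2).2]

theorem Mv.shape {v : Vertex} (h : Mv (imps B C) v) :
    (∃ w, v = conV k w) ∨ ∃ (i : Fin k) (w : Vertex), v = hypV i w := vertex_cases h.isVertex

theorem map_bodyMap_inj (hinj : Function.Injective y) {l l' : List Vertex}
    (hl : Struct (imps B C) l) (hl' : Struct (imps B C) l')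
    (e : l.map (bodyMap Γ y) = l'.map (bodyMap Γ y)) : l = l' :=
  map_inj_of e fun _ ha _ hb => bodyMap_inj hinj (hl.mv ha).shape (hl'.mv hb).shape

theorem mv_box {F : Formula} {w : Vertex} (h : Mv (.box F) w) : ∃ w', w = true :: w' ∧ Mv F w' := by
  match w, h with
  | [], h => simp [Mv, label] at h
  | [false], h => simp [Mv, label] at h
  | false :: _ :: _, h => simp [Mv, label] at h
  | true :: w, h => exact ⟨w, rfl, h⟩

theorem bodyMap_child (hΓ : ∀ i, Γ (y i) = .box (B i)) {u s : Vertex} (hu : Mv (imps B C) u)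
    (hu0 : u ≠ headV (imps B C)) (hinj : Function.Injective y)
    (hs : Mv (imps Γ (.box C)) s) (hs0 : s ≠ headV (imps Γ (.box C)))
    (hp : par (imps Γ (.box C)) s = bodyMap Γ y u) :
    ∃ v, Mv (imps B C) v ∧ v ≠ headV (imps B C) ∧ par (imps B C) v = u ∧ s = bodyMap Γ y v := by
  have h0 : ∀ i, ar (Γ (y i)) = 0 := fun i => by rw [hΓ]; rfl
  have emb := emb_bodyMap (Γ := Γ) (y := y) (B := B) C fun i => by rw [hΓ]; rfl
  suffices ∃ v, Mv (imps B C) v ∧ s = bodyMap Γ y v by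
    obtain ⟨v, hv, rfl⟩ := this
    have hv0 : v ≠ headV (imps B C) := fun e => hs0 (by rw [e, emb.head])
    refine ⟨v, hv, hv0, ?_, rfl⟩
    rw [(emb.par v hv hv0).2] at hp
    exact bodyMap_inj hinj (mv_par hv).shape hu.shape hp
  rcases hs.cases with ⟨w, rfl, hw⟩ | ⟨x, w, rfl, hw⟩
  · obtain ⟨w, rfl, hw⟩ := mv_box hw
    exact ⟨conV k w, mv_conV.2 hw, (bodyMap_conV _ _ _).symm⟩
  · rw [par_hypV] at hp
    split at hp
    · have : bodyMap Γ y u = bodyMap Γ y (headV (imps B C)) := by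
        rw [← hp, emb.head, headV_imps]
      exact absurd (bodyMap_inj hinj hu.shape (mv_headV _).shape this) hu0
    · obtain ⟨i, w', rfl, rfl, _⟩ := bodyMap_eq_hypV hu hp.symm
      rw [hΓ] at hw
      obtain ⟨w, rfl, hw⟩ := mv_box hw
      refine ⟨hypV i w, mv_hypV.2 hw, ?_⟩
      rw [bodyMap_hypV, h0]; rfl

/-- When the arguments are distinct variables, `bodyMap` is injective and the arena of the body is
the whole arena used by the strategy, with one box added around each formula. The added boxes are
linked only among themselves. -/
theorem LW.body_image (h : LW (imps B C) LM) (hinj : Function.Injective y)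
    (hΓ : ∀ i, Γ (y i) = .box (B i)) :
    LW (imps Γ (.box C)) (List.map (bodyMap Γ y) '' LM) := by
  have hy : ∀ i, tgt (Γ (y i)) = .box (B i) := fun i => by rw [hΓ]; rfl
  have emb := emb_bodyMap C hy
  have split : ∀ {q l : List Vertex} {v : Vertex}, q.map (bodyMap Γ y) = l ++ [v] →
      ∃ q₀ v₀, q = q₀ ++ [v₀] ∧ l = q₀.map (bodyMap Γ y) ∧ v = bodyMap Γ y v₀ := by
    intro q l v e
    rcases List.eq_nil_or_concat' q with rfl | ⟨q, u, rfl⟩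
    · simp at e
    · rw [List.map_append] at e
      obtain ⟨rfl, e2⟩ := List.append_inj' e rfl
      exact ⟨q, u, rfl, rfl, (List.cons.inj e2).1.symm⟩
  have split2 : ∀ {q l : List Vertex} {u v : Vertex}, q.map (bodyMap Γ y) = l ++ [u, v] →
      ∃ q₀ u₀ v₀, q = q₀ ++ [u₀, v₀] ∧ l = q₀.map (bodyMap Γ y) ∧ u = bodyMap Γ y u₀ ∧
        v = bodyMap Γ y v₀ := by
    intro q l u v e
    rw [List.append_cons] at e
    obtain ⟨q₁, v₀, rfl, e1, rfl⟩ := split e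
    obtain ⟨q₀, u₀, rfl, rfl, rfl⟩ := split e1.symm
    exact ⟨q₀, u₀, v₀, by simp, rfl, rfl, rfl⟩
  refine ⟨h.fin.image _, ⟨[], h.nil, rfl⟩, ?_, ?_, ?_, ⟨_, h.init, ?_⟩, ?_, ?_, ?_, ?_, ?_, ?_⟩
  · rintro l v ⟨q, hq, e⟩
    obtain ⟨q, v, rfl, rfl, rfl⟩ := split e
    exact ⟨q, h.pre _ _ hq, rfl⟩
  · rintro _ ⟨q, hq, rfl⟩
    exact emb.struct (h.struct q hq)
  · rintro _ ⟨q, hq, rfl⟩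
    have hs := h.struct q hq
    exact (h.nodup q hq).map_on fun a ha b hb => bodyMap_inj hinj (hs.mv ha).shape (hs.mv hb).shape
  · rw [List.map_singleton, emb.head]
  · rintro l u v ⟨q, hq, e⟩ ho hv hv0 hp
    obtain ⟨q, u, rfl, rfl, rfl⟩ := split e
    rw [List.length_map] at ho
    have hu0 : u ≠ headV (imps B C) := by
      rintro rfl
      have := (h.parity _ _ hq).1 (by rw [depth_headV]; exact Even.zero)
      exact (Nat.not_even_iff_odd.2 ho) this
    obtain ⟨v, hv', hv0', rfl, rfl⟩ := bodyMap_child hΓ ((h.struct _ hq).mv (by simp)) hu0 hinj hv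
      hv0 hp
    exact ⟨_, h.opp _ _ _ hq ho hv' hv0' rfl, by simp⟩
  · rintro l u v ⟨q, hq, e⟩ ho
    obtain ⟨q, u, v, rfl, rfl, rfl, rfl⟩ := split2 e
    rw [List.length_map] at ho
    obtain rfl := h.oppar _ _ _ hq ho
    have hs := h.struct _ hq
    have hv0 : v ≠ headV (imps B C) := by
      rw [List.append_cons] at hs
      exact ((Struct.snoc_iff.1 hs).resolve_left (by simp)).2.2.2.1
    exact (emb.par v (hs.mv (by simp)) hv0).2
  · rintro l v ⟨q, hq, e⟩
    obtain ⟨q, v, rfl, rfl, rfl⟩ := split e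
    rw [emb.parity v ((h.struct _ hq).mv (by simp)), List.length_map]
    exact h.parity _ _ hq
  · rintro _ ⟨q, hq, rfl⟩ ho
    rw [List.length_map] at ho
    obtain ⟨v, hv, hu⟩ := h.player q hq ho
    refine ⟨bodyMap Γ y v, ⟨_, hv, by simp⟩, ?_⟩
    rintro s ⟨q', hq', e⟩
    obtain ⟨q', v', rfl, e1, rfl⟩ := split e
    obtain rfl := map_bodyMap_inj hinj (h.struct _ hq) (h.struct _ hq').pre e1
    rw [hu v' hq']
  · rintro l u v ⟨q, hq, e⟩ he
    obtain ⟨q, u, v, rfl, rfl, rfl, rfl⟩ := split2 e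
    rw [List.length_map] at he
    have hu := (h.struct _ hq).mv (v := u) (by simp)
    have hv := (h.struct _ hq).mv (v := v) (by simp)
    obtain ⟨h1, h2⟩ := h.lab _ _ _ hq he
    obtain ⟨b, -, hb⟩ := addr_bodyMap (C := C) hy hu
    obtain ⟨b', -, hb'⟩ := addr_bodyMap (C := C) hy hv
    rw [emb.label _ hu, emb.label _ hv, hb, hb', h1]
    simp [h2]
  · rintro _ ⟨q, hq, rfl⟩ u w huw hu hw
    -- The added boxes are never images of vertices of the body, so a class consists of added boxes
    -- only or is the image of a class of the body.
    let Outer : Vertex → Prop := fun b =>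
      b = conV n [false] ∨ ∃ i, b = hypV (y i) (conV (ar (Γ (y i))) [false])
    let Shape : Vertex → Prop := fun v =>
      (∃ w, v = conV k w) ∨ ∃ (i : Fin k) (w : Vertex), v = hypV i w
    have hdisj : ∀ a, Shape a → ¬ Outer (bodyMap Γ y a) := by
      rintro a (⟨w, rfl⟩ | ⟨i, w, rfl⟩) (e | ⟨i', e⟩)
      · rw [bodyMap_conV, conV_inj] at e; simp at e
      · rw [bodyMap_conV] at e
        exact hypV_ne_conV (y i').2 _ _ e.symm
      · rw [bodyMap_hypV] at e
        exact hypV_ne_conV (y i).2 _ _ e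
      · rw [bodyMap_hypV] at e
        obtain ⟨e1, e2⟩ := hypV_inj.1 e
        rw [Fin.ext e1, conV_inj] at e2
        simp at e2
    have hshape : ∀ v ∈ q, ∀ (i : ℕ) (b : Vertex), (addr (imps B C) v)[i]? = some b → Shape b := by
      intro v hv i b hb
      rcases ((h.struct q hq).mv hv).shape with ⟨w, rfl⟩ | ⟨x, w, rfl⟩
      · rw [addr_conV, List.getElem?_map, Option.map_eq_some_iff] at hb
        obtain ⟨b, _, rfl⟩ := hb
        exact .inl ⟨b, rfl⟩
      · rw [addr_hypV, List.getElem?_map, Option.map_eq_some_iff] at hb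
        obtain ⟨b, _, rfl⟩ := hb
        exact .inr ⟨x, b, rfl⟩
    have key : u = w ∨ (Outer u ∧ Outer w) ∨ ∃ a b, Shape a ∧ Shape b ∧ u = bodyMap Γ y a ∧
        w = bodyMap Γ y b ∧ Relation.EqvGen (Lk (imps B C) q) a b := by
      clear hu hw
      induction huw with
      | rel a b hab =>
        right
        obtain ⟨l', o, p, h1, ⟨r, hr⟩, h3⟩ := hab
        obtain ⟨q₁, q₂, rfl, e1, _⟩ := List.map_eq_append_iff.1 hr.symm
        obtain ⟨l, o, p, rfl, rfl, rfl, rfl⟩ := split2 e1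
        rw [List.length_map] at h1
        have ho : o ∈ l ++ [o, p] ++ q₂ := by simp
        have hp : p ∈ l ++ [o, p] ++ q₂ := by simp
        have hmo := (h.struct _ hq).mv ho
        have hmp := (h.struct _ hq).mv hp
        rcases h3 with ⟨rfl, rfl⟩ | ⟨i, h4, h5⟩
        · exact .inr ⟨o, p, hmo.shape, hmp.shape, rfl, rfl,
            .rel _ _ ⟨l, o, p, h1, List.prefix_append _ _, .inl ⟨rfl, rfl⟩⟩⟩
        · obtain ⟨c, hc, ec⟩ := addr_bodyMap (C := C) hy hmo
          obtain ⟨c', hc', ec'⟩ := addr_bodyMap (C := C) hy hmp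
          rw [ec] at h4
          rw [ec'] at h5
          cases i with
          | zero =>
            simp only [List.getElem?_cons_zero, Option.some_inj] at h4 h5
            subst h4 h5
            exact .inl ⟨hc, hc'⟩
          | succ i =>
            rw [List.getElem?_cons_succ, List.getElem?_map, Option.map_eq_some_iff] at h4 h5
            obtain ⟨a, ha, rfl⟩ := h4
            obtain ⟨b, hb, rfl⟩ := h5
            exact .inr ⟨a, b, hshape o ho i a ha, hshape p hp i b hb, rfl, rfl,
              .rel _ _ ⟨l, o, p, h1, List.prefix_append _ _, .inr ⟨i, ha, hb⟩⟩⟩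
      | refl a => exact .inl rfl
      | symm a b _ ih =>
        rcases ih with rfl | ⟨h1, h2⟩ | ⟨a, b, h1, h2, rfl, rfl, h3⟩
        · exact .inl rfl
        · exact .inr (.inl ⟨h2, h1⟩)
        · exact .inr (.inr ⟨b, a, h2, h1, rfl, rfl, .symm _ _ h3⟩)
      | trans a b c _ _ ih1 ih2 =>
        rcases ih1 with rfl | ⟨h1, h2⟩ | ⟨a, b, h1, h2, rfl, rfl, h3⟩
        · exact ih2
        · rcases ih2 with rfl | ⟨h1', h2'⟩ | ⟨a', b', h1', h2', rfl, rfl, h3'⟩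
          · exact .inr (.inl ⟨h1, h2⟩)
          · exact .inr (.inl ⟨h1, h2'⟩)
          · exact absurd h2 (hdisj _ h1')
        · rcases ih2 with rfl | ⟨h1', h2'⟩ | ⟨a', b', h1', h2', e, rfl, h3'⟩
          · exact .inr (.inr ⟨a, b, h1, h2, rfl, rfl, h3⟩)
          · exact absurd h1' (hdisj _ h2)
          · obtain rfl := bodyMap_inj hinj h2 h1' e
            exact .inr (.inr ⟨a, b', h1, h2', rfl, rfl, .trans _ _ _ h3 h3'⟩)
    -- The added boxes of the hypotheses have depth `1`; only that of the conclusion has even depth.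
    have hout : ∀ b, Outer b → Even (depth (imps Γ (.box C)) b) → b = conV n [false] := by
      rintro b (rfl | ⟨i, rfl⟩) hb
      · rfl
      · rw [depth_hypV, depth_tgt, hy] at hb
        simp [depth] at hb
    rcases key with rfl | ⟨h1, h2⟩ | ⟨a, b, h1, h2, rfl, rfl, h3⟩
    · rfl
    · rw [hout u h1 hu, hout w h2 hw]
    · rw [depth_bodyMap hy h1] at hu
      rw [depth_bodyMap hy h2] at hw
      rw [h.link q hq a b h3 hu hw]

end

/-! ## Construction of `FCK`-derivations -/

theorem measureOf_lt {n n' : ℕ} {Γ : Fin n → Formula} {Γ' : Fin n' → Formula} {t : Tm n}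
    {t' : Tm n'} {C C' : Formula} {d : FCK Γ t C} {d' : FCK Γ' t' C'}
    (h : (strategyOf d).ncard < (strategyOf d').ncard ∨
      (strategyOf d).ncard = (strategyOf d').ncard ∧ C.size < C'.size) :
    measureOf d < measureOf d' := by
  rw [measureOf, measureOf, Prod.Lex.toLex_lt_toLex]
  exact h

theorem image_ptr_bodyMap {n k : ℕ} {Γ : Fin n → Formula} {y : Fin k → Fin n}
    {B : Fin k → Formula} {C : Formula} {LM : Set (List Vertex)}
    (hy : ∀ i, tgt (Γ (y i)) = .box (B i)) (hs : ∀ l ∈ LM, Struct (imps B C) l)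
    (hn : ∀ l ∈ LM, (l.map (bodyMap Γ y)).Nodup) :
    mapMoves (bodyMap Γ y) '' (ptr (imps B C) '' LM) =
      ptr (imps Γ (.box C)) '' (List.map (bodyMap Γ y) '' LM) := by
  rw [Set.image_image, Set.image_image]
  exact Set.image_congr fun l hl => ((emb_bodyMap C hy).ptr (hs l hl) (hn l hl)).symm

/-- The strategy is described twice: as an image under `boxMap`, to be composed with `headMap` when
this derivation is the main premise of `impLK`, and as the pointed views of a language, to apply
`ckwis_of_lw`. The number of views is unchanged by the rule and the conclusion loses its box. -/
theorem exists_fck_box {n k : ℕ} {Γ : Fin n → Formula} {y : Fin k → Fin n}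
    {B : Fin k → Formula} {C : Formula} {M : Tm k} {LM : Set (List Vertex)}
    (hinj : Function.Injective y) (hΓ : ∀ i, Γ (y i) = .box (B i)) (hM : ∀ x, Occurs M x)
    (h : LW (imps B C) LM) (d : FCK B M C) (hd : strategyOf d = ptr (imps B C) '' LM)
    (hb : BuiltByInduction d) :
    ∃ d₀ : FCK Γ (.esub M fun i => .var (y i)) (.box C),
      strategyOf d₀ = mapMoves (boxMap n y) '' (ptr (imps B C) '' LM) ∧
      strategyOf d₀ = ptr (imps Γ (.box C)) '' (List.map (bodyMap Γ y) '' LM) ∧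
      BuiltByInduction d₀ := by
  have h0 : ∀ i, ar (Γ (y i)) = 0 := fun i => by rw [hΓ]; rfl
  have himg := h.body_image hinj hΓ
  have e1 : strategyOf (FCK.boxK k M y B C hinj hΓ hM rfl rfl d) =
      mapMoves (boxMap n y) '' (ptr (imps B C) '' LM) := by rw [strategyOf, hd]
  have e2 := e1
  rw [boxMap_eq_bodyMap h0, image_ptr_bodyMap (fun i => by rw [hΓ]; rfl) h.struct
    fun l hl => himg.nodup _ ⟨l, hl, rfl⟩] at e2
  refine ⟨.boxK k M y B C hinj hΓ hM rfl rfl d, e1, e2, ?_⟩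
  rw [BuiltByInduction]
  refine ⟨e2 ▸ ckwis_of_lw himg, measureOf_lt (.inr ⟨?_, Nat.lt_succ_self _⟩), hb⟩
  rw [e2, hd, ncard_ptr, ncard_ptr, Set.InjOn.ncard_image]
  exact fun l hl l' hl' => map_bodyMap_inj hinj (h.struct l hl) (h.struct l' hl')

/-- By `Der.canonical`, arguments with the same head and the same languages are congruent, against
distinctness. -/
theorem Der.keyInj {n k : ℕ} {Γ : Fin n → Formula} {y : Fin k → Fin n} {U : Fin k → ℕ → Tm n}
    {M : Tm k} {LU : Fin k → ℕ → Set (List Vertex)}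
    (dU : ∀ i, ∀ j < ar (Γ (y i)), Der Γ (U i j) (argF (Γ (y i)) j) (LU i j))
    (h : ∀ i, ∀ j < ar (Γ (y i)), LW (imps Γ (argF (Γ (y i)) j)) (LU i j))
    (ht : Dst (.esub M fun i => apps (.var (y i)) (fun j : Fin (ar (Γ (y i))) => U i j))) :
    KeyInj Γ y LU := by
  obtain ⟨_, htN, htU⟩ := ht
  intro i i' e hU
  refine htU i i' (Sim.apps_var e fun j hj => ?_)
  refine (dU i j hj).canonical ?_ (h i j hj) (dst_apps.1 (htN i) ⟨j, hj⟩)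
    (dst_apps.1 (htN i') ⟨j, e ▸ hj⟩)
  rw [hU j hj, e]
  exact dU i' j (e ▸ hj)

/-- A derivation that treats all the arguments of an explicit substitution at once is an
`FCK`-derivation with the same strategy. -/
theorem Der.exists_fck {n : ℕ} {Γ : Fin n → Formula} {t : Tm n} {C : Formula}
    {L : Set (List Vertex)} (d : Der Γ t C L) (h : LW (imps Γ C) L) (ht : Dst t) :
    ∃ d : FCK Γ t C, strategyOf d = ptr (imps Γ C) '' L ∧ BuiltByInduction d := by
  induction d with
  | @neut n Γ T D L y c U LU hy hT hD hL dU ih =>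
    subst hD hT
    have hh := headV_atom_tgt hy
    have hq := struct_neut (Γ := Γ) y c
    have hbase : [conV n [], hypV y (headV (Γ y))] ∈ L := hL ▸ .inl (.inr (.inr rfl))
    have hp0 : ptr (imps Γ (.atom c)) [conV n []] = [(conV n [], 0)] := by
      rw [← show headV (imps Γ (.atom c)) = conV n [] from headV_imps _ _]
      simp [ptr, par_headV]
    have hp1 : ptr (imps Γ (.atom c)) [conV n [], hypV y (headV (Γ y))] =
        [(conV n [], 0), (hypV y (headV (Γ y)), 0)] := by
      have e : par (imps Γ (.atom c)) (conV n []) = conV n [] := par_conV _ _ _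
      simp [ptr, e, par_hypV, headV]
    have hbase3 : ptr (imps Γ (.atom c)) ''
        {[], [conV n []], [conV n [], hypV y (headV (Γ y))]} =
        {[], [(conV n [], 0)], [(conV n [], 0), (hypV y (headV (Γ y)), 0)]} := by
      rw [Set.image_insert_eq, Set.image_insert_eq, Set.image_singleton, hp0, hp1]; rfl
    rw [dst_apps] at ht
    -- A neutral term without arguments is an axiom of `FCK`.
    rcases Nat.eq_zero_or_pos (ar (Γ y)) with h0 | hpos
    · have hyc : Γ y = .atom c := by rw [← tgt_of_ar_zero h0, hy]
      have hL3 : L = {[], [conV n []], [conV n [], hypV y (headV (Γ y))]} := by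
        rw [hL]
        refine Set.Subset.antisymm ?_ fun l hl => .inl hl
        rintro l (hl | ⟨j, hj, _⟩)
        · exact hl
        · omega
      have e1 : strategyOf (FCK.ax (T := apps (.var y) (fun j : Fin (ar (Γ y)) => U j)) y c hyc
          (apps_of_zero h0 _ _) rfl) = ptr (imps Γ (.atom c)) '' L := by
        rw [strategyOf, hL3, hbase3, hyc]; rfl
      refine ⟨_, e1, ?_⟩
      rw [BuiltByInduction, e1]
      exact ckwis_of_lw h
    · have hlw : ∀ j < ar (Γ y), LW (imps Γ (argF (Γ y) j)) (LU j) ∧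
          (LU j).ncard < L.ncard := by
        intro j hj
        rw [← neutLang_argLang dU hL h hj]
        exact ⟨h.neut_arg hbase hj, h.ncard_arg_lt rfl⟩
      have ih := fun j : Fin (ar (Γ y)) => ih j j.2 (hlw j j.2).1 (ht j)
      choose d hd hb using ih
      have e1 : strategyOf (FCK.impLax y (ar (Γ y)) hpos _ _ c
          (by rw [← hy, imps_tgt]) rfl rfl d) = ptr (imps Γ (.atom c)) '' L := by
        have hg : ∀ j < ar (Γ y), ∀ m ∈ LU j, ptr (imps Γ (.atom c))
            ([conV n [], hypV y (headV (Γ y))] ++ m.map (argMap n y j)) =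
            [(conV n [], 0), (hypV y (headV (Γ y)), 0)] ++
              graft n (hypV y (hypV j [])) 2 (ptr (imps Γ (argF (Γ y) j)) m) := by
          intro j hj m hm
          rw [ptr_graft hj hq rfl ((dU j hj).struct m hm)
            (h.nodup _ (hL ▸ .inr ⟨j, hj, m, hm, rfl⟩)), hp1]
          rfl
        rw [strategyOf, ← hh, hL, neutLang, Set.image_union, hbase3]
        ext p
        constructor
        · rintro (hp | ⟨i, q, hq', _, rfl⟩)
          · exact .inl hp
          · rw [hd] at hq'
            obtain ⟨m, hm, rfl⟩ := hq'
            exact .inr ⟨_, ⟨i, i.2, m, hm, rfl⟩, hg i i.2 m hm⟩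
        · rintro (hp | ⟨_, ⟨j, hj, m, hm, rfl⟩, rfl⟩)
          · exact .inl hp
          · rcases eq_or_ne m [] with rfl | hm0
            · rw [List.map_nil, List.append_nil, hp1]
              exact .inl (.inr (.inr rfl))
            · refine .inr ⟨⟨j, hj⟩, ptr _ m, ?_, by simpa [ptr] using hm0, hg j hj m hm⟩
              rw [hd]
              exact ⟨m, hm, rfl⟩
      refine ⟨_, e1, ?_⟩
      rw [BuiltByInduction, e1]
      refine ⟨ckwis_of_lw h, fun i => ⟨measureOf_lt (.inl ?_), hb i⟩⟩
      rw [e1, hd, ncard_ptr, ncard_ptr]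
      exact (hlw i i.2).2
  | @lams n Γ T D L k hk A M C hC hT hD dM ih =>
    subst hD hT
    obtain ⟨d, hd, hb⟩ := ih (by rwa [imps_append]) (dst_lams.1 ht)
    rw [imps_append] at hd
    have e1 : strategyOf (FCK.impR k hk A M C hC rfl rfl d) = ptr (imps Γ (imps A C)) '' L := by
      rw [strategyOf, hd]
    refine ⟨_, e1, ?_⟩
    rw [BuiltByInduction, e1]
    exact ⟨ckwis_of_lw h, measureOf_lt (.inr ⟨by rw [e1, hd], size_imps hk A C⟩), hb⟩
  | @box n Γ T D L k M y B C U LM LU hy hinj hM hT hD hL dM dU ihM ihU =>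
    subst hD hT
    have hlw := fun i j hj => boxLang_arg_lw hy dM dU hL h hM i (j := j) hj
    have hkey := Der.keyInj dU (fun i j hj => (hlw i j hj).1) ht
    obtain ⟨htM, htN, _⟩ := ht
    have hbody := boxLang_body hy dM dU hL h hkey
    have hLM : LW (imps B C) LM := by
      rw [hbody]
      exact h.body hy hkey (boxLang_covers hy dM dU hL h.nodup)
    have hLMn : ∀ l ∈ LM, (l.map (bodyMap Γ y)).Nodup := fun l hl =>
      h.nodup _ (hL ▸ .inl ⟨l, hl, rfl⟩)
    obtain ⟨d₁, hd₁, hb₁⟩ := ihM hLM htM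
    -- If all arguments are variables a single `boxK` suffices; otherwise the applications are named
    -- first, by `impLK`.
    by_cases hall : ∀ i, ar (Γ (y i)) = 0
    · obtain ⟨d₀, _, hd₀, hb₀⟩ := exists_fck_box (Γ := Γ) (fun i i' e => hinj i i' (hall i) e)
        (fun i => by rw [← hy, tgt_of_ar_zero (hall i)]) hM hLM d₁ hd₁ hb₁
      have eT : (Tm.esub M fun i => apps (.var (y i)) (fun j : Fin (ar (Γ (y i))) => U i j)) =
          .esub M fun i => .var (y i) := by
        congr 1
        funext i
        exact apps_of_zero (hall i) _ _
      rw [eT, hL, boxLang_of_ar_zero hall]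
      exact ⟨d₀, hd₀, hb₀⟩
    obtain ⟨m, e, he, her⟩ : ∃ (m : ℕ) (e : Fin m → Fin k), StrictMono e ∧
        ∀ i, (∃ a, e a = i) ↔ 0 < ar (Γ (y i)) := by
      let P : Finset (Fin k) := Finset.univ.filter fun i => 0 < ar (Γ (y i))
      refine ⟨P.card, P.orderEmbOfFin rfl, (P.orderEmbOfFin rfl).strictMono, fun i => ?_⟩
      have h := Set.ext_iff.1 (Finset.range_orderEmbOfFin P rfl) i
      rw [Set.mem_range] at h
      exact h.trans (by simp [P])
    have hm : 0 < m := by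
      push Not at hall
      obtain ⟨i, hi⟩ := hall
      obtain ⟨a, _⟩ := (her i).2 (Nat.pos_of_ne_zero hi)
      exact a.pos
    have hpos : ∀ a, 0 < ar (Γ (y (e a))) := fun a => (her _).1 ⟨a, rfl⟩
    -- In the main premise, an application is replaced by the fresh hypothesis with its number, and
    -- a variable stays itself. The resulting variables are distinct even if several applications
    -- share their head.
    have hy' : ∀ i, ∃ z : Fin (n + m), (∀ a, e a = i → z = Fin.natAdd n a) ∧
        (ar (Γ (y i)) = 0 → z = Fin.castAdd m (y i)) := by
      intro i
      by_cases hi : ∃ a, e a = i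
      · obtain ⟨a, rfl⟩ := hi
        exact ⟨Fin.natAdd n a, fun a' ha => by rw [he.injective ha],
          fun h0 => absurd h0 (hpos a).ne'⟩
      · exact ⟨Fin.castAdd m (y i), fun a ha => absurd ⟨a, ha⟩ hi, fun _ => rfl⟩
    choose y' hyn hyc using hy'
    have hcase : ∀ i, (∃ a, e a = i) ∨ ar (Γ (y i)) = 0 := fun i => by
      rw [her, or_comm]
      exact Nat.eq_zero_or_pos _
    have hΓ' : ∀ i, Fin.append Γ (fun a => .box (B (e a))) (y' i) = .box (B i) := by
      intro i
      rcases hcase i with ⟨a, rfl⟩ | h0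
      · rw [hyn _ a rfl, Fin.append_right]
      · rw [hyc i h0, Fin.append_left, ← tgt_of_ar_zero h0, hy]
    have hinj' : Function.Injective y' := by
      have hne : ∀ (x : Fin n) (a : Fin m), Fin.castAdd m x ≠ Fin.natAdd n a := by
        intro x a h
        have := congrArg Fin.val h
        simp only [Fin.val_castAdd, Fin.val_natAdd] at this
        have := x.2
        omega
      intro i i' hii
      rcases hcase i with ⟨a, rfl⟩ | h0 <;> rcases hcase i' with ⟨a', rfl⟩ | h0'
      · rw [hyn _ a rfl, hyn _ a' rfl, Fin.natAdd_inj] at hii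
        rw [hii]
      · rw [hyn _ a rfl, hyc _ h0'] at hii
        exact absurd hii.symm (hne _ _)
      · rw [hyn _ a' rfl, hyc _ h0] at hii
        exact absurd hii (hne _ _)
      · rw [hyc _ h0, hyc _ h0', Fin.castAdd_inj] at hii
        exact hinj i i' h0 hii
    obtain ⟨d₀, hd₀, hd₀', hb₀⟩ := exists_fck_box hinj' hΓ' hM hLM d₁ hd₁ hb₁
    have ihU := fun (a : Fin m) (j : Fin (ar (Γ (y (e a))))) =>
      ihU (e a) j j.2 (hlw _ _ j.2).1 (dst_apps.1 (htN (e a)) j)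
    choose d hd hb using ihU
    have ht' : ∀ i, tgt (Fin.append Γ (fun a => .box (B (e a))) (y' i)) = .box (B i) := fun i => by
      rw [hΓ']; rfl
    have h0' : ∀ i, ar (Fin.append Γ (fun a => .box (B (e a))) (y' i)) = 0 := fun i => by
      rw [hΓ']; rfl
    have hmap : headMap n (fun a => y (e a)) (fun a => ar (Γ (y (e a)))) ∘ boxMap (n + m) y' =
        bodyMap Γ y := by
      funext v
      rw [Function.comp_apply, boxMap, bodyMap]
      cases splitV k v with
      | inl b =>
        obtain ⟨i, w⟩ := b
        simp only
        rcases hcase i with ⟨a, rfl⟩ | h0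
        · rw [hyn _ a rfl, headMap_natAdd]
        · rw [hyc _ h0, headMap_castAdd, h0]; rfl
      | inr w => simp only [headMap_conV]
    have hg : ∀ i, ∀ j < ar (Γ (y i)), ∀ q ∈ LM, q.getLast? = some (hypV i (headV (B i))) →
        ∀ l ∈ LU i j, ptr (imps Γ (.box C)) (q.map (bodyMap Γ y) ++ l.map (argMap n (y i) j)) =
          mapMoves (bodyMap Γ y) (ptr (imps B C) q) ++
            graft n (hypV (y i) (hypV j [])) q.length (ptr (imps Γ (argF (Γ (y i)) j)) l) := by
      intro i j hj q hq hlast l hl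
      rw [ptr_graft hj ((emb_bodyMap C hy).struct (hLM.struct q hq))
        (by rw [List.getLast?_map, hlast, Option.map_some, bodyMap_head hy])
        ((dU i j hj).struct l hl) (h.nodup _ (hL ▸ .inr ⟨i, j, hj, q, hq, hlast, l, hl, rfl⟩)),
        (emb_bodyMap C hy).ptr (hLM.struct q hq) (hLMn q hq), List.length_map]
    have hlen : ∀ (g : Vertex → Vertex) (q : List Vertex),
        (mapMoves g (ptr (imps B C) q)).length = q.length := by
      intro g q
      simp [mapMoves, ptr]
    have e1 : strategyOf (FCK.impLK k m hm M
        (fun i => apps (.var (y i)) (fun j : Fin (ar (Γ (y i))) => U i j))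
        (fun i => .var (y' i)) e (fun a => y (e a))
        (fun a => ar (Γ (y (e a)))) _ _ (fun a => B (e a)) C he hpos
        (fun a => by rw [← hy, imps_tgt])
        (fun a => ⟨rfl, congrArg Tm.var (hyn _ a rfl)⟩)
        (fun i hi => ⟨y i, apps_of_zero ((hcase i).resolve_left hi) _ _,
          congrArg Tm.var (hyc i ((hcase i).resolve_left hi))⟩) rfl rfl d d₀) =
        ptr (imps Γ (.box C)) '' L := by
      rw [strategyOf, hd₀]
      have himg : mapMoves (headMap n (fun a => y (e a)) (fun a => ar (Γ (y (e a))))) ''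
          (mapMoves (boxMap (n + m) y') '' (ptr (imps B C) '' LM)) =
          ptr (imps Γ (.box C)) '' (List.map (bodyMap Γ y) '' LM) := by
        rw [Set.image_image]
        simp only [mapMoves_mapMoves, hmap]
        exact image_ptr_bodyMap hy hLM.struct hLMn
      rw [himg, hL, boxLang, Set.image_union]
      ext p
      constructor
      · rintro (hp | ⟨a, j, _, ⟨_, ⟨q, hq, rfl⟩, rfl⟩, q', hq', _, hlast, rfl⟩)
        · exact .inl hp
        · rw [hd] at hq'
          obtain ⟨l, hl, rfl⟩ := hq'
          have hlast' : q.getLast? = some (hypV (e a) (headV (B (e a)))) := by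
            rw [← vs_getLast?, vs_mapMoves, vs_ptr, List.getLast?_map,
              Option.map_eq_some_iff] at hlast
            obtain ⟨u, hu, hu'⟩ := hlast
            rw [boxMap_eq_bodyMap h0'] at hu'
            obtain ⟨i', rfl, hi'⟩ := bodyMap_eq_head ht'
              (x := Fin.natAdd n a) ((hLM.struct _ hq).mv (List.mem_of_getLast? hu))
              (by rw [hu', Fin.append_right]; rfl)
            obtain rfl : i' = e a := hinj' (by rw [hi', hyn _ a rfl])
            exact hu
          refine .inr ⟨_, ⟨e a, j, j.2, q, hq, hlast', l, hl, rfl⟩, ?_⟩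
          rw [hg _ _ j.2 q hq hlast' l hl, mapMoves_mapMoves, hmap, hlen]
      · rintro (hp | ⟨_, ⟨i, j, hj, q, hq, hlast, l, hl, rfl⟩, rfl⟩)
        · exact .inl hp
        · obtain ⟨a, rfl⟩ := (her i).2 (by omega)
          rcases eq_or_ne l [] with rfl | hl0
          · exact .inl ⟨_, ⟨q, hq, rfl⟩, by simp⟩
          · refine .inr ⟨a, ⟨j, hj⟩, _, ⟨_, ⟨q, hq, rfl⟩, rfl⟩,
              ptr (imps Γ (argF (Γ (y (e a))) j)) l, ?_,
              by simpa [ptr] using hl0, ?_, ?_⟩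
            · rw [hd]
              exact ⟨l, hl, rfl⟩
            · rw [← vs_getLast?, vs_mapMoves, vs_ptr, List.getLast?_map, hlast, Option.map_some,
                boxMap_eq_bodyMap h0', bodyMap_head ht', hΓ',
                hyn _ a rfl]
              rfl
            · rw [hg _ _ hj q hq hlast l hl, mapMoves_mapMoves, hmap, hlen]
    -- Some application has a first argument, whose opening move ends a view of `L` that does not
    -- stay inside; so the views of the body do not exhaust `L`.
    have hlt : LM.ncard < L.ncard := by
      rw [← Set.InjOn.ncard_image (f := List.map (bodyMap Γ y)) (s := LM)]
      · obtain ⟨q, hq, hlast⟩ := dM.exists_last (hM (e ⟨0, hm⟩))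
        have hj := hpos ⟨0, hm⟩
        refine Set.ncard_lt_ncard ⟨fun l hl => hL ▸ .inl hl, fun hsub => ?_⟩ h.fin
        have hmem : q.map (bodyMap Γ y) ++ [headV (imps Γ (argF (Γ (y (e ⟨0, hm⟩))) 0))].map
            (argMap n (y (e ⟨0, hm⟩)) 0) ∈ L := hL ▸ .inr ⟨_, 0, hj, q, hq, hlast, _,
          (dU _ 0 hj).nil_mem_and_init_mem.2, rfl⟩
        obtain ⟨l, hl, el⟩ := hsub hmem
        rw [List.map_singleton, headV_argMap] at el
        exact not_inside_arg hj (headV (argF (Γ (y (e ⟨0, hm⟩))) 0))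
          (map_bodyMap_inside hy (hLM.struct l hl) _ (by rw [el]; simp))
      · rw [hbody]
        exact fun l hl l' hl' => bodyLang_inj h hy hkey hl hl'
    refine ⟨_, e1, ?_⟩
    rw [BuiltByInduction, e1]
    refine ⟨ckwis_of_lw h, fun a j => ⟨measureOf_lt (.inl ?_), hb a j⟩, measureOf_lt (.inl ?_), hb₀⟩
    · rw [e1, hd, ncard_ptr, ncard_ptr]
      exact (hlw _ _ j.2).2
    · rw [e1, hd₀', ncard_ptr, ncard_ptr]
      exact (Set.ncard_image_le hLM.fin).trans_lt hlt

end CKGame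

/-! ### The main theorem -/

theorem mainTheorem6 {n : ℕ} (Γ : Fin n → Formula) (C : Formula) (S : Set PSeq)
    (hS : IsCKWIS (imps Γ C) S) (hne : S ≠ {[]}) :
    ∃ T : Term n,
      T ∈ normalTerms n ∩ typableTerms Γ C ∧
      (∀ t : Tm n, ⟦t⟧ = T → ∃ d : FCK Γ t C,
        (∀ d' : FCK Γ t C, d' = d) ∧ strategyOf d = S ∧ BuiltByInduction d) ∧
      (∀ T' ∈ normalTerms n, ∀ t' : Tm n, ⟦t'⟧ = T' →
        ∀ d' : FCK Γ t' C, strategyOf d' = S → T' = T) := by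
  obtain ⟨h, hptr⟩ := lw_of_ckwis hS
  have hSp : ptr (imps Γ C) '' (vs '' S) = S := by
    rw [Set.image_image]
    exact (Set.image_congr fun p hp => (hptr p hp).symm).trans (Set.image_id S)
  obtain ⟨t, ht, d⟩ := exists_der h
  refine ⟨⟦t⟧, ⟨⟨t, rfl, d.normal ht⟩, t, rfl, d.nd⟩, fun t' e => ?_, ?_⟩
  -- The derivation in `Der` is transported to the chosen representative before being turned into an
  -- `FCK`-derivation.
  · have hs : Sim t t' := (Quotient.exact e).sim.symm
    obtain ⟨d', hd', hb⟩ := (d.sim hs).exists_fck h (hs.dst ht)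
    exact ⟨d', fun d'' => FCK.unique d'' d', hd'.trans hSp, hb⟩
  -- Normality is known for some representative `t₀` and typing for another one `t'`; the
  -- distinctness of arguments passes from the first to the second.
  · rintro _ ⟨t₀, rfl, ht₀⟩ t' e d' rfl
    have hs : Sim t₀ t' := (Quotient.exact e).sim.symm
    exact Quotient.sound (s := termSetoid n)
      ((hs.trans (d'.der.canonical d h (hs.dst ht₀.dst) ht)).permEq)
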